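/- Let $\mathbb T=\mathbb R/2\pi\mathbb Z$. For $f:\mathbb T\to\mathbb C$ put $\widehat f(k)=\int_{\mathbb T}f(x)e^{-ikx}\,dx$, let $\mathbb H$ be the Hilbert transform in $x$, $\widehat{\mathbb H[f]}(k)=-i\,\mathrm{sgn}(k)\,\widehat f(k)$ (with $\mathrm{sgn}\,0=0$), let $\|f\|_{H^s(\mathbb T)}^2=\frac1{2\pi}\sum_{k\in\mathbb Z}(1+|k|)^{2s}|\widehat f(k)|^2$, and write $[h;\mathbb H]f=h\,\mathbb H[f]-\mathbb H[hf]$. For $\gamma\ge 1$ let $L^2_\gamma(\mathbb R\times\mathbb T)$ be the space of measurable $f:\mathbb R\times\mathbb T\to\mathbb R$ with $\|f\|_{L^2_\gamma}^2=\int_{\mathbb R\times\mathbb T}e^{-2\gamma t}|f(t,x)|^2\,dx\,dt<\infty$. A function $f(t,x)$ has zero spatial mean if $\int_{\mathbb T}f(t,x)\,dx=0$ for almost every $t$. **Theorem 3.2.** For every $\delta>0$ there is a constant $C_0>0$ depending only on $\delta$, and for every $\delta>0$ and all $a,b\ge 0$ there is a constant $\gamma_0\ge1$ depending only on $\delta,a,b$,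 such that the following holds. Let $\mu\in\mathbb R$, $\delta>0$, and let $\varphi_0:\mathbb R\times\mathbb T\to\mathbb R$ have zero spatial mean and satisfy $$\varphi_0\in L^\infty(\mathbb R;H^3(\mathbb T)),\qquad \varphi_{0,t}\in L^\infty(\mathbb R;H^2(\mathbb T)),\qquad \mu-2\phi_{0,x}\ge\frac{\delta}{2}\ \text{ in }\mathbb R\times\mathbb T,\qquad \phi_0:=\mathbb H[\varphi_0].$$ Take the above constants with $a=\|\varphi_0\|_{L^\infty(\mathbb R;H^3(\mathbb T))}$ and $b=\|\varphi_{0,t}\|_{L^\infty(\mathbb R;H^2(\mathbb T))}$. Then for every $\gamma\ge\gamma_0$ and every $g\in L^2_\gamma(\mathbb R\times\mathbb T)$ with zero spatial mean there exists a unique locally integrable $\varphi':\mathbb R\times\mathbb T\to\mathbb R$ with zero spatial mean, with weak derivatives $\varphi'_t,\varphi'_x\in L^2_\gamma(\mathbb R\times\mathbb T)$, that solves the linearized equation $$\mathbb L'[\varphi_0]\varphi'=\varphi'_{tt}-\mu\varphi'_{xx}-\Big(2\mathbb H[\phi_{0,x}\phi'_x]-[\phi';\mathbb H]\phi_{0,xx}-[\phi_0;\mathbb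 H]\phi'_{xx}\Big)_x=g,\qquad \phi':=\mathbb H[\varphi'],$$ in the sense of distributions on $\mathbb R\times\mathbb T$. Moreover $$\gamma\left\{\|\varphi'_t\|^2_{L^2_\gamma(\mathbb R\times\mathbb T)}+\|\varphi'_x\|^2_{L^2_\gamma(\mathbb R\times\mathbb T)}\right\}\le\frac{C_0}{\gamma}\|g\|^2_{L^2_\gamma(\mathbb R\times\mathbb T)}.$$ -/

import Mathlib

open MeasureTheory

namespace CurrentVortexSheet

noncomputable section

/-! ## The torus and Fourier series -/

instance fact_two_pi_pos : Fact (0 < 2 * Real.pi) := ⟨Real.two_pi_pos⟩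

/-- The torus `ℝ / 2πℤ`. Its `volume` is the measure `dx` of total mass `2π`. -/
abbrev Torus : Type := AddCircle (2 * Real.pi)

/-- The Fourier coefficient `∫ f(x) e^{-ikx} dx` of a real function on the torus. -/
def coeff (f : Torus → ℝ) (k : ℤ) : ℂ :=
  ∫ x, (f x : ℂ) * fourier (-k) x

/-- The Sobolev norm of order `s`, with values in `[0, ∞]`:
its square is `(1 / 2π) ∑ₖ (1 + |k|)^(2s) |coeff f k|²`. -/
def sobolevNorm (s : ℕ) (f : Torus → ℝ) : ENNReal :=
  (ENNReal.ofReal (1 / (2 * Real.pi)) *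
    ∑' k : ℤ, ENNReal.ofReal ((1 + |(k : ℝ)|) ^ (2 * s) * ‖coeff f k‖ ^ 2)) ^ (1 / 2 : ℝ)

/-- `multiplier A f` is the square integrable function, unique up to null sets, whose Fourier
coefficients are `A k * coeff f k`. It is only used where such a function exists. -/
def multiplier (A : ℤ → ℂ) (f : Torus → ℝ) : Torus → ℝ :=
  Classical.epsilon fun h : Torus → ℝ =>
    MemLp h 2 volume ∧ ∀ k : ℤ, coeff h k = A k * coeff f k

/-- The discrete Hilbert transform, the Fourier multiplier with symbol `-i sgn k`. -/
def hilbert (f : Torus → ℝ) : Torus → ℝ :=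
  multiplier (fun k => -Complex.I * (Int.sign k : ℂ)) f

/-- The weak derivative on the torus, the Fourier multiplier with symbol `i k`. -/
def dx (f : Torus → ℝ) : Torus → ℝ :=
  multiplier (fun k => Complex.I * (k : ℂ)) f

/-- The commutator `[h; H] f = h H[f] - H[h f]`. -/
def comm (h f : Torus → ℝ) : Torus → ℝ :=
  fun x => h x * hilbert f x - hilbert (fun y => h y * f y) x

/-! ## Functions of time and space -/

/-- `f(t, ·)` has zero spatial mean for almost every `t`. -/
def ZeroMean (f : ℝ → Torus → ℝ) : Prop :=
  ∀ᵐ t : ℝ, ∫ x, f t x = 0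

/-- The space of functions `f` on `ℝ × 𝕋` such that `e^{-γt} f` is square integrable. -/
def MemL2w (γ : ℝ) (f : ℝ → Torus → ℝ) : Prop :=
  MemLp (fun p : ℝ × Torus => Real.exp (-γ * p.1) * f p.1 p.2) 2 volume

/-- The square of the norm of the weighted space `MemL2w γ`. -/
def normSqL2w (γ : ℝ) (f : ℝ → Torus → ℝ) : ℝ :=
  ∫ p : ℝ × Torus, (Real.exp (-γ * p.1) * f p.1 p.2) ^ 2

/-- The `L^∞(ℝ; H^s(𝕋))` norm, with values in `[0, ∞]`. -/
def normLinftyH (s : ℕ) (f : ℝ → Torus → ℝ) : ENNReal :=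
  essSup (fun t => sobolevNorm s (f t)) volume

/-- The space `L^∞(ℝ; H^s(𝕋))`. -/
structure MemLinftyH (s : ℕ) (f : ℝ → Torus → ℝ) : Prop where
  aestronglyMeasurable : AEStronglyMeasurable (fun p : ℝ × Torus => f p.1 p.2) volume
  memLp : ∀ᵐ t : ℝ, MemLp (f t) 2 volume
  norm_lt_top : normLinftyH s f < ⊤

/-! ## Test functions and weak derivatives -/

/-- The real test functions of class `C_c^∞(ℝ × 𝕋)`; smoothness is that of the lift to `ℝ × ℝ`. -/
structure IsTest (ψ : ℝ → Torus → ℝ) : Prop where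
  smooth : ContDiff ℝ (⊤ : ℕ∞) (fun p : ℝ × ℝ => ψ p.1 (p.2 : Torus))
  compact : ∃ R : ℝ, ∀ t x, R < |t| → ψ t x = 0

/-- The classical derivative in time of a test function. -/
def testDt (ψ : ℝ → Torus → ℝ) (t : ℝ) (x : Torus) : ℝ :=
  deriv (fun s : ℝ => ψ s x) t

/-- The classical derivative in space of a test function. -/
def testDx (ψ : ℝ → Torus → ℝ) (t : ℝ) (x : Torus) : ℝ :=
  deriv (fun y : ℝ => ψ t (x + (y : Torus))) 0

/-- `u` is the weak derivative of `f` with respect to `t` on `ℝ × 𝕋`. -/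
def IsWeakDt (f u : ℝ → Torus → ℝ) : Prop :=
  ∀ ψ : ℝ → Torus → ℝ, IsTest ψ →
    ∫ t : ℝ, ∫ x, f t x * testDt ψ t x = -∫ t : ℝ, ∫ x, u t x * ψ t x

/-- `v` is the weak derivative of `f` with respect to `x` on `ℝ × 𝕋`. -/
def IsWeakDx (f v : ℝ → Torus → ℝ) : Prop :=
  ∀ ψ : ℝ → Torus → ℝ, IsTest ψ →
    ∫ t : ℝ, ∫ x, f t x * testDx ψ t x = -∫ t : ℝ, ∫ x, v t x * ψ t x

/-! ## The linearized equation -/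

/-- The equation
`φ_tt - μ φ_xx - (2 H[Φ₀_x Φ_x] - [Φ; H] Φ₀_xx - [Φ₀; H] Φ_xx)_x = g`,
with `Φ = H[φ]` and `Φ₀ = H[φ₀]`, in the sense of distributions on `ℝ × 𝕋`, for a function `φ`
with weak derivatives `φt`, `φx`; here `Φ_x = H[φx]`.
The distribution `[Φ₀; H] Φ_xx` is the operator `[Φ₀; H] ∂_x` applied to the function `Φ_x`: as
`[Φ₀; H]` is symmetric, its pairing with a function `w` is `-∫ Φ_x ([Φ₀; H] w)_x dx`. -/
def WeakEquation (μ : ℝ) (φ₀ g φ φt φx : ℝ → Torus → ℝ) : Prop :=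
  ∀ ψ : ℝ → Torus → ℝ, IsTest ψ →
    (∫ t : ℝ,
      ((∫ x, -(φt t x * testDt ψ t x))
        + (∫ x, μ * (φx t x * testDx ψ t x))
        + (∫ x, 2 * hilbert (fun y => dx (hilbert (φ₀ t)) y * hilbert (φx t) y) x
            * testDx ψ t x)
        - (∫ x, comm (hilbert (φ t)) (dx (dx (hilbert (φ₀ t)))) x * testDx ψ t x)
        + ∫ x, hilbert (φx t) x * dx (comm (hilbert (φ₀ t)) (testDx ψ t)) x))
      = ∫ t : ℝ, ∫ x, g t x * ψ t x

/-- `φ`, with weak derivatives `φt` and `φx` in the weighted space `MemL2w γ`, is a solution of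
the linearized equation with zero spatial mean. -/
structure IsSolution (μ γ : ℝ) (φ₀ g φ φt φx : ℝ → Torus → ℝ) : Prop where
  locallyIntegrable : LocallyIntegrable (fun p : ℝ × Torus => φ p.1 p.2) volume
  zeroMean : ZeroMean φ
  weakDt : IsWeakDt φ φt
  weakDx : IsWeakDx φ φx
  memDt : MemL2w γ φt
  memDx : MemL2w γ φx
  equation : WeakEquation μ φ₀ g φ φt φx

/-- The assumptions on the basic state `φ₀`, whose weak time derivative is `φ₀t`: zero spatial
mean, `φ₀ ∈ L^∞(ℝ; H³(𝕋))`, `φ₀t ∈ L^∞(ℝ; H²(𝕋))`, and `μ - 2 H[φ₀]_x ≥ δ / 2`. -/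
structure IsBasicState (μ δ : ℝ) (φ₀ φ₀t : ℝ → Torus → ℝ) : Prop where
  zeroMean : ZeroMean φ₀
  mem : MemLinftyH 3 φ₀
  weakDt : IsWeakDt φ₀ φ₀t
  memDt : MemLinftyH 2 φ₀t
  stability : ∀ᵐ t : ℝ, ∀ᵐ x : Torus, δ / 2 ≤ μ - 2 * dx (hilbert (φ₀ t)) x

end

end CurrentVortexSheet

open CurrentVortexSheet

/-!
The equation is solved in terms of the Fourier coefficients `p k (t)` in `x`, and the proof consists
in a weighted energy estimate for the resulting system of ordinary differential equations.

*The equation in Fourier coefficients.* With `c j` the Fourier coefficients of `φ₀` divided by `2π`,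
the linearized equation is `p k'' + k ∑ₗ bKer k l · l p l = g k`, where `bKer k l` is the sum of
`μ` on the diagonal and `lam k l · c (k - l)` (`lam_eq`, `hasSum_spatial`, `hasSum_residual`). The
number `lam k l = -2 |k - l| + rho k l` splits the operator. The first summand, together with `μ`,
is the kernel `aKer` of the multiplication by `μ - 2 Φ₀_x`: it is Hermitian and, by the stability
condition, bounded below by `δ / 2` (`aKer_pos`). The second one is a remainder that comes from the
commutators with the Hilbert transform. It satisfies `rho k l · max(|k|, |l|) ≤ 4 (k - l)²`, hence
gains one derivative of the unknown, or of the test function, at the cost of two derivatives of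
`φ₀`. All kernels are dominated by convolutions with sequences in `ℓ¹`, because `∂ₓ² φ₀` and
`∂ₓ φ₀t` are in `H¹` uniformly in time (`IsBasicState.exists_modeCoeffs`); a form with such a kernel
is bounded on `ℓ²(ℤ; L²(ℝ))` (`FormSum.of_le`).

*Existence and estimate.* With `P = e^{-γt} φ_t` and `Q k = e^{-γt} k p k`, the system reads
`P' + γ P + k B Q = e^{-γt} g` and `Q' + γ Q = k P`. If it is tested by `P`, the symmetric principal
part contributes `γ ‖P‖² + γ (δ / 2) ‖Q‖²`, up to the time derivative of the coefficient and the
remainder, both of which are bounded by `b` and `a` and absorbed for large `γ`. This coercivity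
(`coercive`) is proved for regular test families, and the projection theorem of Lions
(`exists_of_coercive`) turns it into the existence of a weak solution with the desired bound; the
lemma of du Bois-Reymond (`IsWeakDeriv.exists_isPrim`) shows that the weak solution solves the
system (`exists_modeSol`).

*Uniqueness.* For a solution with `g = 0` the derivatives are only known to be in the weighted
spaces, and the equation cannot be tested by `φ_t`. It is tested by `e^{-γt} z` instead, where
`z' = γ z - e^{-γt} φ`, which has the regularity that is needed (`ModeSol.eq_zero`). Uniqueness also
gives the symmetry `p (-k) = conj (p k)`, so the solution is real (`ModeSol.herm`).

Parseval's identity and the theorem of Riesz and Fischer translate between functions and their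
Fourier coefficients, in both directions (`IsSolution.exists_modeSol`,
`ModeSol.exists_isSolution`).
-/

namespace CurrentVortexSheet

noncomputable section

open Set Filter Topology
open scoped ContDiff ENNReal

/-! ### Primitives of locally integrable functions -/

/-- `F` is a primitive of the locally integrable function `f`; equivalently, `F` is locally
absolutely continuous with derivative `f` almost everywhere. -/
structure IsPrim (F f : ℝ → ℂ) : Prop where
  locallyIntegrable : LocallyIntegrable f volume
  sub_eq : ∀ a b : ℝ, F b - F a = ∫ x in a..b, f x

theorem _root_.MeasureTheory.LocallyIntegrable.intervalIntegrable' {f : ℝ → ℂ}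
    (hf : LocallyIntegrable f volume) (a b : ℝ) : IntervalIntegrable f volume a b :=
  intervalIntegrable_iff.mpr
    ((hf.integrableOn_isCompact isCompact_uIcc).mono_set uIoc_subset_uIcc)

namespace IsPrim

variable {F f G g : ℝ → ℂ}

theorem intervalIntegrable (h : IsPrim F f) (a b : ℝ) : IntervalIntegrable f volume a b :=
  h.locallyIntegrable.intervalIntegrable' a b

theorem eq_add (h : IsPrim F f) (a : ℝ) : F = fun b => F a + ∫ x in a..b, f x := by
  funext b
  rw [← h.sub_eq a b]; ring

theorem continuous (h : IsPrim F f) : Continuous F := by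
  rw [h.eq_add 0]
  exact continuous_const.add (intervalIntegral.continuous_primitive h.intervalIntegrable 0)

theorem ae_hasDerivAt (h : IsPrim F f) : ∀ᵐ x, HasDerivAt F (f x) x := by
  filter_upwards [_root_.LocallyIntegrable.ae_hasDerivAt_integral h.locallyIntegrable] with x hx
  rw [h.eq_add 0]
  exact (hx 0).const_add _

theorem of_integral (hf : LocallyIntegrable f volume) (c : ℂ) (a : ℝ) :
    IsPrim (fun b => c + ∫ x in a..b, f x) f := by
  refine ⟨hf, fun s t => ?_⟩
  rw [add_sub_add_left_eq_sub, intervalIntegral.integral_interval_sub_left] <;>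
    exact hf.intervalIntegrable' _ _

theorem of_hasDerivAt (h : ∀ x, HasDerivAt F (f x) x) (hf : Continuous f) : IsPrim F f :=
  ⟨hf.locallyIntegrable, fun a b =>
    (intervalIntegral.integral_eq_sub_of_hasDerivAt (fun x _ => h x)
      (hf.intervalIntegrable a b)).symm⟩

theorem congr_ae (h : IsPrim F f) (hfg : f =ᵐ[volume] g) : IsPrim F g := by
  refine ⟨h.locallyIntegrable.congr hfg, fun a b => ?_⟩
  rw [h.sub_eq]
  exact intervalIntegral.integral_congr_ae (hfg.mono fun x hx _ => hx)

theorem add (hF : IsPrim F f) (hG : IsPrim G g) :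
    IsPrim (fun t => F t + G t) (fun t => f t + g t) := by
  refine ⟨hF.locallyIntegrable.add hG.locallyIntegrable, fun a b => ?_⟩
  rw [intervalIntegral.integral_add (hF.intervalIntegrable a b) (hG.intervalIntegrable a b),
    ← hF.sub_eq, ← hG.sub_eq]
  ring

theorem const_mul (hF : IsPrim F f) (c : ℂ) : IsPrim (fun t => c * F t) (fun t => c * f t) := by
  refine ⟨hF.locallyIntegrable.smul c, fun a b => ?_⟩
  rw [intervalIntegral.integral_const_mul, ← hF.sub_eq]
  ring

theorem sub (hF : IsPrim F f) (hG : IsPrim G g) :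
    IsPrim (fun t => F t - G t) (fun t => f t - g t) := by
  simpa [sub_eq_add_neg] using hF.add (hG.const_mul (-1))

theorem add_const (hF : IsPrim F f) (c : ℂ) : IsPrim (fun t => F t + c) f :=
  ⟨hF.locallyIntegrable, fun a b => by rw [← hF.sub_eq]; ring⟩

theorem conj (hF : IsPrim F f) :
    IsPrim (fun t => starRingEnd ℂ (F t)) (fun t => starRingEnd ℂ (f t)) := by
  refine ⟨?_, fun a b => ?_⟩
  · intro x
    obtain ⟨s, hs, h⟩ := hF.locallyIntegrable x
    exact ⟨s, hs, Complex.conjLIE.toContinuousLinearEquiv.toContinuousLinearMap.integrable_comp h⟩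
  · rw [← map_sub, hF.sub_eq]
    simp only [intervalIntegral, map_sub]
    rw [← integral_conj, ← integral_conj]

theorem absolutelyContinuous (h : IsPrim F f) (a b : ℝ) :
    AbsolutelyContinuousOnInterval F a b := by
  have hi := h.intervalIntegrable a b
  have hre : IntervalIntegrable (fun x => (f x).re) volume a b := ⟨hi.1.re, hi.2.re⟩
  have him : IntervalIntegrable (fun x => (f x).im) volume a b := ⟨hi.1.im, hi.2.im⟩
  have hc : ∀ c : ℂ, AbsolutelyContinuousOnInterval (fun _ : ℝ => c) a b := fun c =>
    (LipschitzOnWith.of_dist_le_mul (K := 0) (by simp)).absolutelyContinuousOnInterval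
  have h1 := (hre.absolutelyContinuousOnInterval_intervalIntegral left_mem_uIcc).smul (hc 1)
  have h2 := (him.absolutelyContinuousOnInterval_intervalIntegral left_mem_uIcc).smul
    (hc Complex.I)
  have h3 := (h1.add h2).add (hc (F a))
  refine (congrArg (AbsolutelyContinuousOnInterval · a b) (funext fun x => ?_)).mp h3
  have hx := h.intervalIntegrable a x
  have e : ∫ t in a..x, f t = (∫ t in a..x, (f t).re : ℝ) + (∫ t in a..x, (f t).im : ℝ) * Complex.I := by
    rw [← intervalIntegral.integral_ofReal, ← intervalIntegral.integral_ofReal,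
      ← intervalIntegral.integral_mul_const, ← intervalIntegral.integral_add]
    · simp [Complex.re_add_im]
    · exact ⟨hx.1.re.ofReal, hx.2.re.ofReal⟩
    · exact IntervalIntegrable.mul_const ⟨hx.1.im.ofReal, hx.2.im.ofReal⟩ _
  have := h.sub_eq a x
  rw [e] at this
  simp only [Pi.add_apply, Pi.smul_apply', Complex.real_smul, mul_one]
  linear_combination -this

theorem mul (hF : IsPrim F f) (hG : IsPrim G g) :
    IsPrim (fun t => F t * G t) (fun t => f t * G t + F t * g t) := by
  have hl : LocallyIntegrable (fun t => f t * G t + F t * g t) volume := by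
    have h1 := hF.locallyIntegrable.smul_continuous hG.continuous
    have h2 := hG.locallyIntegrable.continuous_smul hF.continuous
    exact h1.add h2
  refine ⟨hl, fun a b => ?_⟩
  have hP := of_integral hl 0 a
  have hac := ((hF.absolutelyContinuous a b).smul (hG.absolutelyContinuous a b)).sub
    (hP.absolutelyContinuous a b)
  have h0 : ∀ᵐ x, x ∈ uIcc a b → HasDerivAt
      (F • G - fun b => 0 + ∫ x in a..b, (fun t => f t * G t + F t * g t) x) 0 x := by
    filter_upwards [hF.ae_hasDerivAt, hG.ae_hasDerivAt, hP.ae_hasDerivAt] with x h1 h2 h3 _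
    have := (h1.mul h2).sub h3
    rw [sub_self] at this
    exact this
  obtain ⟨C, hC⟩ := hac.const_of_ae_hasDerivAt_zero h0
  have ha := hC a left_mem_uIcc
  have hb := hC b right_mem_uIcc
  simp only [Pi.sub_apply, smul_eq_mul, Pi.mul_apply, zero_add,
    intervalIntegral.integral_same] at ha hb
  linear_combination hb - ha

theorem exp (γ : ℝ) : IsPrim (fun t : ℝ => (Real.exp (γ * t) : ℂ))
    (fun t => γ * (Real.exp (γ * t) : ℂ)) := by
  refine of_hasDerivAt (fun x => ?_) (by fun_prop)
  have h : HasDerivAt (fun t : ℝ => Real.exp (γ * t)) (γ * Real.exp (γ * x)) x := by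
    have := ((hasDerivAt_id x).const_mul γ).exp
    simpa [mul_comm] using this
  have := h.ofReal_comp
  push_cast at this ⊢
  exact this

/-- A primitive that is integrable over the line, as well as its derivative, vanishes at both
ends; so the derivative has integral zero. -/
theorem integral_eq_zero (h : IsPrim F f) (hF : Integrable F volume) (hf : Integrable f volume) :
    ∫ t, f t = 0 := by
  have e1 := intervalIntegral_tendsto_integral_Ioi (0 : ℝ) hf.integrableOn tendsto_id
  have e2 := intervalIntegral_tendsto_integral_Iic (0 : ℝ) hf.integrableOn tendsto_id
  simp only [id, ← h.sub_eq] at e1 e2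
  have top : Tendsto F atTop (𝓝 ((∫ t in Ioi 0, f t) + F 0)) := by
    simpa using e1.add_const (F 0)
  have bot : Tendsto F atBot (𝓝 (F 0 - ∫ t in Iic 0, f t)) := by
    simpa using (tendsto_const_nhds (x := F 0)).sub e2
  have z1 : (∫ t in Ioi 0, f t) + F 0 = 0 := by
    refine IntegrableAtFilter.eq_zero_of_tendsto (hF.integrableAtFilter atTop)
      (fun s hs => ?_) top
    obtain ⟨b, hb⟩ := mem_atTop_sets.1 hs
    exact top_unique (by simpa using measure_mono (μ := volume) (show Ici b ⊆ s from hb))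
  have z2 : F 0 - ∫ t in Iic 0, f t = 0 := by
    refine IntegrableAtFilter.eq_zero_of_tendsto (hF.integrableAtFilter atBot)
      (fun s hs => ?_) bot
    obtain ⟨b, hb⟩ := mem_atBot_sets.1 hs
    exact top_unique (by simpa using measure_mono (μ := volume) (show Iic b ⊆ s from hb))
  rw [← intervalIntegral.integral_Iic_add_Ioi (b := (0:ℝ)) hf.integrableOn hf.integrableOn]
  linear_combination z1 - z2

end IsPrim

/-! ### Weak derivatives on the line -/

/-- A real test function on the line. -/
structure IsTest1 (η : ℝ → ℝ) : Prop where
  contDiff : ContDiff ℝ ∞ η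
  compact : HasCompactSupport η

theorem IsTest1.deriv {η : ℝ → ℝ} (h : IsTest1 η) : IsTest1 (deriv η) :=
  ⟨(contDiff_infty_iff_deriv.1 h.contDiff).2, h.compact.deriv⟩

theorem IsTest1.continuous {η : ℝ → ℝ} (h : IsTest1 η) : Continuous η := h.contDiff.continuous

theorem IsTest1.hasDerivAt {η : ℝ → ℝ} (h : IsTest1 η) (t : ℝ) :
    HasDerivAt η (_root_.deriv η t) t :=
  (h.contDiff.differentiable (by simp) t).hasDerivAt

theorem IsTest1.ofReal_continuous {η : ℝ → ℝ} (h : IsTest1 η) :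
    Continuous (fun t => (η t : ℂ)) := Complex.continuous_ofReal.comp h.continuous

theorem IsTest1.ofReal_compact {η : ℝ → ℝ} (h : IsTest1 η) :
    HasCompactSupport (fun t => (η t : ℂ)) := h.compact.comp_left Complex.ofReal_zero

theorem IsTest1.isPrim {η : ℝ → ℝ} (h : IsTest1 η) :
    IsPrim (fun t => (η t : ℂ)) (fun t => ((_root_.deriv η t : ℝ) : ℂ)) :=
  .of_hasDerivAt (fun t => (h.hasDerivAt t).ofReal_comp) h.deriv.ofReal_continuous

theorem IsTest1.integrable_mul {η : ℝ → ℝ} (h : IsTest1 η) {f : ℝ → ℂ}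
    (hf : LocallyIntegrable f volume) : Integrable (fun t => f t * η t) volume := by
  have := hf.integrable_smul_left_of_hasCompactSupport h.ofReal_continuous h.ofReal_compact
  simpa [mul_comm] using this

/-- `u` is the weak derivative of `f` on the line. -/
def IsWeakDeriv (f u : ℝ → ℂ) : Prop :=
  ∀ η : ℝ → ℝ, IsTest1 η → ∫ t, f t * ((deriv η t : ℝ) : ℂ) = -∫ t, u t * (η t : ℂ)

theorem IsPrim.isWeakDeriv {F f : ℝ → ℂ} (h : IsPrim F f) : IsWeakDeriv F f := by
  intro η hη
  have hp := h.mul hη.isPrim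
  have hF := h.continuous.locallyIntegrable (μ := volume)
  have i1 := hη.integrable_mul h.locallyIntegrable
  have i2 := hη.deriv.integrable_mul hF
  have := hp.integral_eq_zero (hη.integrable_mul hF) (i1.add i2)
  rw [integral_add i1 i2] at this
  linear_combination this

/-- The lemma of du Bois-Reymond: a function with a locally integrable weak derivative has a
locally absolutely continuous representative. -/
theorem IsWeakDeriv.exists_isPrim {f u : ℝ → ℂ} (h : IsWeakDeriv f u)
    (hf : LocallyIntegrable f volume) (hu : LocallyIntegrable u volume) :
    ∃ F, IsPrim F u ∧ f =ᵐ[volume] F := by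
  set P : ℝ → ℂ := fun b => 0 + ∫ x in (0 : ℝ)..b, u x with hP
  have hPp : IsPrim P u := .of_integral hu 0 0
  have hPl := hPp.continuous.locallyIntegrable (μ := volume)
  obtain ⟨η₀, hη₀, hη₀1⟩ : ∃ η₀ : ℝ → ℝ, IsTest1 η₀ ∧ ∫ t, η₀ t = 1 := by
    let b : ContDiffBump (0 : ℝ) := ⟨1, 2, by norm_num, by norm_num⟩
    refine ⟨b.normed volume, ⟨b.contDiff_normed, b.hasCompactSupport_normed⟩, b.integral_normed⟩
  -- the difference `f - P` has weak derivative zero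
  have h0 : ∀ η, IsTest1 η → ∫ t, (f t - P t) * ((deriv η t : ℝ) : ℂ) = 0 := by
    intro η hη
    have e1 := h η hη
    have e2 := hPp.isWeakDeriv η hη
    simp only [sub_mul]
    rw [integral_sub (hη.deriv.integrable_mul hf) (hη.deriv.integrable_mul hPl), e1, e2, sub_self]
  set c : ℂ := ∫ t, (f t - P t) * (η₀ t : ℂ) with hc
  have key : ∀ᵐ t, f t = P t + c := by
    refine ae_eq_of_integral_contDiff_smul_eq hf
      (hPl.add (continuous_const.locallyIntegrable)) fun η hs hcs => ?_
    have hη : IsTest1 η := ⟨hs, hcs⟩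
    -- `η - (∫ η) η₀` has integral zero, so it is the derivative of a test function
    set m := ∫ t, η t
    set θ : ℝ → ℝ := fun t => η t - m * η₀ t with hθ
    have hθt : IsTest1 θ :=
      ⟨hη.contDiff.sub (contDiff_const.mul hη₀.contDiff), hη.compact.sub hη₀.compact.mul_left⟩
    have hθi : Integrable θ volume := hθt.continuous.integrable_of_hasCompactSupport hθt.compact
    have hθ0 : ∫ t, θ t = 0 := by
      rw [hθ, integral_sub (hη.continuous.integrable_of_hasCompactSupport hη.compact)
        ((hη₀.continuous.integrable_of_hasCompactSupport hη₀.compact).const_mul m),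
        integral_const_mul, hη₀1]; simp [m]
    set ξ : ℝ → ℝ := fun t => ∫ s in Iic t, θ s with hξ
    have hd : ∀ t, HasDerivAt ξ (θ t) t := by
      intro t
      have : ξ = fun t => (∫ s in Iic (0:ℝ), θ s) + ∫ s in (0:ℝ)..t, θ s := by
        funext t
        rw [← intervalIntegral.integral_Iic_sub_Iic hθi.integrableOn hθi.integrableOn]; ring
      rw [this]
      exact (intervalIntegral.integral_hasDerivAt_right (hθt.continuous.intervalIntegrable _ _)
        (hθt.continuous.stronglyMeasurableAtFilter _ _) hθt.continuous.continuousAt).const_add _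
    have hdξ : deriv ξ = θ := funext fun t => (hd t).deriv
    obtain ⟨R, hR⟩ := hθt.compact.isCompact.isBounded.subset_closedBall (0 : ℝ)
    have hθR : ∀ t, R < |t| → θ t = 0 := by
      intro t ht
      by_contra hne
      have := hR (subset_tsupport _ hne)
      rw [mem_closedBall_zero_iff, Real.norm_eq_abs] at this
      linarith
    have hξt : IsTest1 ξ := by
      refine ⟨contDiff_infty_iff_deriv.2 ⟨fun t => (hd t).differentiableAt, ?_⟩, ?_⟩
      · rw [hdξ]; exact hθt.contDiff
      · refine HasCompactSupport.intro (isCompact_Icc (a := -|R|) (b := |R|)) fun t ht => ?_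
        rw [mem_Icc, not_and_or, not_le, not_le] at ht
        have hRR := le_abs_self R
        rcases ht with ht | ht
        · refine setIntegral_eq_zero_of_forall_eq_zero fun s hs => hθR s ?_
          rw [mem_Iic] at hs
          have : s < 0 := by linarith [abs_nonneg R]
          rw [abs_of_neg this]; linarith
        · have e := intervalIntegral.integral_Iic_add_Ioi (b := t) hθi.integrableOn
            hθi.integrableOn
          rw [hθ0, setIntegral_eq_zero_of_forall_eq_zero (t := Ioi t) fun s hs => hθR s ?_,
            add_zero] at e
          · exact e
          · rw [mem_Ioi] at hs
            have : 0 < s := by linarith [abs_nonneg R]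
            rw [abs_of_pos this]; linarith
    have e := h0 ξ hξt
    rw [hdξ] at e
    have i1 := hη.integrable_mul (hf.sub hPl)
    have i2 := hη₀.integrable_mul (hf.sub hPl)
    simp only [Pi.sub_apply] at i1 i2
    have e' : ∫ t, (f t - P t) * (η t : ℂ) = m * c := by
      have : (fun t => (f t - P t) * (θ t : ℂ)) =
          fun t => (f t - P t) * (η t : ℂ) - m * ((f t - P t) * (η₀ t : ℂ)) := by
        funext t; simp only [hθ]; push_cast; ring
      rw [this, integral_sub i1 (i2.const_mul _), integral_const_mul] at e
      linear_combination e
    have i3 := hη.integrable_mul hf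
    have i4 := hη.integrable_mul hPl
    have em : ∫ t, (η t : ℂ) = m := integral_ofReal
    simp only [Complex.real_smul]
    have s1 : (fun t => (η t : ℂ) * f t) = fun t => (f t - P t) * (η t : ℂ) + P t * η t := by
      funext t; ring
    have s2 : (fun t => (η t : ℂ) * (P t + c)) = fun t => P t * η t + c * η t := by
      funext t; ring
    rw [s1, s2, integral_add i1 i4, integral_add i4
      ((hη.ofReal_continuous.integrable_of_hasCompactSupport hη.ofReal_compact).const_mul c),
      integral_const_mul, em, e']
    ring
  exact ⟨fun t => P t + c, hPp.add_const c, key⟩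

/-! ### Absolutely summable families of integrals -/

/-- A countable family of measurable functions whose `L¹` norms have a finite sum. -/
structure SumInt {α ι : Type*} [MeasurableSpace α] (ν : Measure α) (F : ι → α → ℂ) : Prop where
  meas : ∀ i, AEStronglyMeasurable (F i) ν
  fin : ∑' i, ∫⁻ t, ‖F i t‖ₑ ∂ν ≠ ⊤

namespace SumInt

variable {α ι κ : Type*} [MeasurableSpace α] {ν : Measure α} {F G : ι → α → ℂ}

theorem integrable (h : SumInt ν F) (i : ι) : Integrable (F i) ν :=
  ⟨h.meas i, (ENNReal.ne_top_of_tsum_ne_top h.fin i).lt_top⟩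

theorem ae_summable [Countable ι] (h : SumInt ν F) : ∀ᵐ t ∂ν, Summable fun i => ‖F i t‖ := by
  have hf := h.fin
  rw [← lintegral_tsum fun i => (h.meas i).enorm] at hf
  filter_upwards [ae_lt_top' (AEMeasurable.tsum fun i => (h.meas i).enorm) hf] with t ht
  exact tsum_enorm_ne_top_iff_summable_norm.1 ht.ne

theorem integral_tsum [Countable ι] (h : SumInt ν F) :
    ∑' i, ∫ t, F i t ∂ν = ∫ t, ∑' i, F i t ∂ν :=
  (MeasureTheory.integral_tsum h.meas h.fin).symm

theorem enorm_le (i : ι) : ‖∫ t, F i t ∂ν‖ₑ ≤ ∫⁻ t, ‖F i t‖ₑ ∂ν :=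
  enorm_integral_le_lintegral_enorm _

theorem summable_norm (h : SumInt ν F) : Summable fun i => ‖∫ t, F i t ∂ν‖ :=
  tsum_enorm_ne_top_iff_summable_norm.1
    (ne_top_of_le_ne_top h.fin (ENNReal.tsum_le_tsum enorm_le))

theorem summable (h : SumInt ν F) : Summable fun i => ∫ t, F i t ∂ν := h.summable_norm.of_norm

theorem hasSum [Countable ι] (h : SumInt ν F) :
    HasSum (fun i => ∫ t, F i t ∂ν) (∫ t, ∑' i, F i t ∂ν) := by
  rw [← h.integral_tsum]; exact h.summable.hasSum

theorem norm_tsum_le (h : SumInt ν F) :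
    ‖∑' i, ∫ t, F i t ∂ν‖ ≤ (∑' i, ∫⁻ t, ‖F i t‖ₑ ∂ν).toReal := by
  have h1 : ‖∑' i, ∫ t, F i t ∂ν‖ₑ ≤ ∑' i, ∫⁻ t, ‖F i t‖ₑ ∂ν :=
    (enorm_tsum_le_tsum_enorm).trans (ENNReal.tsum_le_tsum enorm_le)
  rw [← toReal_enorm]
  exact ENNReal.toReal_mono h.fin h1

theorem integrable_tsum [Countable ι] (h : SumInt ν F) :
    Integrable (fun t => ∑' i, F i t) ν := by
  refine ⟨?_, ?_⟩
  · refine aestronglyMeasurable_of_tendsto_ae (atTop : Filter (Finset ι))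
      (f := fun s t => ∑ i ∈ s, F i t) (fun s => ?_) ?_
    · have := Finset.aestronglyMeasurable_sum s fun i _ => h.meas i
      refine this.congr (Eventually.of_forall fun t => by simp)
    · filter_upwards [h.ae_summable] with t ht
      exact ht.of_norm.hasSum
  · refine lt_of_le_of_lt (lintegral_mono fun t => enorm_tsum_le_tsum_enorm) ?_
    rw [lintegral_tsum fun i => (h.meas i).enorm]
    exact h.fin.lt_top

theorem congr (h : SumInt ν F) (hFG : ∀ i, F i =ᵐ[ν] G i) : SumInt ν G := by
  refine ⟨fun i => (h.meas i).congr (hFG i), ?_⟩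
  convert h.fin using 3 with i
  exact lintegral_congr_ae ((hFG i).mono fun t ht => by simp only; rw [ht])

theorem add (hF : SumInt ν F) (hG : SumInt ν G) : SumInt ν fun i t => F i t + G i t := by
  refine ⟨fun i => (hF.meas i).add (hG.meas i), ?_⟩
  refine ne_top_of_le_ne_top (ENNReal.add_ne_top.2 ⟨hF.fin, hG.fin⟩) ?_
  rw [← ENNReal.tsum_add]
  refine ENNReal.tsum_le_tsum fun i => ?_
  rw [← lintegral_add_left' (hF.meas i).enorm]
  exact lintegral_mono fun t => enorm_add_le _ _

theorem const_mul (h : SumInt ν F) (c : ℂ) : SumInt ν fun i t => c * F i t := by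
  refine ⟨fun i => (h.meas i).const_mul c, ?_⟩
  simp only [enorm_mul]
  rw [show ∑' i, ∫⁻ t, ‖c‖ₑ * ‖F i t‖ₑ ∂ν = ‖c‖ₑ * ∑' i, ∫⁻ t, ‖F i t‖ₑ ∂ν by
    rw [← ENNReal.tsum_mul_left]
    exact tsum_congr fun i => lintegral_const_mul'' _ (h.meas i).enorm]
  exact ENNReal.mul_ne_top (by simp) h.fin

theorem fiber {F : κ × ι → α → ℂ} (h : SumInt ν F) (k : κ) : SumInt ν fun l => F (k, l) := by
  refine ⟨fun l => h.meas _, ?_⟩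
  have := h.fin
  rw [ENNReal.tsum_prod'] at this
  exact ENNReal.ne_top_of_tsum_ne_top this k

/-- Summing the fibres of a doubly indexed family first. -/
theorem tsum_fiber [Countable ι] {F : κ × ι → α → ℂ} (h : SumInt ν F) :
    SumInt ν (fun k t => ∑' l, F (k, l) t) := by
  refine ⟨fun k => (h.fiber k).integrable_tsum.1, ?_⟩
  have := h.fin
  rw [ENNReal.tsum_prod'] at this
  refine ne_top_of_le_ne_top this (ENNReal.tsum_le_tsum fun k => ?_)
  rw [← lintegral_tsum fun i => (h.meas _).enorm]
  exact lintegral_mono fun t => enorm_tsum_le_tsum_enorm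

theorem tsum_prod [Countable ι] {F : κ × ι → α → ℂ} (h : SumInt ν F) :
    ∑' i, ∫ t, F i t ∂ν = ∑' k, ∫ t, ∑' l, F (k, l) t ∂ν := by
  rw [h.summable.tsum_prod' fun k => (h.fiber k).summable]
  exact tsum_congr fun k => (h.fiber k).integral_tsum

end SumInt

/-! ### Square summable families of functions of time -/

/-- Families `p : ℤ → ℝ → ℂ` in `ℓ²(ℤ; L²(ℝ))`. -/
structure L2Modes (p : ℤ → ℝ → ℂ) : Prop where
  meas : ∀ k, AEStronglyMeasurable (p k) volume
  fin : ∑' k, ∫⁻ t, ‖p k t‖ₑ ^ 2 ≠ ⊤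

/-- The square of the norm of `ℓ²(ℤ; L²(ℝ))`. -/
def modeSq (p : ℤ → ℝ → ℂ) : ℝ := (∑' k, ∫⁻ t, ‖p k t‖ₑ ^ 2).toReal

theorem ennreal_two_mul_le (p q : ℝ≥0∞) : 2 * p * q ≤ p ^ 2 + q ^ 2 := by
  rcases eq_or_ne p ⊤ with rfl | hp
  · simp
  rcases eq_or_ne q ⊤ with rfl | hq
  · simp
  lift p to NNReal using hp
  lift q to NNReal using hq
  exact_mod_cast two_mul_le_add_sq p q

theorem modeSq_nonneg (p : ℤ → ℝ → ℂ) : 0 ≤ modeSq p := ENNReal.toReal_nonneg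

theorem memLp_two_iff {α : Type*} [MeasurableSpace α] {ν : Measure α} {E : Type*}
    [NormedAddCommGroup E] {f : α → E} :
    MemLp f 2 ν ↔ AEStronglyMeasurable f ν ∧ ∫⁻ t, ‖f t‖ₑ ^ 2 ∂ν ≠ ⊤ := by
  rw [MemLp, eLpNorm_lt_top_iff_lintegral_rpow_enorm_lt_top (by norm_num) (by norm_num)]
  simp [lt_top_iff_ne_top]

namespace L2Modes

variable {p q : ℤ → ℝ → ℂ}

theorem memLp (h : L2Modes p) (k : ℤ) : MemLp (p k) 2 volume :=
  memLp_two_iff.2 ⟨h.meas k, ENNReal.ne_top_of_tsum_ne_top h.fin k⟩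

theorem integrable_sq (h : L2Modes p) (k : ℤ) : Integrable (fun t => ‖p k t‖ ^ 2) volume :=
  (h.memLp k).integrable_norm_pow (by norm_num)

theorem integrable_mul (hp : L2Modes p) (hq : L2Modes q) (k l : ℤ) :
    Integrable (fun t => p k t * q l t) volume :=
  (hp.memLp k).integrable_mul (hq.memLp l)

theorem conj (hp : L2Modes p) : L2Modes (fun k t => starRingEnd ℂ (p k t)) := by
  refine ⟨fun k => Complex.continuous_conj.comp_aestronglyMeasurable (hp.meas k), ?_⟩
  simpa [enorm_eq_nnnorm] using hp.fin

theorem integrable_mul_conj (hp : L2Modes p) (hq : L2Modes q) (k l : ℤ) :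
    Integrable (fun t => p k t * starRingEnd ℂ (q l t)) volume :=
  hp.integrable_mul hq.conj k l

theorem hasSum (h : L2Modes p) : HasSum (fun k => ∫ t, ‖p k t‖ ^ 2) (modeSq p) := by
  have e : ∀ k, ∫⁻ t, ‖p k t‖ₑ ^ 2 = ENNReal.ofReal (∫ t, ‖p k t‖ ^ 2) := fun k => by
    rw [ofReal_integral_eq_lintegral_ofReal (h.integrable_sq k)
      (Eventually.of_forall fun t => by positivity)]
    refine lintegral_congr fun t => ?_
    rw [ENNReal.ofReal_pow (norm_nonneg _), ofReal_norm]
  have e' : ∀ k, (∫⁻ t, ‖p k t‖ₑ ^ 2).toReal = ∫ t, ‖p k t‖ ^ 2 := fun k => by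
    rw [e, ENNReal.toReal_ofReal (integral_nonneg fun t => by positivity)]
  have hs := (ENNReal.summable_toReal h.fin).hasSum
  rw [← ENNReal.tsum_toReal_eq fun k => ENNReal.ne_top_of_tsum_ne_top h.fin k] at hs
  rw [modeSq]
  simpa only [e'] using hs

theorem of_le {c : ℝ≥0∞} (hc : c ≠ ⊤) (h : L2Modes p)
    (hq : ∀ k, AEStronglyMeasurable (q k) volume)
    (hle : ∀ k, ∫⁻ t, ‖q k t‖ₑ ^ 2 ≤ c * ∫⁻ t, ‖p k t‖ₑ ^ 2) : L2Modes q := by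
  refine ⟨hq, ne_top_of_le_ne_top (ENNReal.mul_ne_top hc h.fin) ?_⟩
  rw [← ENNReal.tsum_mul_left]
  exact ENNReal.tsum_le_tsum hle

theorem const_mul (h : L2Modes p) (c : ℂ) : L2Modes (fun k t => c * p k t) := by
  refine h.of_le (c := ‖c‖ₑ ^ 2) (by simp) (fun k => (h.meas k).const_mul c) fun k => ?_
  simp only [enorm_mul, mul_pow]
  rw [lintegral_const_mul'' _ ((h.meas k).enorm.pow_const 2)]

theorem add (hp : L2Modes p) (hq : L2Modes q) : L2Modes (fun k t => p k t + q k t) := by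
  refine ⟨fun k => (hp.meas k).add (hq.meas k), ?_⟩
  have h2 : (2 : ℝ≥0∞) * ((∑' k, ∫⁻ t, ‖p k t‖ₑ ^ 2) + ∑' k, ∫⁻ t, ‖q k t‖ₑ ^ 2) ≠ ⊤ :=
    ENNReal.mul_ne_top (by simp) (ENNReal.add_ne_top.2 ⟨hp.fin, hq.fin⟩)
  refine ne_top_of_le_ne_top h2 ?_
  rw [← ENNReal.tsum_add, ← ENNReal.tsum_mul_left]
  refine ENNReal.tsum_le_tsum fun k => ?_
  rw [← lintegral_add_left' ((hp.meas k).enorm.pow_const 2),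
    ← lintegral_const_mul' _ _ (by simp)]
  refine lintegral_mono fun t => ?_
  refine (pow_le_pow_left₀ (by simp) (enorm_add_le _ _) 2).trans ?_
  rw [two_mul (_ + _), add_sq]
  calc _ = ‖p k t‖ₑ ^ 2 + ‖q k t‖ₑ ^ 2 + 2 * ‖p k t‖ₑ * ‖q k t‖ₑ := by ring
    _ ≤ _ := by gcongr; exact ennreal_two_mul_le _ _

theorem neg (hp : L2Modes p) : L2Modes (fun k t => -p k t) := by
  simpa using hp.const_mul (-1)

theorem sub (hp : L2Modes p) (hq : L2Modes q) : L2Modes (fun k t => p k t - q k t) := by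
  simpa [sub_eq_add_neg] using hp.add hq.neg

theorem congr (hp : L2Modes p) (h : ∀ k, p k =ᵐ[volume] q k) : L2Modes q := by
  refine ⟨fun k => (hp.meas k).congr (h k), ?_⟩
  convert hp.fin using 3 with k
  exact lintegral_congr_ae ((h k).mono fun t ht => by simp only; rw [ht])

/-- The pairing of two families, mode by mode. -/
theorem sumInt (hp : L2Modes p) (hq : L2Modes q) :
    SumInt volume fun k t => p k t * starRingEnd ℂ (q k t) := by
  refine ⟨fun k => (hp.meas k).mul (hq.conj.meas k), ?_⟩
  refine ne_top_of_le_ne_top (ENNReal.add_ne_top.2 ⟨hp.fin, hq.fin⟩) ?_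
  rw [← ENNReal.tsum_add]
  refine ENNReal.tsum_le_tsum fun k => ?_
  rw [← lintegral_add_left' ((hp.meas k).enorm.pow_const 2)]
  refine lintegral_mono fun t => ?_
  rw [enorm_mul, enorm_eq_nnnorm (starRingEnd ℂ _), RCLike.nnnorm_conj, ← enorm_eq_nnnorm]
  refine le_trans ?_ (ennreal_two_mul_le _ _)
  rw [mul_assoc, two_mul]
  exact le_self_add

/-- A family with a single nonzero member. -/
theorem single {f : ℝ → ℂ} (hf : MemLp f 2 volume) (k : ℤ) : L2Modes (Pi.single k f) := by
  rw [memLp_two_iff] at hf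
  refine ⟨fun l => ?_, ?_⟩
  · rcases eq_or_ne l k with rfl | h
    · simpa using hf.1
    · rw [Pi.single_eq_of_ne h]; exact aestronglyMeasurable_zero
  · rw [tsum_eq_single k fun l hl => by simp [Pi.single_eq_of_ne hl]]
    simpa using hf.2

end L2Modes

theorem modeSq_congr {p q : ℤ → ℝ → ℂ} (h : ∀ k, p k =ᵐ[volume] q k) : modeSq p = modeSq q := by
  unfold modeSq
  congr 1
  exact tsum_congr fun k => lintegral_congr_ae ((h k).mono fun t ht => by simp only; rw [ht])

/-! ### Forms with a dominated kernel -/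

/-- The sesquilinear form `∑ ∫ K k l (t) p l (t) conj (q k (t)) dt` of a kernel `K`. -/
def form (K : ℤ → ℤ → ℝ → ℂ) (p q : ℤ → ℝ → ℂ) : ℂ :=
  ∑' kl : ℤ × ℤ, ∫ t, K kl.1 kl.2 t * p kl.2 t * starRingEnd ℂ (q kl.1 t)

/-- Absolute convergence of `form K p q`. -/
abbrev FormSum (K : ℤ → ℤ → ℝ → ℂ) (p q : ℤ → ℝ → ℂ) : Prop :=
  SumInt volume fun (kl : ℤ × ℤ) t => K kl.1 kl.2 t * p kl.2 t * starRingEnd ℂ (q kl.1 t)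

/-- Young's inequality for convolutions in the form that follows from `2xy ≤ x² + y²`. -/
theorem tsum_convolution_le (m p q : ℤ → ℝ≥0∞) :
    ∑' kl : ℤ × ℤ, m (kl.1 - kl.2) * p kl.2 * q kl.1 ≤
      (∑' j, m j) * (((∑' k, p k ^ 2) + ∑' k, q k ^ 2) / 2) := by
  have h1 : ∑' kl : ℤ × ℤ, m (kl.1 - kl.2) * p kl.2 ^ 2 = (∑' j, m j) * ∑' k, p k ^ 2 := by
    rw [ENNReal.tsum_prod', ENNReal.tsum_comm, ← ENNReal.tsum_mul_left]
    refine tsum_congr fun l => ?_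
    simp only
    rw [ENNReal.tsum_mul_right, ← (Equiv.subRight l).tsum_eq m]; rfl
  have h2 : ∑' kl : ℤ × ℤ, m (kl.1 - kl.2) * q kl.1 ^ 2 = (∑' j, m j) * ∑' k, q k ^ 2 := by
    rw [ENNReal.tsum_prod', ← ENNReal.tsum_mul_left]
    refine tsum_congr fun k => ?_
    simp only
    rw [ENNReal.tsum_mul_right, ← (Equiv.subLeft k).tsum_eq m]; rfl
  rw [← mul_div_assoc, mul_add, ← h1, ← h2, ← ENNReal.tsum_add, div_eq_mul_inv,
    ← ENNReal.tsum_mul_right]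
  refine ENNReal.tsum_le_tsum fun kl => ?_
  rw [← div_eq_mul_inv, ENNReal.le_div_iff_mul_le (by simp) (by simp), ← mul_add,
    mul_assoc, mul_assoc]
  gcongr
  refine le_trans (le_of_eq ?_) (ennreal_two_mul_le _ _)
  ring

/-- A form converges if its terms are dominated by a convolution. The families `p'` and `q'` of the
bound may differ from the arguments of the form: this is how a kernel that gains derivatives is
estimated. -/
theorem FormSum.of_le {K : ℤ → ℤ → ℝ → ℂ} {p q p' q' : ℤ → ℝ → ℂ} {m : ℤ → ℝ → ℝ≥0∞} {M : ℝ}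
    (hF : ∀ k l, AEStronglyMeasurable
      (fun t => K k l t * p l t * starRingEnd ℂ (q k t)) volume)
    (hp : L2Modes p') (hq : L2Modes q') (hm : ∀ j, AEMeasurable (m j) volume)
    (hM : ∀ᵐ t, ∑' j, m j t ≤ ENNReal.ofReal M) (hM0 : 0 ≤ M)
    (hle : ∀ k l, ∀ᵐ t, ‖K k l t * p l t * starRingEnd ℂ (q k t)‖ₑ ≤
      m (k - l) t * ‖p' l t‖ₑ * ‖q' k t‖ₑ) :
    FormSum K p q ∧ ‖form K p q‖ ≤ M * ((modeSq p' + modeSq q') / 2) := by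
  have h1 : ∑' kl : ℤ × ℤ, ∫⁻ t, ‖K kl.1 kl.2 t * p kl.2 t * starRingEnd ℂ (q kl.1 t)‖ₑ ≤
      ENNReal.ofReal M *
        (((∑' k, ∫⁻ t, ‖p' k t‖ₑ ^ 2) + ∑' k, ∫⁻ t, ‖q' k t‖ₑ ^ 2) / 2) := by
    calc _ ≤ ∑' kl : ℤ × ℤ, ∫⁻ t, m (kl.1 - kl.2) t * ‖p' kl.2 t‖ₑ * ‖q' kl.1 t‖ₑ :=
          ENNReal.tsum_le_tsum fun kl => lintegral_mono_ae (hle _ _)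
      _ = ∫⁻ t, ∑' kl : ℤ × ℤ, m (kl.1 - kl.2) t * ‖p' kl.2 t‖ₑ * ‖q' kl.1 t‖ₑ :=
          (lintegral_tsum fun kl => ((hm _).mul (hp.meas _).enorm).mul (hq.meas _).enorm).symm
      _ ≤ ∫⁻ t, ENNReal.ofReal M * (((∑' k, ‖p' k t‖ₑ ^ 2) + ∑' k, ‖q' k t‖ₑ ^ 2) / 2) := by
          refine lintegral_mono_ae ?_
          filter_upwards [hM] with t ht
          exact (tsum_convolution_le (fun j => m j t) (fun j => ‖p' j t‖ₑ)
            (fun j => ‖q' j t‖ₑ)).trans (by gcongr)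
      _ = _ := by
          have mp := fun k => (hp.meas k).enorm.pow_const 2
          have mq := fun k => (hq.meas k).enorm.pow_const 2
          rw [lintegral_const_mul' _ _ (by simp)]
          simp only [div_eq_mul_inv]
          rw [lintegral_mul_const' _ _ (by simp), lintegral_add_left' (AEMeasurable.tsum mp),
            lintegral_tsum mp, lintegral_tsum mq]
  have hfin : ENNReal.ofReal M *
        (((∑' k, ∫⁻ t, ‖p' k t‖ₑ ^ 2) + ∑' k, ∫⁻ t, ‖q' k t‖ₑ ^ 2) / 2) ≠ ⊤ :=
    ENNReal.mul_ne_top (by simp) (ENNReal.div_ne_top (ENNReal.add_ne_top.2 ⟨hp.fin, hq.fin⟩)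
      (by simp))
  have hS : FormSum K p q := ⟨fun kl => hF _ _, ne_top_of_le_ne_top hfin h1⟩
  refine ⟨hS, hS.norm_tsum_le.trans ((ENNReal.toReal_mono hfin h1).trans ?_)⟩
  rw [ENNReal.toReal_mul, ENNReal.toReal_ofReal hM0, ENNReal.toReal_div,
    ENNReal.toReal_add hp.fin hq.fin]
  simp [modeSq]

namespace FormSum

variable {K K' : ℤ → ℤ → ℝ → ℂ} {p p' q q' : ℤ → ℝ → ℂ}

theorem form_sub_left (h : FormSum K p q) (h' : FormSum K p' q) :
    FormSum K (fun k t => p k t - p' k t) q ∧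
      form K (fun k t => p k t - p' k t) q = form K p q - form K p' q := by
  have e : ∀ (kl : ℤ × ℤ) t, K kl.1 kl.2 t * (p kl.2 t - p' kl.2 t) * starRingEnd ℂ (q kl.1 t) =
      K kl.1 kl.2 t * p kl.2 t * starRingEnd ℂ (q kl.1 t) +
      (-1) * (K kl.1 kl.2 t * p' kl.2 t * starRingEnd ℂ (q kl.1 t)) := fun kl t => by ring
  unfold form FormSum
  simp only [e]
  refine ⟨SumInt.add h (SumInt.const_mul h' (-1)), ?_⟩
  rw [← h.summable.tsum_sub h'.summable]
  refine tsum_congr fun kl => ?_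
  rw [integral_add (h.integrable kl) ((h'.integrable kl).const_mul _), integral_const_mul]
  ring

theorem form_add_right (h : FormSum K p q) (h' : FormSum K p q') :
    FormSum K p (fun k t => q k t + q' k t) ∧
      form K p (fun k t => q k t + q' k t) = form K p q + form K p q' := by
  have e : ∀ (kl : ℤ × ℤ) t, K kl.1 kl.2 t * p kl.2 t * starRingEnd ℂ (q kl.1 t + q' kl.1 t) =
      K kl.1 kl.2 t * p kl.2 t * starRingEnd ℂ (q kl.1 t) +
      (K kl.1 kl.2 t * p kl.2 t * starRingEnd ℂ (q' kl.1 t)) := fun kl t => by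
    rw [map_add]; ring
  unfold form FormSum
  simp only [e]
  refine ⟨SumInt.add h h', ?_⟩
  rw [← h.summable.tsum_add h'.summable]
  refine tsum_congr fun kl => ?_
  rw [integral_add (h.integrable kl) (h'.integrable kl)]

theorem form_add_kernel (h : FormSum K p q) (h' : FormSum K' p q) :
    FormSum (fun k l t => K k l t + K' k l t) p q ∧
      form (fun k l t => K k l t + K' k l t) p q = form K p q + form K' p q := by
  have e : ∀ (kl : ℤ × ℤ) t, (K kl.1 kl.2 t + K' kl.1 kl.2 t) * p kl.2 t *
      starRingEnd ℂ (q kl.1 t) = K kl.1 kl.2 t * p kl.2 t * starRingEnd ℂ (q kl.1 t) +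
      K' kl.1 kl.2 t * p kl.2 t * starRingEnd ℂ (q kl.1 t) := fun kl t => by ring
  unfold form FormSum
  simp only [e]
  refine ⟨SumInt.add h h', ?_⟩
  rw [← h.summable.tsum_add h'.summable]
  refine tsum_congr fun kl => ?_
  rw [integral_add (h.integrable kl) (h'.integrable kl)]

end FormSum

theorem form_const_mul_left (K : ℤ → ℤ → ℝ → ℂ) (p q : ℤ → ℝ → ℂ) (c : ℂ) :
    form K (fun k t => c * p k t) q = c * form K p q := by
  unfold form
  rw [← tsum_mul_left]
  refine tsum_congr fun kl => ?_
  rw [← integral_const_mul]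
  congr 1; funext t; ring

theorem form_const_mul_right (K : ℤ → ℤ → ℝ → ℂ) (p q : ℤ → ℝ → ℂ) (c : ℝ) :
    form K p (fun k t => c * q k t) = c * form K p q := by
  unfold form
  rw [← tsum_mul_left]
  refine tsum_congr fun kl => ?_
  rw [← integral_const_mul]
  congr 1; funext t
  rw [map_mul, Complex.conj_ofReal]; ring

/-- For a Hermitian kernel, exchanging the arguments conjugates the form. -/
theorem form_conj {K : ℤ → ℤ → ℝ → ℂ} (hK : ∀ k l, ∀ᵐ t, starRingEnd ℂ (K k l t) = K l k t)
    (p q : ℤ → ℝ → ℂ) : starRingEnd ℂ (form K p q) = form K q p := by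
  unfold form
  rw [Complex.conj_tsum, ← (Equiv.prodComm ℤ ℤ).tsum_eq]
  refine tsum_congr fun kl => ?_
  rw [← integral_conj]
  refine integral_congr_ae ((hK kl.2 kl.1).mono fun t ht => ?_)
  simp only [Equiv.prodComm_apply, Prod.fst_swap, Prod.snd_swap, map_mul, ht, Complex.conj_conj]
  ring

/-! ### The kernel of the linearized operator -/

/-- The kernel of the linearized operator without its principal part. It vanishes if the
frequencies have the same sign and `|l| ≤ |k|`, where the Hilbert transforms cancel. In the other
cases `|k|` or `|l|` is bounded by `|k - l|` up to a factor, so that derivatives of the unknown can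
be traded for derivatives of the basic state. -/
def rho (k l : ℤ) : ℝ :=
  if k * l < 0 then 2 * |(k : ℝ)| + 2 * |(k : ℝ) - l|
  else if 0 < k * l ∧ |k| < |l| then 2 * ((k : ℝ) - l) ^ 2 / |(l : ℝ)| else 0

/-- The kernel of the linearized operator, acting on the Fourier coefficients of `φ_x`; the
summand `-2 |k - l|` comes from the coefficient `-2 Φ₀_x` of the principal part. -/
def lam (k l : ℤ) : ℝ := rho k l - 2 * |(k : ℝ) - l|

theorem rho_cases (k l : ℤ) : (rho k l = 0) ∨
    (rho k l = 2 * |(k : ℝ)| + 2 * |(k : ℝ) - l| ∧ |(k : ℝ) - l| = |(k : ℝ)| + |(l : ℝ)|) ∨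
    (rho k l = 2 * ((k : ℝ) - l) ^ 2 / |(l : ℝ)| ∧ 0 < |(k : ℝ)| ∧
      |(l : ℝ)| = |(k : ℝ)| + |(k : ℝ) - l|) := by
  unfold rho
  split_ifs with h1 h2
  · right; left
    refine ⟨rfl, ?_⟩
    rcases lt_trichotomy k 0 with hk | hk | hk
    · have hl : 0 < l := by by_contra h; nlinarith
      have hk' : (k : ℝ) < 0 := by exact_mod_cast hk
      have hl' : (0 : ℝ) < l := by exact_mod_cast hl
      rw [abs_of_neg hk', abs_of_pos hl', abs_of_neg (by linarith)]; ring
    · simp [hk] at h1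
    · have hl : l < 0 := by by_contra h; nlinarith
      have hk' : (0 : ℝ) < k := by exact_mod_cast hk
      have hl' : (l : ℝ) < 0 := by exact_mod_cast hl
      rw [abs_of_pos hk', abs_of_neg hl', abs_of_pos (by linarith)]; ring
  · right; right
    obtain ⟨h2, h3⟩ := h2
    have h3' : |(k : ℝ)| < |(l : ℝ)| := by exact_mod_cast h3
    rcases lt_trichotomy k 0 with hk | hk | hk
    · have hl : l < 0 := by by_contra h; nlinarith
      have hk' : (k : ℝ) < 0 := by exact_mod_cast hk
      have hl' : (l : ℝ) < 0 := by exact_mod_cast hl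
      rw [abs_of_neg hk', abs_of_neg hl'] at h3'
      refine ⟨rfl, by rw [abs_of_neg hk']; linarith, ?_⟩
      rw [abs_of_neg hk', abs_of_neg hl', abs_of_pos (by linarith)]; ring
    · simp [hk] at h2
    · have hl : 0 < l := by by_contra h; nlinarith
      have hk' : (0 : ℝ) < k := by exact_mod_cast hk
      have hl' : (0 : ℝ) < l := by exact_mod_cast hl
      rw [abs_of_pos hk', abs_of_pos hl'] at h3'
      refine ⟨rfl, by rw [abs_of_pos hk']; linarith, ?_⟩
      rw [abs_of_pos hk', abs_of_pos hl', abs_of_neg (by linarith)]; ring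
  · left; rfl

theorem rho_nonneg (k l : ℤ) : 0 ≤ rho k l := by
  unfold rho
  split_ifs <;> positivity

/-- The remainder gains a derivative of the unknown at the cost of two derivatives of the basic
state. -/
theorem rho_mul_abs_right_le (k l : ℤ) : rho k l * |(l : ℝ)| ≤ 4 * ((k : ℝ) - l) ^ 2 := by
  rcases rho_cases k l with h | ⟨h, h'⟩ | ⟨h, h0, h'⟩
  · rw [h]; nlinarith [sq_nonneg ((k : ℝ) - l)]
  · rw [h, ← sq_abs ((k : ℝ) - l)]
    nlinarith [abs_nonneg (k : ℝ), abs_nonneg (l : ℝ)]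
  · have : 0 < |(l : ℝ)| := by rw [h']; positivity
    rw [h, div_mul_cancel₀ _ this.ne']
    nlinarith [sq_nonneg ((k : ℝ) - l)]

/-- The remainder gains a derivative of the test function at the cost of two derivatives of the
basic state. -/
theorem rho_mul_abs_left_le (k l : ℤ) : rho k l * |(k : ℝ)| ≤ 4 * ((k : ℝ) - l) ^ 2 := by
  rcases rho_cases k l with h | ⟨h, h'⟩ | ⟨h, h0, h'⟩
  · rw [h]; nlinarith [sq_nonneg ((k : ℝ) - l)]
  · rw [h, ← sq_abs ((k : ℝ) - l)]
    nlinarith [abs_nonneg (k : ℝ), abs_nonneg (l : ℝ)]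
  · refine le_trans ?_ (rho_mul_abs_right_le k l)
    exact mul_le_mul_of_nonneg_left (by rw [h']; linarith [abs_nonneg ((k : ℝ) - l)])
      (rho_nonneg k l)

theorem rho_le (k l : ℤ) : rho k l ≤ 4 * |(k : ℝ) - l| := by
  rcases rho_cases k l with h | ⟨h, h'⟩ | ⟨h, h0, h'⟩
  · rw [h]; positivity
  · rw [h]; linarith [abs_nonneg (l : ℝ)]
  · have : 0 < |(l : ℝ)| := by rw [h']; positivity
    rw [h, div_le_iff₀ this, ← sq_abs ((k : ℝ) - l)]
    nlinarith [abs_nonneg ((k : ℝ) - l)]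

theorem abs_lam_le (k l : ℤ) : |lam k l| ≤ 2 * |(k : ℝ) - l| := by
  have h1 := rho_nonneg k l
  have h2 := rho_le k l
  rw [lam, abs_le]
  constructor <;> linarith

theorem rho_neg (k l : ℤ) : rho (-k) (-l) = rho k l := by
  unfold rho
  have e : |(-k : ℝ) - -l| = |(k : ℝ) - l| := by rw [← abs_neg]; congr 1; ring
  have e' : ((-k : ℝ) - -l) ^ 2 = ((k : ℝ) - l) ^ 2 := by ring
  push_cast
  rw [e, e', abs_neg, abs_neg, abs_neg, abs_neg, neg_mul_neg]

theorem lam_neg (k l : ℤ) : lam (-k) (-l) = lam k l := by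
  have e : |(-k : ℝ) - -l| = |(k : ℝ) - l| := by rw [← abs_neg]; congr 1; ring
  rw [lam, rho_neg, lam]; push_cast; rw [e]

/-- The kernel `lam` is the sum of the contributions of `2 H[Φ₀_x Φ_x]`, `-[Φ; H] Φ₀_xx` and
`-[Φ₀; H] Φ_xx`. -/
theorem lam_eq {k l : ℤ} (hk : k ≠ 0) (hl : l ≠ 0) :
    lam k l = -2 * (k.sign : ℝ) * l.sign * |(k : ℝ) - l| +
      ((k : ℝ) - l) ^ 2 / |(l : ℝ)| * (1 - k.sign * (k - l).sign) +
      |(l : ℝ)| * (l.sign - k.sign) * (k - l).sign := by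
  have pos : ∀ n : ℤ, 0 < n → (n.sign : ℝ) = 1 ∧ |(n : ℝ)| = n ∧ (0 : ℝ) < n := fun n hn => by
    have : (0 : ℝ) < n := by exact_mod_cast hn
    rw [Int.sign_eq_one_of_pos hn]; simp [abs_of_pos this, this]
  have neg : ∀ n : ℤ, n < 0 → (n.sign : ℝ) = -1 ∧ |(n : ℝ)| = -n ∧ (n : ℝ) < 0 := fun n hn => by
    have : (n : ℝ) < 0 := by exact_mod_cast hn
    rw [Int.sign_eq_neg_one_of_neg hn]; simp [abs_of_neg this, this]
  have cast : (k : ℝ) - l = ((k - l : ℤ) : ℝ) := by push_cast; ring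
  unfold lam rho
  rw [cast]
  rcases lt_or_gt_of_ne hk with hk | hk <;> rcases lt_or_gt_of_ne hl with hl | hl
  · obtain ⟨sk, ak, rk⟩ := neg k hk
    obtain ⟨sl, al, rl⟩ := neg l hl
    have hkl : 0 < k * l := mul_pos_of_neg_of_neg hk hl
    rcases lt_trichotomy (k - l) 0 with h | h | h
    · obtain ⟨sj, aj, rj⟩ := neg _ h
      rw [if_neg (by lia), if_neg (by rw [abs_of_neg hk, abs_of_neg hl]; lia), sk, sl, sj, al, aj]
      ring
    · rw [if_neg (by lia), if_neg (by rw [abs_of_neg hk, abs_of_neg hl]; lia), h]; simp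
    · obtain ⟨sj, aj, rj⟩ := pos _ h
      rw [if_neg (by lia), if_pos (by rw [abs_of_neg hk, abs_of_neg hl]; exact ⟨hkl, by lia⟩),
        sk, sl, sj, al, aj]
      ring
  · obtain ⟨sk, ak, rk⟩ := neg k hk
    obtain ⟨sl, al, rl⟩ := pos l hl
    obtain ⟨sj, aj, rj⟩ := neg (k - l) (by lia)
    rw [if_pos (mul_neg_of_neg_of_pos hk hl), sk, sl, sj, ak, al, aj]
    push_cast; ring
  · obtain ⟨sk, ak, rk⟩ := pos k hk
    obtain ⟨sl, al, rl⟩ := neg l hl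
    obtain ⟨sj, aj, rj⟩ := pos (k - l) (by lia)
    rw [if_pos (mul_neg_of_pos_of_neg hk hl), sk, sl, sj, ak, al, aj]
    push_cast; ring
  · obtain ⟨sk, ak, rk⟩ := pos k hk
    obtain ⟨sl, al, rl⟩ := pos l hl
    have hkl : 0 < k * l := mul_pos hk hl
    rcases lt_trichotomy (k - l) 0 with h | h | h
    · obtain ⟨sj, aj, rj⟩ := neg _ h
      rw [if_neg (by lia), if_pos (by rw [abs_of_pos hk, abs_of_pos hl]; exact ⟨hkl, by lia⟩),
        sk, sl, sj, al, aj]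
      ring
    · rw [if_neg (by lia), if_neg (by rw [abs_of_pos hk, abs_of_pos hl]; lia), h]; simp
    · obtain ⟨sj, aj, rj⟩ := pos _ h
      rw [if_neg (by lia), if_neg (by rw [abs_of_pos hk, abs_of_pos hl]; lia), sk, sl, sj, al, aj]
      ring

/-! ### Modulus estimates for the coefficients of the linearized operator -/

/-- The kernel of the principal part: the matrix of multiplication by `μ - 2 Φ₀_x`, if `c j` are
the Fourier coefficients of `φ₀`, divided by `2π`. -/
def aKer (μ : ℝ) (c : ℤ → ℝ → ℂ) (k l : ℤ) (t : ℝ) : ℂ :=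
  (if k = l then (μ : ℂ) else 0) + ((-2 * |(k : ℝ) - l| : ℝ) : ℂ) * c (k - l) t

/-- The time derivative of `aKer`, if `d` is the derivative of `c`. -/
def aKer' (d : ℤ → ℝ → ℂ) (k l : ℤ) (t : ℝ) : ℂ := ((-2 * |(k : ℝ) - l| : ℝ) : ℂ) * d (k - l) t

/-- The kernel of the remainder, which is of order zero as an operator on `φ_x` and gains one
derivative. -/
def rKer (c : ℤ → ℝ → ℂ) (k l : ℤ) (t : ℝ) : ℂ := (rho k l : ℂ) * c (k - l) t

/-- The kernel of the linearized operator. -/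
def bKer (μ : ℝ) (c : ℤ → ℝ → ℂ) (k l : ℤ) (t : ℝ) : ℂ := aKer μ c k l t + rKer c k l t

/-- What the proof uses of the basic state, in terms of its normalized Fourier coefficients `c j`
and those, `d j`, of its time derivative. The numbers `a` and `b` bound the coefficients of
`∂ₓ² φ₀` and of `∂ₓ φ₀t` in `ℓ¹`, which the Sobolev norms do. The field `pos` is the stability
condition `μ - 2 Φ₀_x ≥ δ / 2`. -/
structure ModeCoeffs (μ δ a b : ℝ) (c d : ℤ → ℝ → ℂ) : Prop where
  prim : ∀ j, IsPrim (c j) (d j)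
  herm : ∀ j, ∀ᵐ t, c (-j) t = starRingEnd ℂ (c j t)
  nonneg_a : 0 ≤ a
  nonneg_b : 0 ≤ b
  bound : ∀ᵐ t, ∑' j : ℤ, ‖(j : ℂ) ^ 2 * c j t‖ₑ ≤ ENNReal.ofReal a
  bound' : ∀ᵐ t, ∑' j : ℤ, ‖(j : ℂ) * d j t‖ₑ ≤ ENNReal.ofReal b
  pos : ∀ᵐ t, ∀ x : ℤ → ℂ, (Summable fun k => ‖x k‖ ^ 2) →
    δ / 2 * ∑' k, ‖x k‖ ^ 2 ≤
      (∑' kl : ℤ × ℤ, aKer μ c kl.1 kl.2 t * x kl.2 * starRingEnd ℂ (x kl.1)).re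

namespace ModeCoeffs

variable {μ δ a b : ℝ} {c d : ℤ → ℝ → ℂ}

theorem meas (h : ModeCoeffs μ δ a b c d) (j : ℤ) : AEStronglyMeasurable (c j) volume :=
  (h.prim j).continuous.aestronglyMeasurable

theorem meas' (h : ModeCoeffs μ δ a b c d) (j : ℤ) : AEStronglyMeasurable (d j) volume :=
  (h.prim j).locallyIntegrable.aestronglyMeasurable

theorem abs_sub_le_sq (k l : ℤ) : |(k : ℝ) - l| ≤ ((k : ℝ) - l) ^ 2 := by
  have : |k - l| ≤ (k - l) ^ 2 := by
    rcases eq_or_ne (k - l) 0 with h | h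
    · simp [h]
    · rw [← sq_abs]; nlinarith [Int.one_le_abs h]
  exact_mod_cast this

theorem enorm_ofReal_mul_le {x : ℝ} (n : ℂ) (C : ℝ≥0∞) (z : ℂ) (h : ‖(x : ℂ)‖ₑ ≤ C * ‖n‖ₑ) :
    ‖(x : ℂ) * z‖ₑ ≤ C * ‖n * z‖ₑ := by
  rw [enorm_mul, enorm_mul, ← mul_assoc]; gcongr

theorem enorm_le_of_abs_le {x : ℝ} {n : ℂ} {C : ℕ} (h : |x| ≤ C * ‖n‖) :
    ‖(x : ℂ)‖ₑ ≤ (C : ℝ≥0∞) * ‖n‖ₑ := by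
  rw [← ofReal_norm, ← ofReal_norm, ← ENNReal.ofReal_natCast, ← ENNReal.ofReal_mul (by simp)]
  exact ENNReal.ofReal_le_ofReal (by simpa using h)

theorem norm_sq_sub (k l : ℤ) : ‖((k - l : ℤ) : ℂ) ^ 2‖ = ((k : ℝ) - l) ^ 2 := by
  rw [norm_pow, Complex.norm_intCast, sq_abs]; push_cast; rfl

theorem sum_le {m : ℤ → ℝ≥0∞} {e : ℤ → ℂ} {M B : ℝ} (hM : 0 ≤ M) (hB : 0 ≤ B) (n : ℕ)
    (h : ∑' j, ‖e j‖ₑ ≤ ENNReal.ofReal B)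
    (hm : ∀ j, m j = (if j = 0 then ENNReal.ofReal M else 0) + n * ‖e j‖ₑ) :
    ∑' j, m j ≤ ENNReal.ofReal (M + n * B) := by
  simp only [hm]
  rw [ENNReal.tsum_add, ENNReal.tsum_mul_left, tsum_ite_eq,
    ENNReal.ofReal_add hM (by positivity), ENNReal.ofReal_mul (by simp), ENNReal.ofReal_natCast]
  gcongr

theorem aKer_meas (h : ModeCoeffs μ δ a b c d) (k l : ℤ) :
    AEStronglyMeasurable (aKer μ c k l) volume :=
  aestronglyMeasurable_const.add ((h.meas _).const_mul _)

theorem rKer_meas (h : ModeCoeffs μ δ a b c d) (k l : ℤ) :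
    AEStronglyMeasurable (rKer c k l) volume := (h.meas _).const_mul _

theorem bKer_meas (h : ModeCoeffs μ δ a b c d) (k l : ℤ) :
    AEStronglyMeasurable (bKer μ c k l) volume := (h.aKer_meas k l).add (h.rKer_meas k l)

theorem aKer_prim (h : ModeCoeffs μ δ a b c d) (k l : ℤ) :
    IsPrim (aKer μ c k l) (aKer' d k l) := by
  have := ((h.prim (k - l)).const_mul ((-2 * |(k : ℝ) - l| : ℝ) : ℂ)).add_const
    (if k = l then (μ : ℂ) else 0)
  refine (congrArg (IsPrim · _) (funext fun t => ?_)).mp this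
  simp only [aKer]; ring

theorem aKer_herm (h : ModeCoeffs μ δ a b c d) (k l : ℤ) :
    ∀ᵐ t, starRingEnd ℂ (aKer μ c k l t) = aKer μ c l k t := by
  filter_upwards [h.herm (k - l)] with t ht
  have e : l - k = -(k - l) := by ring
  simp only [aKer, map_add, map_mul, Complex.conj_ofReal, apply_ite (starRingEnd ℂ), map_zero]
  rw [e, ht, abs_sub_comm (l : ℝ), if_congr (eq_comm (a := l) (b := k)) rfl rfl]

theorem prod_meas {K : ℤ → ℤ → ℝ → ℂ} (hK : ∀ k l, AEStronglyMeasurable (K k l) volume)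
    {p q : ℤ → ℝ → ℂ} (hp : ∀ k, AEStronglyMeasurable (p k) volume)
    (hq : ∀ k, AEStronglyMeasurable (q k) volume) (k l : ℤ) :
    AEStronglyMeasurable (fun t => K k l t * p l t * starRingEnd ℂ (q k t)) volume :=
  ((hK k l).mul (hp l)).mul (Complex.continuous_conj.comp_aestronglyMeasurable (hq k))

theorem enorm_form_le {x p q : ℂ} {m : ℝ≥0∞} (h : ‖x‖ₑ ≤ m) :
    ‖x * p * starRingEnd ℂ q‖ₑ ≤ m * ‖p‖ₑ * ‖q‖ₑ := by
  rw [enorm_mul, enorm_mul, enorm_eq_nnnorm (starRingEnd ℂ _), RCLike.nnnorm_conj,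
    ← enorm_eq_nnnorm]
  gcongr

theorem aKer_enorm_le (k l : ℤ) (t : ℝ) : ‖aKer μ c k l t‖ₑ ≤
    (if k - l = 0 then ENNReal.ofReal |μ| else 0) +
      (2 : ℕ) * ‖((k - l : ℤ) : ℂ) ^ 2 * c (k - l) t‖ₑ := by
  refine (enorm_add_le _ _).trans (add_le_add (le_of_eq ?_) ?_)
  · split_ifs with h1 h2 h2
    · rw [← ofReal_norm, Complex.norm_real, Real.norm_eq_abs]
    · lia
    · lia
    · simp
  · refine enorm_ofReal_mul_le _ _ _ (enorm_le_of_abs_le ?_)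
    rw [norm_sq_sub, abs_mul, abs_abs]
    have := abs_sub_le_sq k l
    norm_num
    exact this

theorem form_aKer (h : ModeCoeffs μ δ a b c d) {p q : ℤ → ℝ → ℂ} (hp : L2Modes p)
    (hq : L2Modes q) : FormSum (aKer μ c) p q := by
  refine (FormSum.of_le (M := |μ| + (2 : ℕ) * a)
    (m := fun j t => (if j = 0 then ENNReal.ofReal |μ| else 0) + (2 : ℕ) * ‖(j : ℂ) ^ 2 * c j t‖ₑ)
    (prod_meas h.aKer_meas hp.meas hq.meas) hp hq (fun j => ?_) ?_
    (by have := h.nonneg_a; positivity) fun k l => ?_).1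
  · exact aemeasurable_const.add (((h.meas j).const_mul _).enorm.const_mul _)
  · filter_upwards [h.bound] with t ht
    exact sum_le (abs_nonneg _) h.nonneg_a 2 ht fun j => rfl
  · exact Eventually.of_forall fun t => enorm_form_le (aKer_enorm_le k l t)

theorem form_aKer' (h : ModeCoeffs μ δ a b c d) {p : ℤ → ℝ → ℂ} (hp : L2Modes p) :
    FormSum (aKer' d) p p ∧ ‖form (aKer' d) p p‖ ≤ 2 * b * modeSq p := by
  have := (FormSum.of_le (K := aKer' d) (M := 0 + (2 : ℕ) * b)
    (m := fun j t => (if j = 0 then ENNReal.ofReal 0 else 0) + (2 : ℕ) * ‖(j : ℂ) * d j t‖ₑ)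
    (prod_meas (fun k l => (h.meas' _).const_mul _) hp.meas hp.meas) hp hp (fun j => ?_) ?_
    (by have := h.nonneg_b; positivity) fun k l => ?_)
  · refine ⟨this.1, this.2.trans (le_of_eq ?_)⟩
    push_cast; ring
  · exact aemeasurable_const.add (((h.meas' j).const_mul _).enorm.const_mul _)
  · filter_upwards [h.bound'] with t ht
    exact sum_le le_rfl h.nonneg_b 2 ht fun j => rfl
  · refine Eventually.of_forall fun t => enorm_form_le ?_
    simp only [ENNReal.ofReal_zero, ite_self, zero_add]
    refine enorm_ofReal_mul_le _ _ _ (enorm_le_of_abs_le ?_)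
    rw [Complex.norm_intCast, abs_mul, abs_abs]
    push_cast
    norm_num

theorem rKer_enorm_left {k l : ℤ} {t : ℝ} {p q : ℂ} :
    ‖rKer c k l t * (l * p) * starRingEnd ℂ q‖ₑ ≤
      ((if k - l = 0 then ENNReal.ofReal 0 else 0) +
        (4 : ℕ) * ‖((k - l : ℤ) : ℂ) ^ 2 * c (k - l) t‖ₑ) * ‖p‖ₑ * ‖q‖ₑ := by
  have e : rKer c k l t * (l * p) * starRingEnd ℂ q =
      (((rho k l * l : ℝ) : ℂ) * c (k - l) t) * p * starRingEnd ℂ q := by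
    simp only [rKer]; push_cast; ring
  rw [e]
  refine enorm_form_le ?_
  simp only [ENNReal.ofReal_zero, ite_self, zero_add]
  refine enorm_ofReal_mul_le _ _ _ (enorm_le_of_abs_le ?_)
  rw [norm_sq_sub, abs_mul, abs_of_nonneg (rho_nonneg k l)]
  exact rho_mul_abs_right_le k l

theorem rKer_enorm_right {k l : ℤ} {t : ℝ} {p q : ℂ} :
    ‖rKer c k l t * p * starRingEnd ℂ (k * q)‖ₑ ≤
      ((if k - l = 0 then ENNReal.ofReal 0 else 0) +
        (4 : ℕ) * ‖((k - l : ℤ) : ℂ) ^ 2 * c (k - l) t‖ₑ) * ‖p‖ₑ * ‖q‖ₑ := by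
  have e : rKer c k l t * p * starRingEnd ℂ (k * q) =
      (((rho k l * k : ℝ) : ℂ) * c (k - l) t) * p * starRingEnd ℂ q := by
    simp only [rKer, map_mul, map_intCast]; push_cast; ring
  rw [e]
  refine enorm_form_le ?_
  simp only [ENNReal.ofReal_zero, ite_self, zero_add]
  refine enorm_ofReal_mul_le _ _ _ (enorm_le_of_abs_le ?_)
  rw [norm_sq_sub, abs_mul, abs_of_nonneg (rho_nonneg k l)]
  exact rho_mul_abs_left_le k l

theorem rKer_m (h : ModeCoeffs μ δ a b c d) :
    (∀ j : ℤ, AEMeasurable (fun t => (if j = 0 then ENNReal.ofReal 0 else 0) +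
      ((4 : ℕ) : ℝ≥0∞) * ‖(j : ℂ) ^ 2 * c j t‖ₑ) volume) ∧
    ∀ᵐ t, ∑' j : ℤ, ((if j = 0 then ENNReal.ofReal 0 else 0) +
      ((4 : ℕ) : ℝ≥0∞) * ‖(j : ℂ) ^ 2 * c j t‖ₑ) ≤ ENNReal.ofReal (0 + (4 : ℕ) * a) := by
  refine ⟨fun j => aemeasurable_const.add (((h.meas j).const_mul _).enorm.const_mul _), ?_⟩
  filter_upwards [h.bound] with t ht
  exact sum_le le_rfl h.nonneg_a 4 ht fun j => rfl

/-- Applied to the derivative of `p`, the remainder is bounded in terms of `p`. -/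
theorem form_rKer_left (h : ModeCoeffs μ δ a b c d) {p q : ℤ → ℝ → ℂ} (hp : L2Modes p)
    (hq : L2Modes q) : FormSum (rKer c) (fun l t => l * p l t) q ∧
      ‖form (rKer c) (fun l t => l * p l t) q‖ ≤ 2 * a * (modeSq p + modeSq q) := by
  have := FormSum.of_le (K := rKer c) (p := fun l t => l * p l t) (q := q) (M := 0 + (4 : ℕ) * a)
    (m := fun j t => (if j = 0 then ENNReal.ofReal 0 else 0) + (4 : ℕ) * ‖(j : ℂ) ^ 2 * c j t‖ₑ)
    (prod_meas h.rKer_meas (fun l => (hp.meas l).const_mul _) hq.meas) hp hq h.rKer_m.1 h.rKer_m.2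
    (by have := h.nonneg_a; positivity) fun k l => Eventually.of_forall fun t => rKer_enorm_left
  refine ⟨this.1, this.2.trans (le_of_eq ?_)⟩
  push_cast; ring

theorem form_rKer_right (h : ModeCoeffs μ δ a b c d) {p q : ℤ → ℝ → ℂ} (hp : L2Modes p)
    (hq : L2Modes q) : FormSum (rKer c) p (fun k t => k * q k t) ∧
      ‖form (rKer c) p (fun k t => k * q k t)‖ ≤ 2 * a * (modeSq p + modeSq q) := by
  have := FormSum.of_le (K := rKer c) (p := p) (q := fun k t => k * q k t) (M := 0 + (4 : ℕ) * a)
    (m := fun j t => (if j = 0 then ENNReal.ofReal 0 else 0) + (4 : ℕ) * ‖(j : ℂ) ^ 2 * c j t‖ₑ)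
    (prod_meas h.rKer_meas hp.meas (fun l => (hq.meas l).const_mul _)) hp hq h.rKer_m.1 h.rKer_m.2
    (by have := h.nonneg_a; positivity) fun k l => Eventually.of_forall fun t => rKer_enorm_right
  refine ⟨this.1, this.2.trans (le_of_eq ?_)⟩
  push_cast; ring

theorem bKer_eq (μ : ℝ) (c : ℤ → ℝ → ℂ) (k l : ℤ) (t : ℝ) : bKer μ c k l t =
    (if k = l then (μ : ℂ) else 0) + (lam k l : ℂ) * c (k - l) t := by
  simp only [bKer, aKer, rKer, lam]; push_cast; ring

theorem bKer_enorm_le (k l : ℤ) (t : ℝ) : ‖bKer μ c k l t‖ₑ ≤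
    (if k - l = 0 then ENNReal.ofReal |μ| else 0) +
      (2 : ℕ) * ‖((k - l : ℤ) : ℂ) ^ 2 * c (k - l) t‖ₑ := by
  rw [bKer_eq]
  refine (enorm_add_le _ _).trans (add_le_add (le_of_eq ?_) ?_)
  · split_ifs with h1 h2 h2
    · rw [← ofReal_norm, Complex.norm_real, Real.norm_eq_abs]
    · lia
    · lia
    · simp
  · refine enorm_ofReal_mul_le _ _ _ (enorm_le_of_abs_le ?_)
    rw [norm_sq_sub]
    have := abs_sub_le_sq k l
    have := abs_lam_le k l
    push_cast
    linarith

theorem form_bKer (h : ModeCoeffs μ δ a b c d) {p q : ℤ → ℝ → ℂ} (hp : L2Modes p)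
    (hq : L2Modes q) : FormSum (bKer μ c) p q := by
  refine (FormSum.of_le (M := |μ| + (2 : ℕ) * a)
    (m := fun j t => (if j = 0 then ENNReal.ofReal |μ| else 0) + (2 : ℕ) * ‖(j : ℂ) ^ 2 * c j t‖ₑ)
    (prod_meas h.bKer_meas hp.meas hq.meas) hp hq (fun j => ?_) ?_
    (by have := h.nonneg_a; positivity) fun k l => ?_).1
  · exact aemeasurable_const.add (((h.meas j).const_mul _).enorm.const_mul _)
  · filter_upwards [h.bound] with t ht
    exact sum_le (abs_nonneg _) h.nonneg_a 2 ht fun j => rfl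
  · exact Eventually.of_forall fun t => enorm_form_le (bKer_enorm_le k l t)

/-- The energy identity of the principal part: by symmetry, the time derivative falls on the
coefficient. -/
theorem abs_re_form_aKer_deriv_le (h : ModeCoeffs μ δ a b c d) {Z Z' : ℤ → ℝ → ℂ}
    (hZ : L2Modes Z) (hZ' : L2Modes Z') (hp : ∀ k, IsPrim (Z k) (Z' k)) :
    |(form (aKer μ c) Z' Z).re| ≤ b * modeSq Z := by
  have h1 := h.form_aKer hZ' hZ
  have h2 := h.form_aKer hZ hZ'
  have h3 := h.form_aKer hZ hZ
  obtain ⟨h4, h5⟩ := h.form_aKer' hZ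
  have key : form (aKer' d) Z Z + (form (aKer μ c) Z' Z + form (aKer μ c) Z Z') = 0 := by
    unfold form
    rw [← h1.summable.tsum_add h2.summable, ← h4.summable.tsum_add (h1.summable.add h2.summable)]
    refine (tsum_congr fun kl => ?_).trans tsum_zero
    have s1 := integral_add (h1.integrable kl) (h2.integrable kl)
    have s2 := integral_add (h4.integrable kl) ((h1.integrable kl).add (h2.integrable kl))
    simp only [Pi.add_apply] at s2
    rw [← s1, ← s2]
    have hP := ((h.aKer_prim kl.1 kl.2).mul (hp kl.2)).mul (hp kl.1).conj
    have hi := (h4.integrable kl).add ((h1.integrable kl).add (h2.integrable kl))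
    have e : (fun t => (aKer' d kl.1 kl.2 t * Z kl.2 t + aKer μ c kl.1 kl.2 t * Z' kl.2 t) *
        starRingEnd ℂ (Z kl.1 t) + aKer μ c kl.1 kl.2 t * Z kl.2 t * starRingEnd ℂ (Z' kl.1 t)) =
        fun t => aKer' d kl.1 kl.2 t * Z kl.2 t * starRingEnd ℂ (Z kl.1 t) +
          (aKer μ c kl.1 kl.2 t * Z' kl.2 t * starRingEnd ℂ (Z kl.1 t) +
            aKer μ c kl.1 kl.2 t * Z kl.2 t * starRingEnd ℂ (Z' kl.1 t)) := by
      funext t; ring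
    rw [e] at hP
    exact hP.integral_eq_zero (h3.integrable kl) hi
  rw [← form_conj h.aKer_herm Z' Z, Complex.add_conj] at key
  have e : (form (aKer μ c) Z' Z).re = -(form (aKer' d) Z Z).re / 2 := by
    have := congrArg Complex.re key
    simp at this
    linarith
  rw [e, abs_div, abs_neg]
  have := (Complex.abs_re_le_norm _).trans h5
  rw [abs_two]
  linarith

theorem modeSq_eq_integral {Z : ℤ → ℝ → ℂ} (hZ : L2Modes Z) :
    Integrable (fun t => ∑' k, ‖Z k t‖ ^ 2) volume ∧ modeSq Z = ∫ t, ∑' k, ‖Z k t‖ ^ 2 := by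
  have hS := hZ.sumInt hZ
  have e : ∀ t, ∑' k, Z k t * starRingEnd ℂ (Z k t) = ((∑' k, ‖Z k t‖ ^ 2 : ℝ) : ℂ) := by
    intro t
    rw [Complex.ofReal_tsum]
    exact tsum_congr fun k => by rw [Complex.mul_conj, Complex.normSq_eq_norm_sq]
  have hi := hS.integrable_tsum
  simp only [e] at hi
  refine ⟨by simpa using hi.re, ?_⟩
  have := hS.integral_tsum
  simp only [e] at this
  rw [integral_complex_ofReal] at this
  have e2 : ∀ k, ∫ t, Z k t * starRingEnd ℂ (Z k t) = ((∫ t, ‖Z k t‖ ^ 2 : ℝ) : ℂ) := fun k => by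
    rw [← integral_complex_ofReal]
    congr 1; funext t
    rw [Complex.mul_conj, Complex.normSq_eq_norm_sq]
  simp only [e2] at this
  rw [← Complex.ofReal_tsum] at this
  rw [← hZ.hasSum.tsum_eq]
  exact_mod_cast this

theorem modeSq_le_re_form (h : ModeCoeffs μ δ a b c d) {Z : ℤ → ℝ → ℂ} (hZ : L2Modes Z) :
    δ / 2 * modeSq Z ≤ (form (aKer μ c) Z Z).re := by
  have h3 := h.form_aKer hZ hZ
  obtain ⟨hi, he⟩ := modeSq_eq_integral hZ
  have hre : ∀ {f : ℝ → ℂ}, Integrable f volume → (∫ t, f t).re = ∫ t, (f t).re := fun hf => by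
    simpa using (integral_re hf).symm
  unfold form
  rw [h3.integral_tsum, hre h3.integrable_tsum, he, ← integral_const_mul]
  refine integral_mono_ae (hi.const_mul _) (by simpa using h3.integrable_tsum.re) ?_
  filter_upwards [h.pos, (hZ.sumInt hZ).ae_summable] with t ht hs
  refine ht _ (hs.congr fun k => ?_)
  rw [norm_mul, RCLike.norm_conj, sq]

end ModeCoeffs

/-! ### Solving `z' = γ z - y` in `L²(ℝ)` -/

/-- The pointwise bound that follows from the Cauchy-Schwarz inequality. -/
theorem norm_integral_exp_mul_le {γ : ℝ} (hγ : 0 < γ) {y : ℝ → ℂ} (hy : MemLp y 2 volume)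
    (t : ℝ) : IntegrableOn (fun s => (Real.exp (-γ * s) : ℂ) * y s) (Ioi t) volume ∧
      ‖(Real.exp (γ * t) : ℂ) * ∫ s in Ioi t, (Real.exp (-γ * s) : ℂ) * y s‖ ^ 2 ≤
        (∫ s, ‖y s‖ ^ 2) / (2 * γ) := by
  have he : ∀ s : ℝ, Real.exp (-γ * s) ^ 2 = Real.exp (-(2 * γ) * s) := fun s => by
    rw [← Real.exp_nat_mul]; congr 1; push_cast; ring
  have hi : IntegrableOn (fun s => Real.exp (-γ * s) ^ 2) (Ioi t) volume := by
    simp only [he]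
    exact integrableOn_exp_mul_Ioi (by linarith) t
  have hm : AEStronglyMeasurable (fun s => (Real.exp (-γ * s) : ℂ)) (volume.restrict (Ioi t)) :=
    Continuous.aestronglyMeasurable (by fun_prop)
  have hexp : MemLp (fun s => (Real.exp (-γ * s) : ℂ)) 2 (volume.restrict (Ioi t)) := by
    rw [← memLp_norm_iff hm, memLp_two_iff_integrable_sq hm.norm]
    refine hi.congr (Eventually.of_forall fun s => ?_)
    simp only [Complex.norm_real, Real.norm_eq_abs, sq_abs]
  have hyr : MemLp y 2 (volume.restrict (Ioi t)) := hy.restrict _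
  have h2 : ENNReal.ofReal 2 = 2 := by norm_num
  have hCS := integral_mul_norm_le_Lp_mul_Lq (μ := volume.restrict (Ioi t))
    (f := fun s => (Real.exp (-γ * s) : ℂ)) (g := y) Real.HolderConjugate.two_two
    (by rwa [h2]) (by rwa [h2])
  refine ⟨hexp.integrable_mul hyr, ?_⟩
  have hE : ∫ s in Ioi t, ‖(Real.exp (-γ * s) : ℂ)‖ ^ (2 : ℝ) = Real.exp (-(2 * γ) * t) / (2 * γ) := by
    have : ∀ s : ℝ, ‖(Real.exp (-γ * s) : ℂ)‖ ^ (2 : ℝ) = Real.exp (-(2 * γ) * s) := fun s => by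
      rw [Complex.norm_real, Real.norm_eq_abs, Real.rpow_ofNat, sq_abs, he]
    simp only [this]
    rw [integral_exp_mul_Ioi (by linarith)]
    field_simp
  have hY : ∫ s in Ioi t, ‖y s‖ ^ (2 : ℝ) ≤ ∫ s, ‖y s‖ ^ 2 := by
    simp only [Real.rpow_ofNat]
    exact setIntegral_le_integral (hy.integrable_norm_pow (by norm_num))
      (Eventually.of_forall fun s => by positivity)
  have hY0 : 0 ≤ ∫ s in Ioi t, ‖y s‖ ^ (2 : ℝ) := integral_nonneg fun s => by positivity
  rw [hE] at hCS
  have h3 : ‖∫ s in Ioi t, (Real.exp (-γ * s) : ℂ) * y s‖ ^ 2 ≤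
      Real.exp (-(2 * γ) * t) / (2 * γ) * ∫ s, ‖y s‖ ^ 2 := by
    have h4 : ‖∫ s in Ioi t, (Real.exp (-γ * s) : ℂ) * y s‖ ≤
        (Real.exp (-(2 * γ) * t) / (2 * γ)) ^ (1 / (2 : ℝ)) *
          (∫ s in Ioi t, ‖y s‖ ^ (2 : ℝ)) ^ (1 / (2 : ℝ)) := by
      refine (norm_integral_le_integral_norm _).trans (le_trans (le_of_eq ?_) hCS)
      congr 1; funext s; rw [norm_mul]
    refine (pow_le_pow_left₀ (norm_nonneg _) h4 2).trans ?_
    rw [mul_pow, ← Real.sqrt_eq_rpow, ← Real.sqrt_eq_rpow, Real.sq_sqrt (by positivity),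
      Real.sq_sqrt hY0]
    gcongr
  rw [norm_mul, mul_pow, Complex.norm_real, Real.norm_eq_abs, sq_abs]
  have h5 : Real.exp (γ * t) ^ 2 * Real.exp (-(2 * γ) * t) = 1 := by
    rw [← Real.exp_nat_mul, ← Real.exp_add]; simp; ring
  calc _ ≤ Real.exp (γ * t) ^ 2 * (Real.exp (-(2 * γ) * t) / (2 * γ) * ∫ s, ‖y s‖ ^ 2) := by
        gcongr
    _ = (Real.exp (γ * t) ^ 2 * Real.exp (-(2 * γ) * t)) * ((∫ s, ‖y s‖ ^ 2) / (2 * γ)) := by ring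
    _ = _ := by rw [h5, one_mul]

/-- The solution `z(t) = ∫_t^∞ e^{γ(t - s)} y(s) ds` of the backward equation. -/
theorem exists_backward {γ : ℝ} (hγ : 0 < γ) {y : ℝ → ℂ} (hy : MemLp y 2 volume) :
    ∃ z : ℝ → ℂ, IsPrim z (fun t => γ * z t - y t) ∧ AEStronglyMeasurable z volume ∧
      ∫⁻ t, ‖z t‖ₑ ^ 2 ≤ ENNReal.ofReal (2 / γ ^ 2) * ∫⁻ t, ‖y t‖ₑ ^ 2 := by
  set f : ℝ → ℂ := fun s => (Real.exp (-γ * s) : ℂ) * y s with hf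
  have hyl : LocallyIntegrable y volume := hy.locallyIntegrable (by norm_num)
  have hfl : LocallyIntegrable f volume := by
    have hexp : Continuous fun s : ℝ => (Real.exp (-γ * s) : ℂ) := by fun_prop
    exact hyl.continuous_smul hexp
  set w : ℝ → ℂ := fun t => ∫ s in Ioi t, f s with hw
  have hwp : IsPrim w (fun t => -1 * f t) := by
    have h := ((IsPrim.of_integral hfl 0 0).const_mul (-1)).add_const (∫ s in Ioi 0, f s)
    refine (congrArg (IsPrim · _) (funext fun t => ?_)).mp h
    have := intervalIntegral.integral_Ioi_sub_Ioi' (norm_integral_exp_mul_le hγ hy 0).1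
      (norm_integral_exp_mul_le hγ hy t).1
    simp only [hw]
    rw [← this]; ring
  set z : ℝ → ℂ := fun t => (Real.exp (γ * t) : ℂ) * w t with hz
  have hzp : IsPrim z (fun t => γ * z t - y t) := by
    have h := (IsPrim.exp γ).mul hwp
    refine (congrArg (IsPrim z) (funext fun t => ?_)).mp h
    have : (Real.exp (γ * t) : ℂ) * (Real.exp (-γ * t) : ℂ) = 1 := by
      rw [← Complex.ofReal_mul, ← Real.exp_add]; simp
    simp only [hz, hf]
    linear_combination (-y t) * this
  set Y := ∫ s, ‖y s‖ ^ 2 with hY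
  have hY0 : 0 ≤ Y := integral_nonneg fun s => by positivity
  have hyi : Integrable (fun s => ‖y s‖ ^ 2) volume := hy.integrable_norm_pow (by norm_num)
  have hzb : ∀ t, ‖z t‖ ^ 2 ≤ Y / (2 * γ) := fun t => (norm_integral_exp_mul_le hγ hy t).2
  have hzc : Continuous fun t => ‖z t‖ ^ 2 := hzp.continuous.norm.pow 2
  -- the energy inequality on a bounded interval
  have henergy : ∀ n : ℕ, ∫ t in (-(n : ℝ))..n, ‖z t‖ ^ 2 ≤ 2 / γ ^ 2 * Y := by
    intro n
    have hn : -(n : ℝ) ≤ n := by have : (0 : ℝ) ≤ n := n.cast_nonneg; linarith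
    have hp := (hzp.mul hzp.conj).sub_eq (-n) n
    have hi := ((hzp.mul hzp.conj).intervalIntegrable (-n) n)
    have e : ∀ t, ((γ * z t - y t) * starRingEnd ℂ (z t) +
        z t * starRingEnd ℂ (γ * z t - y t)).re =
        2 * γ * ‖z t‖ ^ 2 - 2 * (y t * starRingEnd ℂ (z t)).re := fun t => by
      rw [← Complex.normSq_eq_norm_sq, Complex.normSq_apply]
      simp; ring
    have hre : (∫ t in (-(n : ℝ))..n, ((γ * z t - y t) * starRingEnd ℂ (z t) +
        z t * starRingEnd ℂ (γ * z t - y t))).re =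
        ∫ t in (-(n : ℝ))..n, (2 * γ * ‖z t‖ ^ 2 - 2 * (y t * starRingEnd ℂ (z t)).re) := by
      rw [← funext e, intervalIntegral.integral_of_le hn, intervalIntegral.integral_of_le hn]
      simpa using (integral_re hi.1).symm
    rw [← hp] at hre
    have hleft : (z n * starRingEnd ℂ (z n) - z (-n) * starRingEnd ℂ (z (-n))).re ≤
        Y / (2 * γ) := by
      rw [Complex.mul_conj, Complex.mul_conj, Complex.normSq_eq_norm_sq,
        Complex.normSq_eq_norm_sq, ← Complex.ofReal_sub, Complex.ofReal_re]
      have := hzb n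
      have := sq_nonneg ‖z (-n)‖
      linarith
    rw [hre] at hleft
    have hiR : IntervalIntegrable
        (fun t => 2 * γ * ‖z t‖ ^ 2 - 2 * (y t * starRingEnd ℂ (z t)).re) volume (-n) n := by
      rw [← funext e]; exact ⟨hi.1.re, hi.2.re⟩
    have hiL : IntervalIntegrable (fun t => γ * ‖z t‖ ^ 2 - ‖y t‖ ^ 2 / γ) volume (-n) n :=
      ((hzc.intervalIntegrable _ _).const_mul _).sub (hyi.div_const γ).intervalIntegrable
    have hmono : ∫ t in (-(n : ℝ))..n, (γ * ‖z t‖ ^ 2 - ‖y t‖ ^ 2 / γ) ≤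
        ∫ t in (-(n : ℝ))..n, (2 * γ * ‖z t‖ ^ 2 - 2 * (y t * starRingEnd ℂ (z t)).re) := by
      refine intervalIntegral.integral_mono_on hn hiL hiR fun t _ => ?_
      have h1 := Complex.re_le_norm (y t * starRingEnd ℂ (z t))
      rw [norm_mul, RCLike.norm_conj] at h1
      have h2 : 2 * (‖y t‖ * ‖z t‖) ≤ γ * ‖z t‖ ^ 2 + ‖y t‖ ^ 2 / γ := by
        have : 0 ≤ (γ * ‖z t‖ - ‖y t‖) ^ 2 / γ := by positivity
        have e : (γ * ‖z t‖ - ‖y t‖) ^ 2 / γ =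
            γ * ‖z t‖ ^ 2 + ‖y t‖ ^ 2 / γ - 2 * (‖y t‖ * ‖z t‖) := by field_simp; ring
        linarith
      linarith
    have hsplit : ∫ t in (-(n : ℝ))..n, (γ * ‖z t‖ ^ 2 - ‖y t‖ ^ 2 / γ) =
        γ * (∫ t in (-(n : ℝ))..n, ‖z t‖ ^ 2) - (∫ t in (-(n : ℝ))..n, ‖y t‖ ^ 2) / γ := by
      rw [intervalIntegral.integral_sub ((hzc.intervalIntegrable _ _).const_mul _)
        (hyi.div_const γ).intervalIntegrable, intervalIntegral.integral_const_mul,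
        intervalIntegral.integral_div]
    have hYn : ∫ t in (-(n : ℝ))..n, ‖y t‖ ^ 2 ≤ Y := by
      rw [intervalIntegral.integral_of_le hn]
      exact setIntegral_le_integral hyi (Eventually.of_forall fun s => by positivity)
    have h6 : γ * (∫ t in (-(n : ℝ))..n, ‖z t‖ ^ 2) ≤ Y / (2 * γ) + Y / γ := by
      have : (∫ t in (-(n : ℝ))..n, ‖y t‖ ^ 2) / γ ≤ Y / γ := by gcongr
      linarith
    have h7 : Y / (2 * γ) + Y / γ ≤ 2 / γ * Y := by
      have : Y / (2 * γ) + Y / γ = 3 / 2 * (Y / γ) := by field_simp; ring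
      rw [this]
      have : 2 / γ * Y = 2 * (Y / γ) := by ring
      rw [this]
      have : 0 ≤ Y / γ := by positivity
      linarith
    have h8 : 2 / γ ^ 2 * Y = (2 / γ * Y) / γ := by field_simp
    rw [h8, le_div_iff₀ hγ]
    linarith
  have hzi : Integrable (fun t => ‖z t‖ ^ 2) volume := by
    refine integrable_of_intervalIntegral_norm_bounded (2 / γ ^ 2 * Y) (l := atTop)
      (a := fun n : ℕ => -(n : ℝ)) (b := fun n : ℕ => (n : ℝ))
      (fun n => (hzc.locallyIntegrable (μ := volume)).integrableOn_isCompact isCompact_Icc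
        |>.mono_set Ioc_subset_Icc_self) ?_ ?_ ?_
    · exact tendsto_neg_atTop_atBot.comp tendsto_natCast_atTop_atTop
    · exact tendsto_natCast_atTop_atTop
    · refine Eventually.of_forall fun n => ?_
      simpa using henergy n
  have hzle : ∫ t, ‖z t‖ ^ 2 ≤ 2 / γ ^ 2 * Y := by
    refine le_of_tendsto' (intervalIntegral_tendsto_integral hzi
      (tendsto_neg_atTop_atBot.comp tendsto_natCast_atTop_atTop) tendsto_natCast_atTop_atTop)
      henergy
  refine ⟨z, hzp, hzp.continuous.aestronglyMeasurable, ?_⟩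
  have conv : ∀ {h : ℝ → ℂ}, Integrable (fun t => ‖h t‖ ^ 2) volume →
      ∫⁻ t, ‖h t‖ₑ ^ 2 = ENNReal.ofReal (∫ t, ‖h t‖ ^ 2) := fun hh => by
    rw [ofReal_integral_eq_lintegral_ofReal hh (Eventually.of_forall fun t => by positivity)]
    refine lintegral_congr fun t => ?_
    rw [ENNReal.ofReal_pow (norm_nonneg _), ofReal_norm]
  rw [conv hzi, conv hyi, ← ENNReal.ofReal_mul (by positivity)]
  exact ENNReal.ofReal_le_ofReal hzle

/-! ### Solutions in terms of Fourier coefficients; uniqueness -/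

/-- The `k`-th Fourier coefficient of the spatial part
`-μ φ_xx - (2 H[Φ₀_x Φ_x] - [Φ; H] Φ₀_xx - [Φ₀; H] Φ_xx)_x` of the linearized operator, if `p` are
the coefficients of `φ`. -/
def modeOp (μ : ℝ) (c p : ℤ → ℝ → ℂ) (k : ℤ) (t : ℝ) : ℂ :=
  k * ∑' l : ℤ, bKer μ c k l t * (l * p l t)

/-- `p` are the Fourier coefficients of a solution of the linearized equation with right hand
side `g`, and `v` those of its time derivative. The equation is encoded in its integrated form by
`prim_v`; the representatives `p` and `v` are continuous, and `zero` is the zero mean condition. -/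
structure ModeSol (μ γ : ℝ) (c g p v : ℤ → ℝ → ℂ) : Prop where
  prim_p : ∀ k, IsPrim (p k) (v k)
  prim_v : ∀ k, IsPrim (v k) (fun t => g k t - modeOp μ c p k t)
  zero : ∀ t, p 0 t = 0
  memDt : L2Modes fun k t => (Real.exp (-γ * t) : ℂ) * v k t
  memDx : L2Modes fun k t => (Real.exp (-γ * t) : ℂ) * (k * p k t)

namespace ModeCoeffs

variable {μ δ a b : ℝ} {c d : ℤ → ℝ → ℂ}

theorem sumInt_row (h : ModeCoeffs μ δ a b c d) {P : ℤ → ℝ → ℂ} (hP : L2Modes P) {q : ℝ → ℂ}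
    (hq : MemLp q 2 volume) (k : ℤ) :
    SumInt volume fun l t => bKer μ c k l t * P l t * starRingEnd ℂ (q t) := by
  have := (h.form_bKer hP (.single hq k)).fiber k
  simpa using this

theorem row_summable (h : ModeCoeffs μ δ a b c d) {γ : ℝ} {p : ℤ → ℝ → ℂ}
    (hp : L2Modes fun k t => (Real.exp (-γ * t) : ℂ) * (k * p k t)) (k : ℤ) :
    ∀ᵐ t, Summable fun l : ℤ => bKer μ c k l t * (l * p l t) := by
  -- any positive function in `L²(ℝ)` would do as a test function
  have hq : MemLp (fun t : ℝ => (Real.exp (-t ^ 2) : ℂ)) 2 volume := by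
    have hm : AEStronglyMeasurable (fun t : ℝ => (Real.exp (-t ^ 2) : ℂ)) volume :=
      Continuous.aestronglyMeasurable (by fun_prop)
    rw [← memLp_norm_iff hm, memLp_two_iff_integrable_sq hm.norm]
    refine (integrable_exp_neg_mul_sq (b := 2) (by norm_num)).congr
      (Eventually.of_forall fun t => ?_)
    simp only [Complex.norm_real, Real.norm_eq_abs, sq_abs]
    rw [← Real.exp_nat_mul]; congr 1; push_cast; ring
  filter_upwards [(h.sumInt_row hp hq k).ae_summable] with t ht
  have h0 : (Real.exp (-γ * t) : ℂ) * (Real.exp (-t ^ 2) : ℂ) ≠ 0 := by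
    rw [← Complex.ofReal_mul]; exact_mod_cast (mul_pos (Real.exp_pos _) (Real.exp_pos _)).ne'
  refine (summable_mul_left_iff h0).1 (ht.of_norm.congr fun l => ?_)
  rw [Complex.conj_ofReal]; ring

end ModeCoeffs

namespace ModeSol

variable {μ δ a b γ : ℝ} {c d g p v p' v' : ℤ → ℝ → ℂ}

theorem sub (hc : ModeCoeffs μ δ a b c d) (h : ModeSol μ γ c g p v) (h' : ModeSol μ γ c g p' v') :
    ModeSol μ γ c 0 (fun k t => p k t - p' k t) (fun k t => v k t - v' k t) where
  prim_p k := (h.prim_p k).sub (h'.prim_p k)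
  prim_v k := by
    refine ((h.prim_v k).sub (h'.prim_v k)).congr_ae ?_
    filter_upwards [hc.row_summable h.memDx k, hc.row_summable h'.memDx k] with t h1 h2
    simp only [modeOp, mul_sub, Pi.zero_apply]
    rw [h1.tsum_sub h2]; ring
  zero t := by rw [h.zero, h'.zero, sub_zero]
  memDt := by simpa only [mul_sub] using h.memDt.sub h'.memDt
  memDx := by simpa only [mul_sub] using h.memDx.sub h'.memDx

/-- Uniqueness, by Ladyzhenskaya's choice of the test function
`e^{-γ t} z` with `z(t) = ∫_t^∞ e^{γ(t - s)} e^{-γ s} p(s) ds`, whose derivative gives back `p`. -/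
theorem eq_zero (hc : ModeCoeffs μ δ a b c d) (hγ : 0 < γ) (hγa : 2 * a < γ)
    (hγb : b + 2 * a ≤ γ * (δ / 2)) (h : ModeSol μ γ c 0 p v) (k : ℤ) (t : ℝ) : p k t = 0 := by
  set E : ℝ → ℂ := fun t => (Real.exp (-γ * t) : ℂ) with hE
  have hEp : IsPrim E (fun t => ((-γ : ℝ) : ℂ) * E t) := .exp (-γ)
  set y : ℤ → ℝ → ℂ := fun k t => E t * p k t with hy
  set u : ℤ → ℝ → ℂ := fun k t => E t * v k t with hu
  set Y : ℤ → ℝ → ℂ := fun k t => k * y k t with hYdef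
  have hU : L2Modes u := h.memDt
  have hY : L2Modes Y := by
    refine h.memDx.congr fun k => Eventually.of_forall fun t => ?_
    simp only [hYdef, hy, hE]; ring
  have hyp : ∀ k, IsPrim (y k) (fun t => u k t - γ * y k t) := fun k => by
    refine (congrArg (IsPrim (y k)) (funext fun t => ?_)).mp (hEp.mul (h.prim_p k))
    simp only [hy, hu]; push_cast; ring
  have hyL : L2Modes y := by
    refine hY.of_le (c := 1) (by simp) (fun k => (hyp k).continuous.aestronglyMeasurable)
      fun k => ?_
    rw [one_mul]
    refine lintegral_mono fun t => ?_
    rcases eq_or_ne k 0 with rfl | hk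
    · simp [hy, h.zero]
    · have : (1 : ℝ≥0∞) ≤ ‖(k : ℂ)‖ₑ := by
        rw [← ofReal_norm, Complex.norm_intCast, ← ENNReal.ofReal_one]
        exact ENNReal.ofReal_le_ofReal (by exact_mod_cast Int.one_le_abs hk)
      simp only [hYdef, enorm_mul, mul_pow]
      exact le_mul_of_one_le_left (by simp) (one_le_pow₀ this)
  choose z hzp hzm hzb using fun k => exists_backward hγ (hyL.memLp k)
  have hzL : L2Modes z := hyL.of_le (by simp) hzm hzb
  set Z : ℤ → ℝ → ℂ := fun k t => k * z k t with hZdef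
  have hZ : L2Modes Z := by
    refine hY.of_le (c := ENNReal.ofReal (2 / γ ^ 2)) (by simp)
      (fun k => (hzm k).const_mul _) fun k => ?_
    simp only [hZdef, hYdef, enorm_mul, mul_pow]
    rw [lintegral_const_mul' _ _ (by simp), lintegral_const_mul' _ _ (by simp), mul_left_comm]
    gcongr
    exact hzb k
  set Z' : ℤ → ℝ → ℂ := fun k t => γ * Z k t - Y k t with hZ'def
  have hZ' : L2Modes Z' := (hZ.const_mul γ).sub hY
  have hZp : ∀ k, IsPrim (Z k) (Z' k) := fun k => by
    refine (congrArg (IsPrim (Z k)) (funext fun t => ?_)).mp ((hzp k).const_mul (k : ℂ))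
    simp only [hZ'def, hZdef, hYdef]; ring
  -- the equation tested by `e^{-γ t} z`
  have hF := hc.form_bKer hY hZ
  have hW : ∀ k t, (E t * modeOp μ c p k t) * starRingEnd ℂ (z k t) =
      ∑' l, bKer μ c k l t * Y l t * starRingEnd ℂ (Z k t) := fun k t => by
    rw [modeOp, ← tsum_mul_left, ← tsum_mul_left, ← tsum_mul_right]
    refine tsum_congr fun l => ?_
    simp only [hYdef, hy, hZdef, map_mul, map_intCast]; ring
  have htest : ∀ k, (∫ t, ∑' l, bKer μ c k l t * Y l t * starRingEnd ℂ (Z k t)) =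
      -∫ t, u k t * starRingEnd ℂ (y k t) := fun k => by
    have hWi := (hF.fiber k).integrable_tsum
    have huy := hU.integrable_mul_conj hyL k k
    have hq := (h.prim_v k).mul (hEp.mul (hzp k)).conj
    have e1 : (fun t => v k t * starRingEnd ℂ (E t * z k t)) =
        fun t => u k t * starRingEnd ℂ (z k t) := by
      funext t; simp only [hu, hE, map_mul, Complex.conj_ofReal]; ring
    have e2 : (fun t => ((0 : ℤ → ℝ → ℂ) k t - modeOp μ c p k t) * starRingEnd ℂ (E t * z k t) +
        v k t * starRingEnd ℂ (((-γ : ℝ) : ℂ) * E t * z k t + E t * (γ * z k t - y k t))) =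
        fun t => -((∑' l, bKer μ c k l t * Y l t * starRingEnd ℂ (Z k t)) +
          u k t * starRingEnd ℂ (y k t)) := by
      funext t
      rw [← hW]
      simp only [hu, hE, Pi.zero_apply, map_mul, map_add, map_sub, Complex.conj_ofReal]
      push_cast; ring
    rw [e1, e2] at hq
    have := hq.integral_eq_zero (hU.integrable_mul_conj hzL k k) (hWi.add huy).neg
    rw [integral_neg, neg_eq_zero, integral_add hWi huy] at this
    linear_combination this
  have hre : ∀ k, (∫ t, u k t * starRingEnd ℂ (y k t)).re = γ * ∫ t, ‖y k t‖ ^ 2 := fun k => by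
    have hp := (hyp k).mul (hyp k).conj
    have i1 := hU.integrable_mul_conj hyL k k
    have i2 := hyL.integrable_mul_conj hU k k
    have i3 := (hyL.integrable_mul_conj hyL k k).const_mul (2 * γ : ℂ)
    have e : (fun t => (u k t - γ * y k t) * starRingEnd ℂ (y k t) +
        y k t * starRingEnd ℂ (u k t - γ * y k t)) = fun t =>
        u k t * starRingEnd ℂ (y k t) + y k t * starRingEnd ℂ (u k t) -
          2 * γ * (y k t * starRingEnd ℂ (y k t)) := by
      funext t; simp only [map_sub, map_mul, Complex.conj_ofReal]; ring
    rw [e] at hp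
    have h0 := hp.integral_eq_zero (hyL.integrable_mul_conj hyL k k) ((i1.add i2).sub i3)
    have s1 := integral_sub (i1.add i2) i3
    simp only [Pi.add_apply] at s1
    rw [s1, integral_add i1 i2, integral_const_mul] at h0
    have c1 : ∫ t, y k t * starRingEnd ℂ (u k t) =
        starRingEnd ℂ (∫ t, u k t * starRingEnd ℂ (y k t)) := by
      rw [← integral_conj]; congr 1; funext t; simp [mul_comm]
    have c2 : ∫ t, y k t * starRingEnd ℂ (y k t) = ((∫ t, ‖y k t‖ ^ 2 : ℝ) : ℂ) := by
      rw [← integral_complex_ofReal]; congr 1; funext t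
      rw [Complex.mul_conj, Complex.normSq_eq_norm_sq]
    rw [c1, c2, Complex.add_conj] at h0
    have := congrArg Complex.re h0
    simp at this
    linarith
  have hsum : (form (bKer μ c) Y Z).re = -(γ * modeSq y) := by
    have h1 : form (bKer μ c) Y Z = -∑' k, ∫ t, u k t * starRingEnd ℂ (y k t) := by
      rw [← tsum_neg]
      exact hF.tsum_prod.trans (tsum_congr htest)
    rw [h1, Complex.neg_re, Complex.re_tsum (hU.sumInt hyL).summable]
    simp only [hre]
    rw [tsum_mul_left, hyL.hasSum.tsum_eq]
  -- the form is nearly nonnegative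
  obtain ⟨hR, hRb⟩ := hc.form_rKer_left hyL hZ
  have hA : FormSum (aKer μ c) (fun k t => γ * Z k t) Z :=
    ((hc.form_aKer hZ hZ).const_mul (γ : ℂ)).congr fun kl =>
      Eventually.of_forall fun t => by ring
  obtain ⟨hA2, hA3⟩ := FormSum.form_sub_left hA (hc.form_aKer hZ' hZ)
  have eY : (fun k t => γ * Z k t - Z' k t) = Y := by
    funext k t; simp only [hZ'def]; ring
  rw [eY] at hA2 hA3
  rw [form_const_mul_left] at hA3
  have hB : form (bKer μ c) Y Z = form (aKer μ c) Y Z + form (rKer c) Y Z :=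
    (FormSum.form_add_kernel hA2 hR).2
  have p1 := hc.modeSq_le_re_form hZ
  have p2 := abs_le.1 (hc.abs_re_form_aKer_deriv_le hZ hZ' hZp)
  have p3 := abs_le.1 ((Complex.abs_re_le_norm _).trans hRb)
  have p4 := congrArg Complex.re hB
  rw [hA3, hsum] at p4
  simp only [Complex.add_re, Complex.sub_re, Complex.re_ofReal_mul] at p4
  have n1 := modeSq_nonneg y
  have n2 := modeSq_nonneg Z
  have p3' : -(2 * a * (modeSq y + modeSq Z)) ≤ (form (rKer c) Y Z).re := p3.1
  have hy0 : modeSq y = 0 := by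
    have q1 : γ * (δ / 2 * modeSq Z) ≤ γ * (form (aKer μ c) Z Z).re := by gcongr
    have q2 : (b + 2 * a) * modeSq Z ≤ γ * (δ / 2) * modeSq Z := by gcongr
    have : (γ - 2 * a) * modeSq y ≤ 0 := by nlinarith [p2.2]
    nlinarith
  have hk : ∫ t, ‖y k t‖ ^ 2 = 0 := by
    have := hyL.hasSum
    rw [hy0, hasSum_zero_iff_of_nonneg fun k => integral_nonneg fun t => by positivity] at this
    exact congrFun this k
  rw [integral_eq_zero_iff_of_nonneg (fun t => by positivity) (hyL.integrable_sq k)] at hk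
  have hk0 : y k =ᵐ[volume] fun _ => 0 := hk.mono fun t ht => by simpa using ht
  have hk1 : y k = fun _ => 0 :=
    (Continuous.ae_eq_iff_eq volume (hyp k).continuous continuous_const).1 hk0
  have := congrFun hk1 t
  simp only [hy, hE, mul_eq_zero] at this
  exact this.resolve_left (by exact_mod_cast (Real.exp_pos _).ne')

end ModeSol

/-! ### The projection theorem of Lions -/

/-- Lions' theorem: a coercive estimate `c ‖J w‖² ≤ Re ⟪J w, K w⟫` on the test space `Φ` gives a
solution `u` of `⟪u, K w⟫ = ⟪f, J w⟫`, in the closure of the range of `J`. -/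
theorem exists_of_coercive {Φ H : Type*} [AddCommGroup Φ] [Module ℂ Φ] [NormedAddCommGroup H]
    [InnerProductSpace ℂ H] [CompleteSpace H] (J K : Φ →ₗ[ℂ] H) {c : ℝ} (hc : 0 < c)
    (hJK : ∀ w, c * ‖J w‖ ^ 2 ≤ (inner ℂ (J w) (K w)).re) (f : H) :
    ∃ u ∈ (LinearMap.range J).topologicalClosure, ‖u‖ ≤ ‖f‖ / c ∧
      ∀ w, inner ℂ u (K w) = inner ℂ f (J w) := by
  set V := (LinearMap.range J).topologicalClosure with hV
  have : CompleteSpace V := (Submodule.isClosed_topologicalClosure _).completeSpace_coe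
  -- `K` is composed with the projection on `V`, so that the solution can be chosen in `V`
  set P : H →L[ℂ] H := V.starProjection with hP
  set K' : Φ →ₗ[ℂ] H := (P : H →ₗ[ℂ] H) ∘ₗ K with hK'
  have hJV : ∀ w, J w ∈ V := fun w => Submodule.le_topologicalClosure _ (LinearMap.mem_range_self J w)
  have hPJ : ∀ w, inner ℂ (J w) (K' w) = inner ℂ (J w) (K w) := fun w => by
    show inner ℂ (J w) (P (K w)) = _
    rw [hP, ← Submodule.inner_starProjection_left_eq_right,
      Submodule.starProjection_eq_self_iff.2 (hJV w)]
  have hle : ∀ w, ‖J w‖ ≤ ‖K' w‖ / c := fun w => by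
    have h1 := hJK w
    rw [← hPJ] at h1
    have h2 := (Complex.re_le_norm _).trans (norm_inner_le_norm (𝕜 := ℂ) (J w) (K' w))
    rw [le_div_iff₀ hc]
    by_contra! h
    have h0 : 0 < ‖J w‖ := by
      by_contra! h0
      have := norm_nonneg (K' w)
      nlinarith
    nlinarith
  have hker : LinearMap.ker K' ≤ LinearMap.ker ((innerSL ℂ f : H →ₗ[ℂ] ℂ) ∘ₗ J) := by
    intro w hw
    have : J w = 0 := by
      have := hle w
      rw [LinearMap.mem_ker.1 hw, norm_zero, zero_div] at this
      exact norm_le_zero_iff.1 this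
    simp [this]
  set ℓ : LinearMap.range K' →ₗ[ℂ] ℂ :=
    ((LinearMap.ker K').liftQ _ hker) ∘ₗ (LinearMap.quotKerEquivRange K').symm.toLinearMap with hℓ
  have hℓa : ∀ w, ℓ ⟨K' w, LinearMap.mem_range_self K' w⟩ = inner ℂ f (J w) := fun w => by
    have : (LinearMap.quotKerEquivRange K').symm ⟨K' w, LinearMap.mem_range_self K' w⟩ =
        Submodule.Quotient.mk w := by
      rw [LinearEquiv.symm_apply_eq]; rfl
    simp only [hℓ, LinearMap.comp_apply, LinearEquiv.coe_coe, this]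
    rw [Submodule.liftQ_apply]
    simp
  have hb : ∀ x, ‖ℓ x‖ ≤ ‖f‖ / c * ‖x‖ := by
    rintro ⟨_, w, rfl⟩
    rw [hℓa]
    calc _ ≤ ‖f‖ * ‖J w‖ := norm_inner_le_norm _ _
      _ ≤ ‖f‖ * (‖K' w‖ / c) := by gcongr; exact hle w
      _ = ‖f‖ / c * ‖K' w‖ := by ring
  obtain ⟨L, hL1, hL2⟩ := exists_extension_norm_eq _ (ℓ.mkContinuous _ hb)
  set u₀ := (InnerProductSpace.toDual ℂ H).symm L with hu₀
  refine ⟨P u₀, Submodule.starProjection_apply_mem V _, ?_, fun w => ?_⟩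
  · refine (V.norm_starProjection_apply_le u₀).trans ?_
    rw [hu₀, LinearIsometryEquiv.norm_map, hL2]
    exact LinearMap.mkContinuous_norm_le _ (by positivity) _
  · rw [hP, Submodule.inner_starProjection_left_eq_right, hu₀,
      InnerProductSpace.toDual_symm_apply]
    exact (hL1 ⟨K' w, LinearMap.mem_range_self K' w⟩).trans (hℓa w)

/-! ### The Hilbert space of families of functions of time -/

/-- `ℓ²(ℤ; L²(ℝ))` as a Hilbert space. -/
abbrev ModeSpace : Type := lp (fun _ : ℤ => Lp ℂ 2 (volume : Measure ℝ)) 2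

theorem norm_toLp_sq {f : ℝ → ℂ} (hf : MemLp f 2 volume) : ‖hf.toLp f‖ ^ 2 = ∫ t, ‖f t‖ ^ 2 := by
  have h1 := inner_self_eq_norm_sq_to_K (𝕜 := ℂ) (hf.toLp f)
  rw [L2.inner_def] at h1
  have h2 : ∫ t, inner ℂ ((hf.toLp f : ℝ → ℂ) t) ((hf.toLp f : ℝ → ℂ) t) = ((∫ t, ‖f t‖ ^ 2 : ℝ) : ℂ) := by
    rw [← integral_complex_ofReal]
    refine integral_congr_ae ?_
    filter_upwards [hf.coeFn_toLp] with t ht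
    rw [ht, inner_self_eq_norm_sq_to_K]
    norm_cast
  rw [h2] at h1
  apply Complex.ofReal_injective
  rw [h1, Complex.ofReal_pow]; rfl

namespace L2Modes

variable {p q : ℤ → ℝ → ℂ}

/-- The element of the Hilbert space `ModeSpace` given by a family of functions. -/
def toSpace (hp : L2Modes p) : ModeSpace :=
  ⟨fun k => (hp.memLp k).toLp _, (memℓp_gen_iff (by norm_num)).2 (by
    simp only [ENNReal.toReal_ofNat, Real.rpow_ofNat, norm_toLp_sq]
    exact hp.hasSum.summable)⟩

theorem toSpace_apply (hp : L2Modes p) (k : ℤ) :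
    (hp.toSpace : ∀ _ : ℤ, Lp ℂ 2 volume) k = (hp.memLp k).toLp _ := rfl

theorem toSpace_congr (hp : L2Modes p) (hq : L2Modes q) (h : ∀ k, p k =ᵐ[volume] q k) :
    hp.toSpace = hq.toSpace :=
  lp.ext (funext fun k => MemLp.toLp_congr (hp.memLp k) (hq.memLp k) (h k))

theorem norm_toSpace_sq (hp : L2Modes p) : ‖hp.toSpace‖ ^ 2 = modeSq p := by
  have := lp.hasSum_norm (by norm_num) hp.toSpace
  simp only [ENNReal.toReal_ofNat, Real.rpow_ofNat, toSpace_apply, norm_toLp_sq] at this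
  exact this.unique hp.hasSum

theorem inner_toSpace (hp : L2Modes p) (hq : L2Modes q) :
    inner ℂ hp.toSpace hq.toSpace = ∑' k, ∫ t, q k t * starRingEnd ℂ (p k t) := by
  rw [lp.inner_eq_tsum]
  refine tsum_congr fun k => ?_
  rw [toSpace_apply, toSpace_apply, L2.inner_def]
  refine integral_congr_ae ?_
  filter_upwards [(hp.memLp k).coeFn_toLp, (hq.memLp k).coeFn_toLp] with t h1 h2
  rw [h1, h2, RCLike.inner_apply]

theorem toSpace_add (hp : L2Modes p) (hq : L2Modes q) :
    (hp.add hq).toSpace = hp.toSpace + hq.toSpace :=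
  lp.ext (funext fun k => by
    rw [lp.coeFn_add, Pi.add_apply]; exact MemLp.toLp_add (hp.memLp k) (hq.memLp k))

theorem toSpace_const_mul (hp : L2Modes p) (c : ℂ) :
    (hp.const_mul c).toSpace = c • hp.toSpace :=
  lp.ext (funext fun k => by
    rw [lp.coeFn_smul, Pi.smul_apply]; exact MemLp.toLp_const_smul c (hp.memLp k))

end L2Modes

/-- The family of functions given by an element of `ModeSpace`. -/
def ofSpace (u : ModeSpace) (k : ℤ) : ℝ → ℂ := (u : ∀ _ : ℤ, Lp ℂ 2 volume) k

theorem ofSpace_l2Modes (u : ModeSpace) : L2Modes (ofSpace u) := by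
  have hm := fun k => Lp.memLp ((u : ∀ _ : ℤ, Lp ℂ 2 volume) k)
  have hs := (memℓp_gen_iff (by norm_num)).1 (lp.memℓp u)
  refine ⟨fun k => (hm k).1, ?_⟩
  have e : ∀ k, ∫⁻ t, ‖ofSpace u k t‖ₑ ^ 2 =
      ENNReal.ofReal (‖(u : ∀ _ : ℤ, Lp ℂ 2 volume) k‖ ^ 2) := fun k => by
    have h1 : (hm k).toLp _ = (u : ∀ _ : ℤ, Lp ℂ 2 volume) k := Lp.toLp_coeFn _ _
    rw [← h1, norm_toLp_sq, ofReal_integral_eq_lintegral_ofReal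
      ((hm k).integrable_norm_pow (by norm_num)) (Eventually.of_forall fun t => by positivity)]
    refine lintegral_congr fun t => ?_
    rw [ENNReal.ofReal_pow (norm_nonneg _), ofReal_norm]; rfl
  simp only [e]
  simpa using hs.tsum_ofReal_ne_top

theorem toSpace_ofSpace (u : ModeSpace) : (ofSpace_l2Modes u).toSpace = u :=
  lp.ext (funext fun k => Lp.toLp_coeFn _ ((ofSpace_l2Modes u).memLp k))

theorem ofSpace_toSpace {p : ℤ → ℝ → ℂ} (hp : L2Modes p) (k : ℤ) :
    ofSpace hp.toSpace k =ᵐ[volume] p k := (hp.memLp k).coeFn_toLp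

theorem form_congr {K : ℤ → ℤ → ℝ → ℂ} {p p' q : ℤ → ℝ → ℂ} (h : ∀ k, p k =ᵐ[volume] p' k) :
    form K p q = form K p' q :=
  tsum_congr fun kl => integral_congr_ae ((h kl.2).mono fun t ht => by simp only [ht])

theorem form_add_left {K : ℤ → ℤ → ℝ → ℂ} {p p' q : ℤ → ℝ → ℂ} (h : FormSum K p q)
    (h' : FormSum K p' q) : form K (fun k t => p k t + p' k t) q = form K p q + form K p' q := by
  unfold form
  rw [← h.summable.tsum_add h'.summable]
  refine tsum_congr fun kl => ?_
  rw [← integral_add (h.integrable kl) (h'.integrable kl)]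
  congr 1; funext t; ring

namespace ModeCoeffs

variable {μ δ a b : ℝ} {c d : ℤ → ℝ → ℂ}

theorem norm_form_bKer_le (h : ModeCoeffs μ δ a b c d) {p q : ℤ → ℝ → ℂ} (hp : L2Modes p)
    (hq : L2Modes q) :
    ‖form (bKer μ c) p q‖ ≤ (|μ| + (2 : ℕ) * a) * ((modeSq p + modeSq q) / 2) := by
  refine (FormSum.of_le (M := |μ| + (2 : ℕ) * a)
    (m := fun j t => (if j = 0 then ENNReal.ofReal |μ| else 0) + (2 : ℕ) * ‖(j : ℂ) ^ 2 * c j t‖ₑ)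
    (prod_meas h.bKer_meas hp.meas hq.meas) hp hq (fun j => ?_) ?_
    (by have := h.nonneg_a; positivity) fun k l => ?_).2
  · exact aemeasurable_const.add (((h.meas j).const_mul _).enorm.const_mul _)
  · filter_upwards [h.bound] with t ht
    exact sum_le (abs_nonneg _) h.nonneg_a 2 ht fun j => rfl
  · exact Eventually.of_forall fun t => enorm_form_le (bKer_enorm_le k l t)

/-- The continuous functional `p ↦ form (bKer μ c) p q`. -/
def formFunctional (h : ModeCoeffs μ δ a b c d) {q : ℤ → ℝ → ℂ} (hq : L2Modes q) :
    ModeSpace →L[ℂ] ℂ :=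
  LinearMap.mkContinuous
    { toFun := fun u => form (bKer μ c) (ofSpace u) q
      map_add' := fun u v => by
        rw [← form_add_left (h.form_bKer (ofSpace_l2Modes u) hq)
          (h.form_bKer (ofSpace_l2Modes v) hq)]
        refine form_congr fun k => ?_
        exact Lp.coeFn_add ((u : ∀ _ : ℤ, Lp ℂ 2 volume) k) _
      map_smul' := fun r u => by
        rw [RingHom.id_apply, smul_eq_mul, ← form_const_mul_left]
        refine form_congr fun k => ?_
        exact Lp.coeFn_smul r ((u : ∀ _ : ℤ, Lp ℂ 2 volume) k) }
    _ (LinearMap.bound_of_sphere_bound one_pos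
      ((|μ| + (2 : ℕ) * a) * ((1 + modeSq q) / 2)) _ fun u hu => by
        have h1 := h.norm_form_bKer_le (ofSpace_l2Modes u) hq
        rw [← (ofSpace_l2Modes u).norm_toSpace_sq, toSpace_ofSpace, mem_sphere_zero_iff_norm.1 hu,
          one_pow] at h1
        exact h1)

/-- The element `∑ₖ conj (bKer k l) q k` of `ModeSpace`, the adjoint operator applied to `q`; it is
obtained from the Riesz representation theorem. -/
def adjointSpace (h : ModeCoeffs μ δ a b c d) {q : ℤ → ℝ → ℂ} (hq : L2Modes q) : ModeSpace :=
  (InnerProductSpace.toDual ℂ ModeSpace).symm (h.formFunctional hq)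

theorem inner_adjointSpace (h : ModeCoeffs μ δ a b c d) {q : ℤ → ℝ → ℂ} (hq : L2Modes q)
    (u : ModeSpace) : inner ℂ (h.adjointSpace hq) u = form (bKer μ c) (ofSpace u) q :=
  InnerProductSpace.toDual_symm_apply

end ModeCoeffs

/-! ### Existence for the equations of the Fourier coefficients -/

theorem IsPrim.re_integral_mul_conj {F f : ℝ → ℂ} (h : IsPrim F f) (hF : MemLp F 2 volume)
    (hf : MemLp f 2 volume) : (∫ t, f t * starRingEnd ℂ (F t)).re = 0 := by
  have cF : MemLp (fun t => starRingEnd ℂ (F t)) 2 volume :=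
    hF.of_le (Complex.continuous_conj.comp_aestronglyMeasurable hF.1) (by simp)
  have cf : MemLp (fun t => starRingEnd ℂ (f t)) 2 volume :=
    hf.of_le (Complex.continuous_conj.comp_aestronglyMeasurable hf.1) (by simp)
  have i1 : Integrable (fun t => f t * starRingEnd ℂ (F t)) volume := hf.integrable_mul cF
  have i2 : Integrable (fun t => F t * starRingEnd ℂ (f t)) volume := hF.integrable_mul cf
  have h0 := (h.mul h.conj).integral_eq_zero (hF.integrable_mul cF) (i1.add i2)
  rw [integral_add i1 i2] at h0
  have c1 : ∫ t, F t * starRingEnd ℂ (f t) = starRingEnd ℂ (∫ t, f t * starRingEnd ℂ (F t)) := by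
    rw [← integral_conj]; congr 1; funext t; simp [mul_comm]
  rw [c1, Complex.add_conj] at h0
  have := congrArg Complex.re h0
  simpa using this

/-- The test families for the existence proof: `w` is the test function, with time derivative
`w'`, and `y` solves `y' + γ y = w`. Thus `w` plays the role of the weighted time derivative of a
function whose weighted Fourier coefficients are `y`. -/
structure IsTestFamily (γ : ℝ) (w w' y : ℤ → ℝ → ℂ) : Prop where
  prim_w : ∀ k, IsPrim (w k) (w' k)
  prim_y : ∀ k, IsPrim (y k) (fun t => w k t - γ * y k t)
  zero : ∀ t, y 0 t = 0
  l2_w : L2Modes w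
  l2_w' : L2Modes w'
  l2_kw : L2Modes fun k t => k * w k t
  l2_ky : L2Modes fun k t => k * y k t

/-- The space of test families. -/
def testFamilies (γ : ℝ) :
    Submodule ℂ ((ℤ → ℝ → ℂ) × (ℤ → ℝ → ℂ) × (ℤ → ℝ → ℂ)) where
  carrier := {w | IsTestFamily γ w.1 w.2.1 w.2.2}
  zero_mem' := by
    have hz : IsPrim 0 0 := .of_hasDerivAt (fun x => hasDerivAt_const x 0) continuous_const
    have hl : L2Modes 0 := ⟨fun k => aestronglyMeasurable_zero, by simp⟩
    have hl' : L2Modes fun k t => (k : ℂ) * (0 : ℤ → ℝ → ℂ) k t := by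
      simpa using! hl
    refine ⟨fun k => hz, fun k => ?_, fun t => rfl, hl, hl, hl', hl'⟩
    simpa using! hz
  add_mem' := by
    intro v w hv hw
    refine ⟨fun k => (hv.prim_w k).add (hw.prim_w k), fun k => ?_, fun t => ?_,
      hv.l2_w.add hw.l2_w, hv.l2_w'.add hw.l2_w', ?_, ?_⟩
    · refine (congrArg (IsPrim _) (funext fun t => ?_)).mp ((hv.prim_y k).add (hw.prim_y k))
      simp; ring
    · simp [hv.zero, hw.zero]
    · simpa [mul_add] using hv.l2_kw.add hw.l2_kw
    · simpa [mul_add] using hv.l2_ky.add hw.l2_ky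
  smul_mem' := by
    intro c w hw
    refine ⟨fun k => (hw.prim_w k).const_mul c, fun k => ?_, fun t => ?_,
      hw.l2_w.const_mul c, hw.l2_w'.const_mul c, ?_, ?_⟩
    · refine (congrArg (IsPrim _) (funext fun t => ?_)).mp ((hw.prim_y k).const_mul c)
      simp; ring
    · simp [hw.zero]
    · simpa [mul_left_comm] using hw.l2_kw.const_mul c
    · simpa [mul_left_comm] using hw.l2_ky.const_mul c

/-- The Hilbert space in which weak solutions are sought; the components stand for the weighted
time derivative and the weighted space derivative. -/
abbrev PairSpace : Type := WithLp 2 (ModeSpace × ModeSpace)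

/-- The map `w ↦ (w, k y)`, the weighted derivatives of a test family. -/
def testJ (γ : ℝ) : testFamilies γ →ₗ[ℂ] PairSpace where
  toFun w := WithLp.toLp 2 (w.2.l2_w.toSpace, w.2.l2_ky.toSpace)
  map_add' v w := by
    rw [← WithLp.toLp_add, Prod.mk_add_mk, ← L2Modes.toSpace_add, ← L2Modes.toSpace_add]
    refine congrArg (WithLp.toLp 2) (Prod.ext rfl ?_)
    exact L2Modes.toSpace_congr (v + w).2.l2_ky (v.2.l2_ky.add w.2.l2_ky) fun k =>
      Eventually.of_forall fun t => mul_add _ _ _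
  map_smul' r w := by
    rw [RingHom.id_apply, ← WithLp.toLp_smul, Prod.smul_mk, ← L2Modes.toSpace_const_mul,
      ← L2Modes.toSpace_const_mul]
    refine congrArg (WithLp.toLp 2) (Prod.ext rfl ?_)
    exact L2Modes.toSpace_congr (r • w).2.l2_ky (w.2.l2_ky.const_mul r) fun k =>
      Eventually.of_forall fun t => mul_left_comm _ _ _

theorem IsTestFamily.l2_adj {γ : ℝ} {w w' y : ℤ → ℝ → ℂ} (h : IsTestFamily γ w w' y) :
    L2Modes fun k t => γ * w k t - w' k t := (h.l2_w.const_mul γ).sub h.l2_w'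

section

variable {μ δ a b : ℝ} {c d : ℤ → ℝ → ℂ}

/-- The formal adjoint of the weighted operator: `(γ w - w', ∑ₖ conj (bKer k l) k w k)`. The
equation `⟪(P, Q), testK w⟫ = ⟪(G, 0), testJ w⟫` is the weak form of
`P' + γ P + k ∑ₗ bKer k l Q l = G`. -/
def testK (hc : ModeCoeffs μ δ a b c d) (γ : ℝ) : testFamilies γ →ₗ[ℂ] PairSpace where
  toFun w := WithLp.toLp 2 (w.2.l2_adj.toSpace, hc.adjointSpace w.2.l2_kw)
  map_add' v w := by
    rw [← WithLp.toLp_add, Prod.mk_add_mk, ← L2Modes.toSpace_add]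
    refine congrArg (WithLp.toLp 2) (Prod.ext ?_ ?_)
    · refine L2Modes.toSpace_congr (v + w).2.l2_adj (v.2.l2_adj.add w.2.l2_adj) fun k =>
        Eventually.of_forall fun t => ?_
      simp; ring
    · refine ext_inner_right ℂ fun u => ?_
      rw [inner_add_left, hc.inner_adjointSpace, hc.inner_adjointSpace, hc.inner_adjointSpace,
        ← (FormSum.form_add_right (hc.form_bKer (ofSpace_l2Modes u) v.2.l2_kw)
          (hc.form_bKer (ofSpace_l2Modes u) w.2.l2_kw)).2]
      congr 1; funext k t
      exact mul_add _ _ _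
  map_smul' r w := by
    rw [RingHom.id_apply, ← WithLp.toLp_smul, Prod.smul_mk, ← L2Modes.toSpace_const_mul]
    refine congrArg (WithLp.toLp 2) (Prod.ext ?_ ?_)
    · refine L2Modes.toSpace_congr (r • w).2.l2_adj (w.2.l2_adj.const_mul r) fun k =>
        Eventually.of_forall fun t => ?_
      simp; ring
    · refine ext_inner_right ℂ fun u => ?_
      rw [inner_smul_left, hc.inner_adjointSpace, hc.inner_adjointSpace]
      unfold form
      rw [← tsum_mul_left]
      refine tsum_congr fun kl => ?_
      rw [← integral_const_mul]
      congr 1; funext t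
      simp; ring

/-- The energy estimate for the weighted operator. With `Z = k y` one has `k w = Z' + γ Z`: the
principal part contributes `γ δ / 2 ‖Z‖²`, up to the time derivative of the coefficient, and the
other errors are absorbed for large `γ`. -/
theorem coercive (hc : ModeCoeffs μ δ a b c d) {γ : ℝ} (hγ : 0 < γ) (hγa : 4 * a ≤ γ)
    (hγb : b + 2 * a ≤ γ * (δ / 4)) (w : testFamilies γ) :
    γ * min (1 / 2) (δ / 4) * ‖testJ γ w‖ ^ 2 ≤ (inner ℂ (testJ γ w) (testK hc γ w)).re := by
  obtain ⟨⟨w, w', y⟩, hw⟩ := w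
  have hw : IsTestFamily γ w w' y := hw
  set W : ℤ → ℝ → ℂ := fun k t => k * w k t with hW
  set Z : ℤ → ℝ → ℂ := fun k t => k * y k t with hZ
  set Z' : ℤ → ℝ → ℂ := fun k t => W k t - γ * Z k t with hZ'
  have lW : L2Modes W := hw.l2_kw
  have lZ : L2Modes Z := hw.l2_ky
  have lZ' : L2Modes Z' := lW.sub (lZ.const_mul γ)
  have hJ : ‖testJ γ ⟨⟨w, w', y⟩, hw⟩‖ ^ 2 = modeSq w + modeSq Z := by
    rw [WithLp.prod_norm_sq_eq_of_L2, ← hw.l2_w.norm_toSpace_sq, ← hw.l2_ky.norm_toSpace_sq]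
    rfl
  have hin : inner ℂ (testJ γ ⟨⟨w, w', y⟩, hw⟩) (testK hc γ ⟨⟨w, w', y⟩, hw⟩) =
      inner ℂ hw.l2_w.toSpace hw.l2_adj.toSpace +
        inner ℂ hw.l2_ky.toSpace (hc.adjointSpace hw.l2_kw) := WithLp.prod_inner_apply _ _
  have h1 : (inner ℂ hw.l2_w.toSpace hw.l2_adj.toSpace).re = γ * modeSq w := by
    have e : hw.l2_adj.toSpace = (γ : ℂ) • hw.l2_w.toSpace - hw.l2_w'.toSpace := by
      rw [← L2Modes.toSpace_const_mul, eq_sub_iff_add_eq, ← L2Modes.toSpace_add]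
      exact L2Modes.toSpace_congr (hw.l2_adj.add hw.l2_w') (hw.l2_w.const_mul γ) fun k =>
        Eventually.of_forall fun t => by simp
    have e2 : (inner ℂ hw.l2_w.toSpace hw.l2_w'.toSpace).re = 0 := by
      rw [L2Modes.inner_toSpace, Complex.re_tsum (hw.l2_w'.sumInt hw.l2_w).summable]
      exact (tsum_congr fun k =>
        (hw.prim_w k).re_integral_mul_conj (hw.l2_w.memLp k) (hw.l2_w'.memLp k)).trans tsum_zero
    rw [e, inner_sub_right, inner_smul_right, inner_self_eq_norm_sq_to_K, Complex.sub_re, e2,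
      sub_zero, Complex.re_ofReal_mul, ← hw.l2_w.norm_toSpace_sq]
    norm_cast
  have h2 : (inner ℂ hw.l2_ky.toSpace (hc.adjointSpace hw.l2_kw)).re =
      (form (bKer μ c) Z W).re := by
    rw [← inner_conj_symm, Complex.conj_re, hc.inner_adjointSpace,
      form_congr (ofSpace_toSpace hw.l2_ky)]
  obtain ⟨hR, hRb⟩ := hc.form_rKer_right lZ hw.l2_w
  have hZp : ∀ k, IsPrim (Z k) (Z' k) := fun k => by
    refine (congrArg (IsPrim (Z k)) (funext fun t => ?_)).mp ((hw.prim_y k).const_mul (k : ℂ))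
    simp only [hZ', hZ, hW]; ring
  have hA1 := hc.form_aKer lZ lZ'
  have hA2 : FormSum (aKer μ c) Z (fun k t => γ * Z k t) := hc.form_aKer lZ (lZ.const_mul γ)
  obtain ⟨hA, hAe⟩ := FormSum.form_add_right hA1 hA2
  have eW : (fun k t => Z' k t + γ * Z k t) = W := by
    funext k t; simp only [hZ']; ring
  rw [eW] at hA hAe
  have hB : form (bKer μ c) Z W = form (aKer μ c) Z W + form (rKer c) Z W :=
    (FormSum.form_add_kernel hA hR).2
  have hs : (form (aKer μ c) Z Z').re = (form (aKer μ c) Z' Z).re := by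
    rw [← form_conj hc.aKer_herm Z' Z, Complex.conj_re]
  rw [hin, hJ, Complex.add_re, h1, h2, hB, hAe, form_const_mul_right]
  simp only [Complex.add_re, Complex.re_ofReal_mul]
  have p1 := hc.modeSq_le_re_form lZ
  have p2 := (abs_le.1 (hc.abs_re_form_aKer_deriv_le lZ lZ' hZp)).1
  rw [← hs] at p2
  have p3 : -(2 * a * (modeSq Z + modeSq w)) ≤ (form (rKer c) Z W).re :=
    (abs_le.1 ((Complex.abs_re_le_norm _).trans hRb)).1
  have n1 := modeSq_nonneg w
  have n2 := modeSq_nonneg Z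
  have q1 : γ * (δ / 2 * modeSq Z) ≤ γ * (form (aKer μ c) Z Z).re := by gcongr
  have q2 : (b + 2 * a) * modeSq Z ≤ γ * (δ / 4) * modeSq Z := by gcongr
  have q3 : 4 * a * modeSq w ≤ γ * modeSq w := by gcongr
  have m1 : γ * min (1 / 2) (δ / 4) * modeSq w ≤ γ * (1 / 2) * modeSq w := by
    gcongr; exact min_le_left _ _
  have m2 : γ * min (1 / 2) (δ / 4) * modeSq Z ≤ γ * (δ / 4) * modeSq Z := by
    gcongr; exact min_le_right _ _
  linarith

end

theorem IsPrim.comp_neg {F f : ℝ → ℂ} (h : IsPrim F f) :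
    IsPrim (fun t => F (-t)) (fun t => -f (-t)) := by
  refine ⟨?_, fun a b => ?_⟩
  · have : LocallyIntegrable (fun t => f (-t)) volume := by
      rw [locallyIntegrable_iff]
      intro K hK
      have := (h.locallyIntegrable.integrableOn_isCompact hK.neg)
      have e := (Measure.measurePreserving_neg (volume : Measure ℝ)).integrableOn_comp_preimage
        (f := f) (s := -K) (MeasurableEquiv.neg ℝ).measurableEmbedding
      have e2 : (Neg.neg ⁻¹' (-K) : Set ℝ) = K := by ext x; simp
      rw [e2] at e
      exact e.2 this
    exact this.neg
  · rw [h.sub_eq, intervalIntegral.integral_neg, intervalIntegral.integral_comp_neg,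
      ← intervalIntegral.integral_symm]

/-- The solution of the forward equation, by reflection in time. -/
theorem exists_forward {γ : ℝ} (hγ : 0 < γ) {y : ℝ → ℂ} (hy : MemLp y 2 volume) :
    ∃ z : ℝ → ℂ, IsPrim z (fun t => y t - γ * z t) ∧ MemLp z 2 volume := by
  have hneg := Measure.measurePreserving_neg (volume : Measure ℝ)
  obtain ⟨z, h1, h2, h3⟩ := exists_backward hγ (hy.comp_measurePreserving hneg)
  refine ⟨fun t => z (-t), ?_, ?_⟩
  · refine (congrArg (IsPrim _) (funext fun t => ?_)).mp h1.comp_neg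
    simp
  · have hz : MemLp z 2 volume := by
      refine memLp_two_iff.2 ⟨h2, ne_top_of_le_ne_top (ENNReal.mul_ne_top (by simp)
        (memLp_two_iff.1 (hy.comp_measurePreserving hneg)).2) h3⟩
    exact hz.comp_measurePreserving hneg

theorem mul_single (k : ℤ) (f : ℝ → ℂ) :
    (fun (j : ℤ) (t : ℝ) => (j : ℂ) * (Pi.single k f : ℤ → ℝ → ℂ) j t) =
      (Pi.single k (fun t => (k : ℂ) * f t) : ℤ → ℝ → ℂ) := by
  funext j t
  rcases eq_or_ne j k with rfl | h
  · simp
  · simp [Pi.single_eq_of_ne h]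

theorem IsTest1.memLp {η : ℝ → ℝ} (h : IsTest1 η) : MemLp (fun t => (η t : ℂ)) 2 volume :=
  h.ofReal_continuous.memLp_of_hasCompactSupport h.ofReal_compact

/-- A test function concentrated at a nonzero frequency is part of a test family. -/
theorem exists_isTestFamily_single {γ : ℝ} (hγ : 0 < γ) {k : ℤ} (hk : k ≠ 0) {η : ℝ → ℝ}
    (hη : IsTest1 η) : ∃ y : ℤ → ℝ → ℂ, IsTestFamily γ (Pi.single k fun t => (η t : ℂ))
      (Pi.single k fun t => ((deriv η t : ℝ) : ℂ)) y := by
  obtain ⟨z, hz, hz2⟩ := exists_forward hγ hη.memLp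
  have h0 : IsPrim 0 0 := .of_hasDerivAt (fun x => hasDerivAt_const x 0) continuous_const
  refine ⟨Pi.single k z, fun j => ?_, fun j => ?_, fun t => ?_, .single hη.memLp k,
    .single hη.deriv.memLp k, ?_, ?_⟩
  · rcases eq_or_ne j k with rfl | h
    · simpa using hη.isPrim
    · simpa [Pi.single_eq_of_ne h] using! h0
  · rcases eq_or_ne j k with rfl | h
    · simpa using hz
    · simpa [Pi.single_eq_of_ne h] using! h0
  · simp [Pi.single_eq_of_ne hk.symm]
  · rw [mul_single]; exact .single (hη.memLp.const_mul _) k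
  · rw [mul_single]; exact .single (hz2.const_mul _) k

namespace L2Modes

variable {p : ℤ → ℝ → ℂ}

theorem inner_single_right (hp : L2Modes p) {k : ℤ} {f : ℝ → ℂ}
    (hf : L2Modes (Pi.single k f : ℤ → ℝ → ℂ)) :
    inner ℂ hp.toSpace hf.toSpace = ∫ t, f t * starRingEnd ℂ (p k t) := by
  rw [inner_toSpace, tsum_eq_single k fun j hj => by simp [Pi.single_eq_of_ne hj]]
  simp

theorem inner_single_left (hp : L2Modes p) {k : ℤ} {f : ℝ → ℂ}
    (hf : L2Modes (Pi.single k f : ℤ → ℝ → ℂ)) :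
    inner ℂ hf.toSpace hp.toSpace = ∫ t, p k t * starRingEnd ℂ (f t) := by
  rw [inner_toSpace, tsum_eq_single k fun j hj => by simp [Pi.single_eq_of_ne hj]]
  simp

theorem modeSq_mono {q : ℤ → ℝ → ℂ} (hq : L2Modes q)
    (h : ∀ k, ∀ᵐ t, ‖p k t‖ₑ ≤ ‖q k t‖ₑ) : modeSq p ≤ modeSq q :=
  ENNReal.toReal_mono hq.fin (ENNReal.tsum_le_tsum fun k =>
    lintegral_mono_ae ((h k).mono fun t ht => by gcongr))

end L2Modes

section

variable {μ δ a b : ℝ} {c d : ℤ → ℝ → ℂ}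

/-- The second component of a limit of test families has no mean. -/
theorem ofSpace_snd_zero {γ : ℝ} {u : PairSpace}
    (hu : u ∈ (LinearMap.range (testJ γ)).topologicalClosure) :
    ofSpace u.snd 0 =ᵐ[volume] 0 := by
  set Q := ofSpace u.snd with hQ
  have lQ : L2Modes Q := ofSpace_l2Modes _
  have lS := L2Modes.single (lQ.memLp 0) 0
  set χ : PairSpace := WithLp.toLp 2 (0, lS.toSpace)
  have hle : (LinearMap.range (testJ γ)).topologicalClosure ≤ (Submodule.span ℂ {χ})ᗮ := by
    refine Submodule.topologicalClosure_minimal _ ?_ (Submodule.isClosed_orthogonal _)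
    rintro _ ⟨w, rfl⟩
    rw [Submodule.mem_orthogonal_singleton_iff_inner_right]
    refine (WithLp.prod_inner_apply _ _).trans ?_
    show inner ℂ 0 _ + inner ℂ lS.toSpace w.2.l2_ky.toSpace = 0
    rw [inner_zero_left, L2Modes.inner_single_left]
    simp
  have h := Submodule.mem_orthogonal_singleton_iff_inner_right.1 (hle hu)
  have h2 : inner ℂ χ u = inner ℂ 0 u.fst + inner ℂ lS.toSpace u.snd := WithLp.prod_inner_apply _ _
  rw [h2, inner_zero_left, zero_add, ← toSpace_ofSpace u.snd, L2Modes.inner_single_left] at h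
  have h3 : ∫ t, ‖Q 0 t‖ ^ 2 = 0 := by
    apply Complex.ofReal_injective
    rw [← integral_complex_ofReal, Complex.ofReal_zero, ← h]
    congr 1; funext t
    rw [Complex.mul_conj, Complex.normSq_eq_norm_sq]
  rw [integral_eq_zero_iff_of_nonneg (fun t => by positivity) (lQ.integrable_sq 0)] at h3
  exact h3.mono fun t ht => by simpa using ht

/-- The two components of a limit of test families are the derivatives of one function. -/
theorem isWeakDeriv_snd {γ : ℝ} {u : PairSpace}
    (hu : u ∈ (LinearMap.range (testJ γ)).topologicalClosure) (k : ℤ) :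
    IsWeakDeriv (ofSpace u.snd k) (fun t => k * ofSpace u.fst k t - γ * ofSpace u.snd k t) := by
  intro η hη
  set P := ofSpace u.fst with hP
  set Q := ofSpace u.snd with hQ
  have lP : L2Modes P := ofSpace_l2Modes _
  have lQ : L2Modes Q := ofSpace_l2Modes _
  have m1 := hη.memLp
  have m2 := hη.deriv.memLp
  have lS := L2Modes.single (m1.const_mul (k : ℂ)) k
  have m3 := m2.sub (m1.const_mul (γ : ℂ))
  have lT := L2Modes.single m3 k
  have rl : ∀ x : ℝ, starRingEnd ℂ (x : ℂ) = x := Complex.conj_ofReal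
  set χ : PairSpace := WithLp.toLp 2 (lS.toSpace, lT.toSpace)
  have hle : (LinearMap.range (testJ γ)).topologicalClosure ≤ (Submodule.span ℂ {χ})ᗮ := by
    refine Submodule.topologicalClosure_minimal _ ?_ (Submodule.isClosed_orthogonal _)
    rintro _ ⟨w, rfl⟩
    rw [Submodule.mem_orthogonal_singleton_iff_inner_right]
    refine (WithLp.prod_inner_apply _ _).trans ?_
    show inner ℂ lS.toSpace w.2.l2_w.toSpace + inner ℂ lT.toSpace w.2.l2_ky.toSpace = 0
    rw [L2Modes.inner_single_left, L2Modes.inner_single_left]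
    have i1 : Integrable (fun t => w.1.1 k t * starRingEnd ℂ ((k : ℂ) * (η t : ℂ))) volume := by
      simpa using! (w.2.l2_w.memLp k).integrable_mul (m1.const_mul (k : ℂ))
    have i2 : Integrable (fun t => (k : ℂ) * w.1.2.2 k t *
        starRingEnd ℂ (((deriv η t : ℝ) : ℂ) - γ * (η t : ℂ))) volume := by
      simpa using! (w.2.l2_ky.memLp k).integrable_mul m3
    refine (integral_add i1 i2).symm.trans ?_
    have hp := ((w.2.prim_y k).const_mul (k : ℂ)).mul hη.isPrim
    refine (congrArg (integral volume) (funext fun t => ?_)).trans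
      (hp.integral_eq_zero ?_ ((i1.add i2).congr (Eventually.of_forall fun t => ?_)))
    · simp only [map_mul, map_sub, map_intCast, rl]; ring
    · exact (w.2.l2_ky.memLp k).integrable_mul m1
    · simp only [Pi.add_apply, map_mul, map_sub, map_intCast, rl]; ring
  have h := Submodule.mem_orthogonal_singleton_iff_inner_right.1 (hle hu)
  have h2 : inner ℂ χ u = inner ℂ lS.toSpace u.fst + inner ℂ lT.toSpace u.snd :=
    WithLp.prod_inner_apply _ _
  rw [h2, ← toSpace_ofSpace u.fst, ← toSpace_ofSpace u.snd, L2Modes.inner_single_left,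
    L2Modes.inner_single_left] at h
  have i1 : Integrable (fun t => P k t * (η t : ℂ)) volume := (lP.memLp k).integrable_mul m1
  have i2 : Integrable (fun t => Q k t * (η t : ℂ)) volume := (lQ.memLp k).integrable_mul m1
  have i3 : Integrable (fun t => Q k t * ((deriv η t : ℝ) : ℂ)) volume :=
    (lQ.memLp k).integrable_mul m2
  have e1 : ∫ t, ofSpace u.fst k t * starRingEnd ℂ ((k : ℂ) * (η t : ℂ)) =
      k * ∫ t, P k t * (η t : ℂ) := by
    rw [← integral_const_mul]; congr 1; funext t; simp; ring
  have e2 : ∫ t, ofSpace u.snd k t * starRingEnd ℂ (((fun t => ((deriv η t : ℝ) : ℂ)) -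
      fun t => (γ : ℂ) * (η t : ℂ)) t) =
      (∫ t, Q k t * ((deriv η t : ℝ) : ℂ)) - γ * ∫ t, Q k t * (η t : ℂ) := by
    rw [← integral_const_mul, ← integral_sub i3 (i2.const_mul _)]
    congr 1; funext t; simp; ring
  have e3 : ∫ t, (k * P k t - γ * Q k t) * (η t : ℂ) =
      (k * ∫ t, P k t * (η t : ℂ)) - γ * ∫ t, Q k t * (η t : ℂ) := by
    rw [← integral_const_mul, ← integral_const_mul,
      ← integral_sub (i1.const_mul _) (i2.const_mul _)]
    congr 1; funext t; ring
  rw [e1, e2] at h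
  rw [e3]
  linear_combination h

theorem ModeCoeffs.locallyIntegrable_row (hc : ModeCoeffs μ δ a b c d) {Q : ℤ → ℝ → ℂ}
    (hQ : L2Modes Q) (k : ℤ) :
    LocallyIntegrable (fun t => ∑' l : ℤ, bKer μ c k l t * Q l t) volume := by
  rw [locallyIntegrable_iff]
  intro K hK
  have hm : MemLp (K.indicator fun _ : ℝ => (1 : ℂ)) 2 volume :=
    memLp_indicator_const 2 hK.measurableSet 1 (Or.inr hK.measure_lt_top.ne)
  have := (hc.sumInt_row hQ hm k).integrable_tsum
  rw [← integrable_indicator_iff hK.measurableSet]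
  refine this.congr (Eventually.of_forall fun t => ?_)
  simp only [tsum_mul_right, indicator]
  split_ifs <;> simp

/-- The equation satisfied by a weak solution in the Hilbert space. -/
theorem isWeakDeriv_fst (hc : ModeCoeffs μ δ a b c d) {γ : ℝ} (hγ : 0 < γ) {u : PairSpace}
    {G : ℤ → ℝ → ℂ} (hG : L2Modes G)
    (hu : ∀ w, inner ℂ u (testK hc γ w) =
      inner ℂ (WithLp.toLp 2 (hG.toSpace, (0 : ModeSpace)) : PairSpace) (testJ γ w))
    {k : ℤ} (hk : k ≠ 0) :
    IsWeakDeriv (ofSpace u.fst k) (fun t => G k t - γ * ofSpace u.fst k t -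
      k * ∑' l : ℤ, bKer μ c k l t * ofSpace u.snd l t) := by
  intro η hη
  set P := ofSpace u.fst with hP
  set Q := ofSpace u.snd with hQ
  have lP : L2Modes P := ofSpace_l2Modes _
  have lQ : L2Modes Q := ofSpace_l2Modes _
  obtain ⟨y, hy⟩ := exists_isTestFamily_single hγ hk hη
  have h := hu ⟨⟨_, _, y⟩, hy⟩
  have m1 := hη.memLp
  have m2 := hη.deriv.memLp
  have e1 : inner ℂ u (testK hc γ ⟨⟨_, _, y⟩, hy⟩) =
      inner ℂ u.fst hy.l2_adj.toSpace + inner ℂ u.snd (hc.adjointSpace hy.l2_kw) :=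
    WithLp.prod_inner_apply _ _
  have e2 : inner ℂ (WithLp.toLp 2 (hG.toSpace, (0 : ModeSpace)) : PairSpace)
      (testJ γ ⟨⟨_, _, y⟩, hy⟩) = inner ℂ hG.toSpace hy.l2_w.toSpace + inner ℂ 0 hy.l2_ky.toSpace :=
    WithLp.prod_inner_apply _ _
  have m3 := (m1.const_mul (γ : ℂ)).sub m2
  have e3 : hy.l2_adj.toSpace = (L2Modes.single m3 k).toSpace :=
    L2Modes.toSpace_congr hy.l2_adj (L2Modes.single m3 k) fun j => Eventually.of_forall fun t => by
      rcases eq_or_ne j k with rfl | h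
      · simp
      · simp [Pi.single_eq_of_ne h]
  rw [e1, e2, inner_zero_left, add_zero, e3, ← toSpace_ofSpace u.fst,
    L2Modes.inner_single_right, L2Modes.inner_single_right, ← inner_conj_symm u.snd,
    hc.inner_adjointSpace, mul_single] at h
  have hF := hc.form_bKer lQ (L2Modes.single (m1.const_mul (k : ℂ)) k)
  have hrow := hc.sumInt_row lQ m1 k
  set W : ℝ → ℂ := fun t => ∑' l : ℤ, bKer μ c k l t * Q l t with hW
  have e4 : form (bKer μ c) Q (Pi.single k fun t => (k : ℂ) * (η t : ℂ)) =
      k * ∫ t, W t * (η t : ℂ) := by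
    refine hF.tsum_prod.trans ?_
    rw [tsum_eq_single k fun j hj => by simp [Pi.single_eq_of_ne hj], ← integral_const_mul]
    congr 1; funext t
    rw [hW, ← tsum_mul_right, ← tsum_mul_left]
    refine tsum_congr fun l => ?_
    simp; ring
  have iW : Integrable (fun t => W t * (η t : ℂ)) volume := by
    refine hrow.integrable_tsum.congr (Eventually.of_forall fun t => ?_)
    simp only [Complex.conj_ofReal, tsum_mul_right, hW]
  have i1 : Integrable (fun t => P k t * (η t : ℂ)) volume := (lP.memLp k).integrable_mul m1
  have i2 : Integrable (fun t => G k t * (η t : ℂ)) volume := (hG.memLp k).integrable_mul m1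
  have i3 : Integrable (fun t => P k t * ((deriv η t : ℝ) : ℂ)) volume :=
    (lP.memLp k).integrable_mul m2
  rw [e4] at h
  have h' := congrArg (starRingEnd ℂ) h
  rw [map_add, Complex.conj_conj, ← integral_conj, ← integral_conj] at h'
  have e5 : ∫ t, starRingEnd ℂ (((fun t => (γ : ℂ) * (η t : ℂ)) -
      fun t => ((deriv η t : ℝ) : ℂ)) t * starRingEnd ℂ (ofSpace u.fst k t)) =
      (γ * ∫ t, P k t * (η t : ℂ)) - ∫ t, P k t * ((deriv η t : ℝ) : ℂ) := by
    rw [← integral_const_mul, ← integral_sub (i1.const_mul _) i3]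
    congr 1; funext t; simp [hP]; ring
  have e6 : ∫ t, starRingEnd ℂ ((η t : ℂ) * starRingEnd ℂ (G k t)) = ∫ t, G k t * (η t : ℂ) := by
    congr 1; funext t; simp; ring
  rw [e5, e6] at h'
  have e7 : ∫ t, (G k t - γ * P k t - k * W t) * (η t : ℂ) =
      (∫ t, G k t * (η t : ℂ)) - (γ * ∫ t, P k t * (η t : ℂ)) - k * ∫ t, W t * (η t : ℂ) := by
    have i4 : Integrable (fun t => G k t * (η t : ℂ) - γ * (P k t * (η t : ℂ))) volume :=
      i2.sub (i1.const_mul _)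
    rw [← integral_const_mul, ← integral_const_mul, ← integral_sub i2 (i1.const_mul _),
      ← integral_sub i4 (iW.const_mul _)]
    congr 1; funext t; ring
  rw [e7]
  linear_combination -h'

/-- Existence of a solution, with the energy estimate. -/
theorem exists_modeSol (hc : ModeCoeffs μ δ a b c d) {γ : ℝ} (hγ : 0 < γ) (hδ : 0 < δ)
    (hγa : 4 * a ≤ γ) (hγb : b + 2 * a ≤ γ * (δ / 4)) {g : ℤ → ℝ → ℂ}
    (hg : L2Modes fun k t => (Real.exp (-γ * t) : ℂ) * g k t) (hg0 : g 0 =ᵐ[volume] 0) :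
    ∃ p v, ModeSol μ γ c g p v ∧
      modeSq (fun k t => (Real.exp (-γ * t) : ℂ) * v k t) +
        modeSq (fun k t => (Real.exp (-γ * t) : ℂ) * (k * p k t)) ≤
      modeSq (fun k t => (Real.exp (-γ * t) : ℂ) * g k t) / (γ * min (1 / 2) (δ / 4)) ^ 2 := by
  set cδ := min (1 / 2) (δ / 4) with hcδ
  have hcδ0 : 0 < cδ := lt_min (by norm_num) (by linarith)
  obtain ⟨u, hu, hub, hue⟩ := exists_of_coercive (testJ γ) (testK hc γ) (mul_pos hγ hcδ0)
    (coercive hc hγ hγa hγb) (WithLp.toLp 2 (hg.toSpace, (0 : ModeSpace)) : PairSpace)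
  set G : ℤ → ℝ → ℂ := fun k t => (Real.exp (-γ * t) : ℂ) * g k t with hG
  set P := ofSpace u.fst with hP
  set Q := ofSpace u.snd with hQ
  have lP : L2Modes P := ofSpace_l2Modes _
  have lQ : L2Modes Q := ofSpace_l2Modes _
  have hQ0 : Q 0 =ᵐ[volume] 0 := ofSpace_snd_zero hu
  have li : ∀ {f : ℝ → ℂ}, MemLp f 2 volume → LocallyIntegrable f volume := fun hf =>
    hf.locallyIntegrable (by norm_num)
  have lm : ∀ (r : ℂ) {f : ℝ → ℂ}, LocallyIntegrable f volume →
      LocallyIntegrable (fun t => r * f t) volume := fun r _ hf => hf.smul r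
  choose F hF hFQ using fun k => (isWeakDeriv_snd hu k).exists_isPrim (li (lQ.memLp k))
    ((lm k (li (lP.memLp k))).sub (lm γ (li (lQ.memLp k))))
  have hV' : ∀ k : ℤ, ∃ V : ℝ → ℂ, k ≠ 0 → IsPrim V (fun t => G k t - γ * P k t -
      k * ∑' l : ℤ, bKer μ c k l t * Q l t) ∧ P k =ᵐ[volume] V := fun k => by
    rcases eq_or_ne k 0 with rfl | hk
    · exact ⟨0, fun h => absurd rfl h⟩
    · obtain ⟨V, h1, h2⟩ := (isWeakDeriv_fst hc hγ hg hue hk).exists_isPrim (li (lP.memLp k))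
        (((li (hg.memLp k)).sub (lm γ (li (lP.memLp k)))).sub
          (lm k (hc.locallyIntegrable_row lQ k)))
      exact ⟨V, fun _ => ⟨h1, h2⟩⟩
  choose V hV using hV'
  -- the weights are removed, and the mean is set to zero
  have hE : IsPrim (fun t : ℝ => (Real.exp (γ * t) : ℂ))
      (fun t => (γ : ℂ) * (Real.exp (γ * t) : ℂ)) := .exp γ
  have hEE : ∀ t : ℝ, (Real.exp (-γ * t) : ℂ) * (Real.exp (γ * t) : ℂ) = 1 := fun t => by
    rw [← Complex.ofReal_mul, ← Real.exp_add]; simp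
  set p : ℤ → ℝ → ℂ := fun k t => if k = 0 then 0 else (Real.exp (γ * t) : ℂ) * ((k : ℂ)⁻¹ * F k t)
    with hp
  set v : ℤ → ℝ → ℂ := fun k t => if k = 0 then 0 else (Real.exp (γ * t) : ℂ) * V k t with hv
  have hpF : ∀ k : ℤ, (fun t => (k : ℂ) * p k t) =ᵐ[volume]
      fun t => (Real.exp (γ * t) : ℂ) * Q k t := fun k => by
    rcases eq_or_ne k 0 with rfl | hk
    · filter_upwards [hQ0] with t ht
      simp [ht]
    · filter_upwards [hFQ k] with t ht
      have : (k : ℂ) ≠ 0 := by exact_mod_cast hk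
      simp only [hp, hk, if_false, hQ, ht]
      field_simp
  have hDx : ∀ k : ℤ, Q k =ᵐ[volume] fun t => (Real.exp (-γ * t) : ℂ) * (k * p k t) := fun k => by
    filter_upwards [hpF k] with t ht
    rw [ht, ← mul_assoc, hEE, one_mul]
  have hDt : ∀ k : ℤ, k ≠ 0 → P k =ᵐ[volume] fun t => (Real.exp (-γ * t) : ℂ) * v k t :=
    fun k hk => by
    filter_upwards [(hV k hk).2] with t ht
    simp only [hv, hk, if_false, ht]
    rw [← mul_assoc, hEE, one_mul]
  have hmv : ∀ k : ℤ, ∀ᵐ t, ‖(Real.exp (-γ * t) : ℂ) * v k t‖ₑ ≤ ‖P k t‖ₑ := fun k => by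
    rcases eq_or_ne k 0 with rfl | hk
    · exact Eventually.of_forall fun t => by simp [hv]
    · filter_upwards [hDt k hk] with t ht
      rw [ht]
  have hall : ∀ᵐ t, ∀ k : ℤ, (k : ℂ) * p k t = (Real.exp (γ * t) : ℂ) * Q k t := ae_all_iff.2 hpF
  refine ⟨p, v, ⟨fun k => ?_, fun k => ?_, fun t => by simp [hp], ?_, lQ.congr hDx⟩, ?_⟩
  · rcases eq_or_ne k 0 with rfl | hk
    · simpa [hp, hv] using
        IsPrim.of_hasDerivAt (F := fun _ => (0 : ℂ)) (fun x => hasDerivAt_const x 0) continuous_const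
    · have := hE.mul ((hF k).const_mul (k : ℂ)⁻¹)
      simp only [hp, hv, hk, if_false]
      refine this.congr_ae ?_
      filter_upwards [hFQ k, (hV k hk).2] with t h1 h2
      have : (k : ℂ) ≠ 0 := by exact_mod_cast hk
      rw [← h1, ← h2]
      field_simp
      ring
  · rcases eq_or_ne k 0 with rfl | hk
    · have := IsPrim.of_hasDerivAt (F := fun _ => (0 : ℂ)) (fun x => hasDerivAt_const x 0)
        continuous_const
      simp only [hv, if_true]
      refine this.congr_ae ?_
      filter_upwards [hg0] with t ht
      simp [modeOp, ht]
    · have := hE.mul (hV k hk).1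
      simp only [hv, hk, if_false]
      refine this.congr_ae ?_
      filter_upwards [hall, (hV k hk).2] with t h1 h2
      have h3 : ∑' l : ℤ, bKer μ c k l t * (l * p l t) =
          (Real.exp (γ * t) : ℂ) * ∑' l : ℤ, bKer μ c k l t * Q l t := by
        rw [← tsum_mul_left]
        exact tsum_congr fun l => by rw [h1]; ring
      rw [modeOp, h3, ← h2]
      simp only [hG]
      linear_combination (g k t) * hEE t
  · refine lP.of_le (c := 1) (by simp) (fun k => ?_) fun k => ?_
    · rcases eq_or_ne k 0 with rfl | hk
      · simpa [hv] using aestronglyMeasurable_const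
      · exact (lP.meas k).congr (hDt k hk)
    · rw [one_mul]
      exact lintegral_mono_ae ((hmv k).mono fun t ht => by gcongr)
  · have h1 : ‖u‖ ^ 2 = modeSq P + modeSq Q := by
      rw [WithLp.prod_norm_sq_eq_of_L2, ← lP.norm_toSpace_sq, ← lQ.norm_toSpace_sq,
        toSpace_ofSpace, toSpace_ofSpace]
    have h2 : ‖(WithLp.toLp 2 (hg.toSpace, (0 : ModeSpace)) : PairSpace)‖ ^ 2 = modeSq G := by
      rw [WithLp.prod_norm_sq_eq_of_L2, ← hg.norm_toSpace_sq]
      simp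
    have h3 := pow_le_pow_left₀ (norm_nonneg _) hub 2
    rw [div_pow, h1, h2] at h3
    have h4 := lP.modeSq_mono hmv
    have h5 := modeSq_congr hDx
    linarith

end

/-! ### Fourier series on the torus -/

/-- The Fourier coefficients of a complex function; `coeff` is the case of real functions. -/
def ccoeff (f : Torus → ℂ) (k : ℤ) : ℂ := ∫ x, f x * fourier (-k) x

theorem coeff_eq_ccoeff (f : Torus → ℝ) : coeff f = ccoeff fun x => (f x : ℂ) := rfl

theorem ccoeff_eq (f : Torus → ℂ) (k : ℤ) : ccoeff f k = 2 * Real.pi * fourierCoeff f k := by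
  have hπ : (Real.pi : ℂ) ≠ 0 := by exact_mod_cast Real.pi_ne_zero
  rw [fourierCoeff, AddCircle.integral_haarAddCircle, ccoeff, Complex.real_smul]
  simp only [smul_eq_mul, mul_comm (fourier (-k) _)]
  push_cast
  field_simp

theorem ccoeff_congr {f g : Torus → ℂ} (h : f =ᵐ[volume] g) : ccoeff f = ccoeff g :=
  funext fun _ => integral_congr_ae (h.mono fun x hx => by simp only [hx])

theorem integrable_mul_fourier {f : Torus → ℂ} (hf : Integrable f volume) (k : ℤ) :
    Integrable (fun x => f x * fourier k x) volume :=
  hf.mul_bdd (c := 1) (fourier k).continuous.aestronglyMeasurable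
    (Eventually.of_forall fun x => by rw [fourier_apply, Circle.norm_coe])

theorem integrable_ofReal {f : Torus → ℝ} (hf : MemLp f 2 volume) :
    Integrable (fun x => (f x : ℂ)) volume := (hf.integrable (by norm_num)).ofReal

theorem memLp_ofReal {α : Type*} [MeasurableSpace α] {ν : Measure α} {f : α → ℝ}
    (hf : MemLp f 2 ν) : MemLp (fun x => (f x : ℂ)) 2 ν := hf.ofReal

theorem ccoeff_add {f g : Torus → ℂ} (hf : Integrable f volume) (hg : Integrable g volume)
    (k : ℤ) : ccoeff (fun x => f x + g x) k = ccoeff f k + ccoeff g k := by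
  simp only [ccoeff, add_mul]
  exact integral_add (integrable_mul_fourier hf _) (integrable_mul_fourier hg _)

theorem ccoeff_sub {f g : Torus → ℂ} (hf : Integrable f volume) (hg : Integrable g volume)
    (k : ℤ) : ccoeff (fun x => f x - g x) k = ccoeff f k - ccoeff g k := by
  simp only [ccoeff, sub_mul]
  exact integral_sub (integrable_mul_fourier hf _) (integrable_mul_fourier hg _)

theorem ccoeff_const_mul (c : ℂ) (f : Torus → ℂ) (k : ℤ) :
    ccoeff (fun x => c * f x) k = c * ccoeff f k := by
  simp only [ccoeff, mul_assoc]
  exact integral_const_mul _ _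

theorem ccoeff_conj (f : Torus → ℂ) (k : ℤ) :
    ccoeff (fun x => starRingEnd ℂ (f x)) k = starRingEnd ℂ (ccoeff f (-k)) := by
  rw [ccoeff, ccoeff, ← integral_conj]
  congr 1; funext x
  rw [map_mul, fourier_neg, neg_neg]

theorem coeff_neg (f : Torus → ℝ) (k : ℤ) : coeff f (-k) = starRingEnd ℂ (coeff f k) := by
  have := ccoeff_conj (fun x => (f x : ℂ)) (-k)
  simp only [Complex.conj_ofReal, neg_neg] at this
  exact this

theorem ccoeff_mul_fourier (f : Torus → ℂ) (j k : ℤ) :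
    ccoeff (fun x => f x * fourier j x) k = ccoeff f (k - j) := by
  rw [ccoeff, ccoeff]
  congr 1; funext x
  rw [mul_assoc, ← fourier_add, show -(k - j) = j + -k by ring]

/-- Parseval's identity. -/
theorem hasSum_ccoeff_mul_conj {f g : Torus → ℂ} (hf : MemLp f 2 volume) (hg : MemLp g 2 volume) :
    HasSum (fun k => ccoeff f k * starRingEnd ℂ (ccoeff g k))
      (2 * Real.pi * ∫ x, f x * starRingEnd ℂ (g x)) := by
  have hπ : (Real.pi : ℂ) ≠ 0 := by exact_mod_cast Real.pi_ne_zero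
  have hf' := hf.haarAddCircle
  have hg' := hg.haarAddCircle
  have hr : ∀ {h : Torus → ℂ} (hh : MemLp h 2 AddCircle.haarAddCircle) (k : ℤ),
      inner ℂ (fourierBasis k) (hh.toLp h) = fourierCoeff h k := fun hh k => by
    rw [← HilbertBasis.repr_apply_apply, fourierBasis_repr, fourierCoeff_congr_ae hh.coeFn_toLp]
  have h1 := fourierBasis.hasSum_inner_mul_inner (hg'.toLp g) (hf'.toLp f)
  have h2 : inner ℂ (hg'.toLp g) (hf'.toLp f) =
      (2 * Real.pi : ℂ)⁻¹ * ∫ x, f x * starRingEnd ℂ (g x) := by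
    rw [L2.inner_def]
    have : ∫ x, inner ℂ ((hg'.toLp g : Torus → ℂ) x) ((hf'.toLp f : Torus → ℂ) x)
        ∂AddCircle.haarAddCircle = ∫ x, f x * starRingEnd ℂ (g x) ∂AddCircle.haarAddCircle := by
      refine integral_congr_ae ?_
      filter_upwards [hf'.coeFn_toLp, hg'.coeFn_toLp] with x h1 h2
      rw [h1, h2, RCLike.inner_apply]
    rw [this, AddCircle.integral_haarAddCircle, Complex.real_smul]
    push_cast; rfl
  rw [h2] at h1
  have h3 := h1.mul_left ((2 * Real.pi : ℂ) ^ 2)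
  have e1 : (2 * Real.pi : ℂ) ^ 2 * ((2 * Real.pi : ℂ)⁻¹ * ∫ x, f x * starRingEnd ℂ (g x)) =
      2 * Real.pi * ∫ x, f x * starRingEnd ℂ (g x) := by field_simp
  rw [e1] at h3
  refine (congrArg (HasSum · _) (funext fun k => ?_)).mp h3
  rw [← inner_conj_symm, hr hg', hr hf', ccoeff_eq, ccoeff_eq]
  simp only [map_mul, Complex.conj_ofReal, map_ofNat]
  ring

theorem hasSum_ccoeff_sq {f : Torus → ℂ} (hf : MemLp f 2 volume) :
    HasSum (fun k => ‖ccoeff f k‖ ^ 2) (2 * Real.pi * ∫ x, ‖f x‖ ^ 2) := by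
  have h := hasSum_ccoeff_mul_conj hf hf
  have e : ∫ x, f x * starRingEnd ℂ (f x) = ((∫ x, ‖f x‖ ^ 2 : ℝ) : ℂ) := by
    rw [← integral_complex_ofReal]
    congr 1; funext x
    rw [Complex.mul_conj, Complex.normSq_eq_norm_sq]
  rw [e] at h
  have e2 : (fun k => ccoeff f k * starRingEnd ℂ (ccoeff f k)) =
      fun k => ((‖ccoeff f k‖ ^ 2 : ℝ) : ℂ) := by
    funext k
    rw [Complex.mul_conj, Complex.normSq_eq_norm_sq]
  rw [e2] at h
  exact_mod_cast h

/-- The theorem of Riesz and Fischer. -/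
theorem exists_ccoeff_eq {x : ℤ → ℂ} (hx : Summable fun k => ‖x k‖ ^ 2) :
    ∃ f : Torus → ℂ, MemLp f 2 volume ∧ ∀ k, ccoeff f k = x k := by
  have hπ : (Real.pi : ℂ) ≠ 0 := by exact_mod_cast Real.pi_ne_zero
  have hm : Memℓp (fun k => (2 * Real.pi : ℂ)⁻¹ * x k) 2 := by
    refine (memℓp_gen_iff (by norm_num)).2 ?_
    simp only [ENNReal.toReal_ofNat, Real.rpow_ofNat, norm_mul, mul_pow]
    exact hx.mul_left _
  set F := (fourierBasis (T := 2 * Real.pi)).repr.symm ⟨_, hm⟩ with hF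
  refine ⟨F, (Lp.memLp F).of_haarAddCircle, fun k => ?_⟩
  rw [ccoeff_eq, ← fourierBasis_repr, hF, LinearIsometryEquiv.apply_symm_apply]
  field_simp

/-- The theorem of Riesz and Fischer for real functions. -/
theorem exists_coeff_eq {x : ℤ → ℂ} (hx : Summable fun k => ‖x k‖ ^ 2)
    (hconj : ∀ k, x (-k) = starRingEnd ℂ (x k)) :
    ∃ f : Torus → ℝ, MemLp f 2 volume ∧ ∀ k, coeff f k = x k := by
  obtain ⟨f, hf, hfx⟩ := exists_ccoeff_eq hx
  have hfi := hf.integrable (by norm_num)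
  have hc : Integrable (fun x => starRingEnd ℂ (f x)) volume :=
    hfi.congr' (Complex.continuous_conj.comp_aestronglyMeasurable hf.1) (by simp)
  refine ⟨fun x => (f x).re, hf.re, fun k => ?_⟩
  have e : (fun x => (((f x).re : ℝ) : ℂ)) =
      fun x => (1 / 2 : ℂ) * (f x + starRingEnd ℂ (f x)) := by
    funext x; rw [Complex.add_conj]; push_cast; ring
  rw [coeff_eq_ccoeff, e, ccoeff_const_mul, ccoeff_add hfi hc, ccoeff_conj, hfx, hfx, hconj,
    Complex.conj_conj]
  ring

/-- An integrable function is determined by its Fourier coefficients. -/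
theorem ae_eq_zero_of_ccoeff_eq_zero {f : Torus → ℂ} (hf : Integrable f volume)
    (h : ∀ k, ccoeff f k = 0) : f =ᵐ[volume] 0 := by
  have hmul : ∀ g : C(Torus, ℂ), Integrable (fun x => f x * g x) volume := fun g =>
    hf.mul_bdd (c := ‖g‖) g.continuous.aestronglyMeasurable
      (Eventually.of_forall fun x => g.norm_coe_le_norm x)
  let Λ : C(Torus, ℂ) →L[ℂ] ℂ := LinearMap.mkContinuous
    { toFun := fun g => ∫ x, f x * g x
      map_add' := fun g g' => by
        rw [← integral_add (hmul g) (hmul g')]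
        simp [mul_add]
      map_smul' := fun c g => by
        rw [RingHom.id_apply, smul_eq_mul, ← integral_const_mul]
        simp [mul_left_comm] } (∫ x, ‖f x‖) fun g => by
      refine (norm_integral_le_integral_norm _).trans ?_
      rw [← integral_mul_const]
      refine integral_mono (hmul g).norm (hf.norm.mul_const _) fun x => ?_
      simp only [norm_mul]
      gcongr
      exact g.norm_coe_le_norm x
  have hΛ : ∀ g, Λ g = ∫ x, f x * g x := fun g => rfl
  -- integration against `f` vanishes on the dense set of trigonometric polynomials
  have hker : ∀ g, Λ g = 0 := fun g => by
    have h1 : (Submodule.span ℂ (range (fourier (T := 2 * Real.pi)))).topologicalClosure ≤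
        LinearMap.ker (Λ : C(Torus, ℂ) →ₗ[ℂ] ℂ) := by
      refine Submodule.topologicalClosure_minimal _ ?_ Λ.isClosed_ker
      rw [Submodule.span_le]
      rintro _ ⟨k, rfl⟩
      have := h (-k)
      rw [ccoeff, neg_neg] at this
      exact this
    rw [span_fourier_closure_eq_top] at h1
    exact h1 (Submodule.mem_top (x := g))
  refine ae_eq_zero_of_forall_setIntegral_isClosed_eq_zero hf fun s hs => ?_
  -- the indicator of a closed set is a limit of continuous functions
  have hpos : ∀ n : ℕ, (0 : ℝ) < 1 / ((n : ℝ) + 1) := fun n => by positivity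
  have ht := thickenedIndicator_tendsto_indicator_closure hpos
    tendsto_one_div_add_atTop_nhds_zero_nat s
  rw [hs.closure_eq, tendsto_pi_nhds] at ht
  have hlim : Tendsto (fun n : ℕ => ∫ x, f x * ((thickenedIndicator (hpos n) s x : ℝ) : ℂ)) atTop
      (𝓝 (∫ x, s.indicator f x)) := by
    refine tendsto_integral_of_dominated_convergence (fun x => ‖f x‖) (fun n => ?_) hf.norm
      (fun n => Eventually.of_forall fun x => ?_) (Eventually.of_forall fun x => ?_)
    · refine hf.1.mul (Continuous.aestronglyMeasurable ?_)
      have := (thickenedIndicator (hpos n) s).continuous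
      fun_prop
    · rw [norm_mul, Complex.norm_real, Real.norm_of_nonneg (by positivity)]
      exact mul_le_of_le_one_right (norm_nonneg _)
        (by exact_mod_cast thickenedIndicator_le_one (hpos n) s x)
    · have h1 : Tendsto (fun n : ℕ => (((thickenedIndicator (hpos n) s x : NNReal) : ℝ) : ℂ)) atTop
          (𝓝 ((((s.indicator (fun _ => 1) x : NNReal)) : ℝ) : ℂ)) :=
        (Complex.continuous_ofReal.tendsto _).comp
          ((NNReal.continuous_coe.tendsto _).comp (ht x))
      have h2 := h1.const_mul (f x)
      refine (congrArg (Tendsto _ atTop) (congrArg 𝓝 ?_)).mp h2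
      by_cases hx : x ∈ s <;> simp [hx]
  have h0 : ∀ n : ℕ, ∫ x, f x * ((thickenedIndicator (hpos n) s x : ℝ) : ℂ) = 0 := fun n =>
    hker ⟨fun x => ((thickenedIndicator (hpos n) s x : ℝ) : ℂ), by
      have := (thickenedIndicator (hpos n) s).continuous
      fun_prop⟩
  simp only [h0] at hlim
  rw [← integral_indicator hs.measurableSet]
  exact tendsto_nhds_unique hlim tendsto_const_nhds

theorem ae_eq_of_ccoeff_eq {f g : Torus → ℂ} (hf : Integrable f volume) (hg : Integrable g volume)
    (h : ∀ k, ccoeff f k = ccoeff g k) : f =ᵐ[volume] g := by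
  have := ae_eq_zero_of_ccoeff_eq_zero (hf.sub hg) fun k =>
    (ccoeff_sub hf hg k).trans (sub_eq_zero.2 (h k))
  exact this.mono fun x hx => sub_eq_zero.1 hx

theorem ae_eq_of_coeff_eq {f g : Torus → ℝ} (hf : Integrable f volume) (hg : Integrable g volume)
    (h : ∀ k, coeff f k = coeff g k) : f =ᵐ[volume] g :=
  (ae_eq_of_ccoeff_eq hf.ofReal hg.ofReal h).mono fun _ hx => Complex.ofReal_injective hx

/-- A function with absolutely summable Fourier coefficients is bounded. -/
theorem exists_bound_of_summable {F : Torus → ℂ} (hF : Integrable F volume)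
    (hs : Summable fun j => ‖ccoeff F j‖) :
    AEStronglyMeasurable F volume ∧ ∃ M, ∀ᵐ x, ‖F x‖ ≤ M := by
  have hπ : (Real.pi : ℂ) ≠ 0 := by exact_mod_cast Real.pi_ne_zero
  set u : ℤ → C(Torus, ℂ) := fun j => ((2 * Real.pi : ℂ)⁻¹ * ccoeff F j) • fourier j with hu
  have hus : Summable u := by
    refine Summable.of_norm ?_
    simp only [hu, norm_smul, fourier_norm, mul_one, norm_mul]
    exact hs.mul_left _
  have hGi : Integrable (fun x => (∑' j, u j) x) volume :=
    (∑' j, u j).continuous.integrable_of_hasCompactSupport (HasCompactSupport.of_compactSpace _)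
  have hG : F =ᵐ[volume] fun x => (∑' j, u j) x := by
    refine ae_eq_of_ccoeff_eq hF hGi fun k => ?_
    let Λ : C(Torus, ℂ) →L[ℂ] ℂ := LinearMap.mkContinuous
      { toFun := fun g => ccoeff g k
        map_add' := fun g g' => ccoeff_add
          (g.continuous.integrable_of_hasCompactSupport (HasCompactSupport.of_compactSpace _))
          (g'.continuous.integrable_of_hasCompactSupport (HasCompactSupport.of_compactSpace _)) k
        map_smul' := fun c g => ccoeff_const_mul c g k } (2 * Real.pi) fun g => by
        refine (norm_integral_le_of_norm_le_const (C := ‖g‖) (Eventually.of_forall fun x => ?_)).trans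
          (le_of_eq ?_)
        · rw [norm_mul, fourier_apply, Circle.norm_coe, mul_one]
          exact g.norm_coe_le_norm x
        · rw [mul_comm, Measure.real, AddCircle.measure_univ, ENNReal.toReal_ofReal]
          exact Real.two_pi_pos.le
    have hΛ : Λ (∑' j, u j) = ∑' j, Λ (u j) := Λ.map_tsum hus
    have hf : ∀ j, Λ (u j) = if j = k then ccoeff F k else 0 := fun j => by
      have e : Λ (u j) = (2 * Real.pi : ℂ)⁻¹ * ccoeff F j * Λ (fourier j) := by
        rw [hu, map_smul, smul_eq_mul]
      have e2 : Λ (fourier j) = if j = k then (2 * Real.pi : ℂ) else 0 := by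
        have : Λ (fourier j) = 2 * Real.pi * fourierCoeff (fourier (T := 2 * Real.pi) j) k :=
          ccoeff_eq _ _
        rw [this, fourierCoeff_fourier]
        by_cases hjk : j = k
        · subst hjk; simp
        · simp [hjk]
      rw [e, e2]
      split_ifs with hjk
      · subst hjk; field_simp
      · simp
    have : ccoeff (fun x => (∑' j, u j) x) k = Λ (∑' j, u j) := rfl
    rw [this, hΛ]
    simp only [hf]
    rw [tsum_ite_eq]
  refine ⟨hF.1, ‖∑' j, u j‖, hG.mono fun x hx => ?_⟩
  rw [hx]
  exact ContinuousMap.norm_coe_le_norm _ x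

/-- The Fourier coefficients of a product. -/
theorem hasSum_ccoeff_mul {F g : Torus → ℂ} (hF : MemLp F 2 volume) (hg : MemLp g 2 volume)
    (k : ℤ) : HasSum (fun l => ccoeff F (k - l) * ccoeff g l)
      (2 * Real.pi * ccoeff (fun x => F x * g x) k) := by
  have hm : MemLp (fun x => starRingEnd ℂ (g x) * fourier k x) 2 volume := by
    refine hg.of_le ((Complex.continuous_conj.comp_aestronglyMeasurable hg.1).mul
      (fourier k).continuous.aestronglyMeasurable) (Eventually.of_forall fun x => ?_)
    rw [norm_mul, fourier_apply, Circle.norm_coe, mul_one, RCLike.norm_conj]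
  have h := hasSum_ccoeff_mul_conj hF hm
  have e1 : ∀ j, starRingEnd ℂ (ccoeff (fun x => starRingEnd ℂ (g x) * fourier k x) j) =
      ccoeff g (k - j) := fun j => by
    rw [ccoeff_mul_fourier, ccoeff_conj, Complex.conj_conj, neg_sub]
  have e2 : ∫ x, F x * starRingEnd ℂ (starRingEnd ℂ (g x) * fourier k x) =
      ccoeff (fun x => F x * g x) k := by
    rw [ccoeff]
    congr 1; funext x
    rw [map_mul, Complex.conj_conj, fourier_neg, mul_assoc]
  simp only [e1] at h
  rw [e2] at h
  have := (Equiv.hasSum_iff (Equiv.subLeft k)).2 h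
  refine (congrArg (HasSum · _) (funext fun l => ?_)).mp this
  simp [Equiv.subLeft]

theorem memLp_mul_of_summable {F g : Torus → ℝ} (hF : MemLp F 2 volume) (hg : MemLp g 2 volume)
    (hs : Summable fun j => ‖coeff F j‖) : MemLp (fun x => F x * g x) 2 volume := by
  obtain ⟨hm, M, hM⟩ := exists_bound_of_summable (integrable_ofReal hF) hs
  refine hg.of_le_mul (c := M) (hF.1.mul hg.1) (hM.mono fun x hx => ?_)
  rw [norm_mul]
  gcongr
  simpa using hx

theorem hasSum_coeff_mul {F g : Torus → ℝ} (hF : MemLp F 2 volume) (hg : MemLp g 2 volume)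
    (k : ℤ) : HasSum (fun l => coeff F (k - l) * coeff g l)
      (2 * Real.pi * coeff (fun x => F x * g x) k) := by
  have := hasSum_ccoeff_mul (memLp_ofReal hF) (memLp_ofReal hg) k
  rw [coeff_eq_ccoeff, coeff_eq_ccoeff, coeff_eq_ccoeff]
  simpa only [Complex.ofReal_mul] using this

theorem hasSum_coeff_mul_conj {f g : Torus → ℝ} (hf : MemLp f 2 volume) (hg : MemLp g 2 volume) :
    HasSum (fun k => coeff f k * starRingEnd ℂ (coeff g k))
      ((2 * Real.pi * ∫ x, f x * g x : ℝ) : ℂ) := by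
  have := hasSum_ccoeff_mul_conj (memLp_ofReal hf) (memLp_ofReal hg)
  simp only [Complex.conj_ofReal, ← Complex.ofReal_mul, integral_complex_ofReal] at this
  push_cast
  exact this

theorem summable_coeff_sq {f : Torus → ℝ} (hf : MemLp f 2 volume) :
    Summable fun k => ‖coeff f k‖ ^ 2 := (hasSum_ccoeff_sq (memLp_ofReal hf)).summable

/-! ### Fourier multipliers -/

/-- A multiplier is characterized by its Fourier coefficients as soon as they are square summable
and those of a real function. -/
theorem multiplier_spec {A : ℤ → ℂ} {f : Torus → ℝ} (hA : ∀ k, A (-k) = starRingEnd ℂ (A k))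
    (hs : Summable fun k => ‖A k * coeff f k‖ ^ 2) :
    MemLp (multiplier A f) 2 volume ∧ ∀ k, coeff (multiplier A f) k = A k * coeff f k :=
  Classical.epsilon_spec (p := fun h : Torus → ℝ =>
    MemLp h 2 volume ∧ ∀ k : ℤ, coeff h k = A k * coeff f k)
    (exists_coeff_eq hs fun k => by rw [hA, coeff_neg, map_mul])

theorem norm_sign_le (k : ℤ) : ‖((Int.sign k : ℤ) : ℂ)‖ ≤ 1 := by
  rcases Int.sign_trichotomy k with h | h | h <;> simp [h]

theorem hilbert_spec {f : Torus → ℝ} (hs : Summable fun k => ‖coeff f k‖ ^ 2) :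
    MemLp (hilbert f) 2 volume ∧
      ∀ k, coeff (hilbert f) k = -Complex.I * (Int.sign k : ℂ) * coeff f k := by
  refine multiplier_spec (fun k => by simp) (hs.of_nonneg_of_le (fun k => by positivity) fun k => ?_)
  gcongr
  rw [norm_mul, norm_mul, norm_neg, Complex.norm_I, one_mul]
  exact mul_le_of_le_one_left (norm_nonneg _) (norm_sign_le k)

theorem dx_spec {f : Torus → ℝ} (hs : Summable fun k : ℤ => ‖(k : ℂ) * coeff f k‖ ^ 2) :
    MemLp (dx f) 2 volume ∧ ∀ k, coeff (dx f) k = Complex.I * k * coeff f k := by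
  refine multiplier_spec (fun k => by simp) (hs.congr fun k => ?_)
  rw [mul_assoc, norm_mul Complex.I, Complex.norm_I, one_mul]

/-! ### Matrices dominated by a convolution -/

/-- The matrix `K` is dominated by convolution with a summable sequence. -/
def Dominated (K : ℤ → ℤ → ℂ) : Prop :=
  ∃ m : ℤ → ℝ, Summable m ∧ ∀ k l, ‖K k l‖ ≤ m (k - l)

theorem summable_sq_of_summable {x : ℤ → ℂ} (h : Summable fun k => ‖x k‖) :
    Summable fun k => ‖x k‖ ^ 2 := by
  have h1 : Memℓp (E := fun _ : ℤ => ℂ) x 1 := by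
    refine (memℓp_gen_iff (by norm_num)).2 ?_
    simpa only [ENNReal.toReal_one, Real.rpow_one] using h
  have h2 : Memℓp (E := fun _ : ℤ => ℂ) x 2 := h1.of_exponent_ge (by norm_num)
  have h3 := (memℓp_gen_iff (by norm_num)).1 h2
  simpa only [ENNReal.toReal_ofNat, Real.rpow_ofNat] using h3

namespace Dominated

variable {K K' : ℤ → ℤ → ℂ} {x y : ℤ → ℂ}

theorem add (h : Dominated K) (h' : Dominated K') : Dominated fun k l => K k l + K' k l := by
  obtain ⟨m, hm, hK⟩ := h
  obtain ⟨m', hm', hK'⟩ := h'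
  exact ⟨_, hm.add hm', fun k l => (norm_add_le _ _).trans (add_le_add (hK k l) (hK' k l))⟩

theorem summable (h : Dominated K) (hx : Summable fun k => ‖x k‖ ^ 2)
    (hy : Summable fun k => ‖y k‖ ^ 2) :
    Summable fun kl : ℤ × ℤ => K kl.1 kl.2 * x kl.2 * starRingEnd ℂ (y kl.1) := by
  obtain ⟨m, hm, hK⟩ := h
  have hm0 : ∀ j, 0 ≤ m j := fun j => (norm_nonneg _).trans (by simpa using hK j 0)
  let e1 : ℤ × ℤ ≃ ℤ × ℤ :=
    ⟨fun q => (q.1 - q.2, q.2), fun q => (q.1 + q.2, q.2), fun q => by simp, fun q => by simp⟩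
  let e2 : ℤ × ℤ ≃ ℤ × ℤ :=
    ⟨fun q => (q.1 - q.2, q.1), fun q => (q.2, q.2 - q.1), fun q => by simp, fun q => by simp⟩
  have s1 := (e1.summable_iff).2 (hm.mul_of_nonneg hx hm0 fun k => by positivity)
  have s2 := (e2.summable_iff).2 (hm.mul_of_nonneg hy hm0 fun k => by positivity)
  refine Summable.of_norm_bounded (s1.add s2) fun kl => ?_
  simp only [Function.comp_apply, e1, e2, Equiv.coe_fn_mk]
  rw [norm_mul, norm_mul, RCLike.norm_conj]
  have h0 := hm0 (kl.1 - kl.2)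
  have h1 := two_mul_le_add_sq ‖x kl.2‖ ‖y kl.1‖
  calc ‖K kl.1 kl.2‖ * ‖x kl.2‖ * ‖y kl.1‖ ≤ m (kl.1 - kl.2) * ‖x kl.2‖ * ‖y kl.1‖ := by
        gcongr; exact hK _ _
    _ = m (kl.1 - kl.2) * (‖x kl.2‖ * ‖y kl.1‖) := by ring
    _ ≤ m (kl.1 - kl.2) * (‖x kl.2‖ ^ 2 + ‖y kl.1‖ ^ 2) := by
        gcongr
        have := mul_nonneg (norm_nonneg (x kl.2)) (norm_nonneg (y kl.1))
        linarith
    _ = _ := by ring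

/-- Young's inequality: convolution with a summable sequence preserves `ℓ²`. The convolution is
realized as the product of a bounded function and a square integrable one. -/
theorem summable_sq (h : Dominated K) (hx : Summable fun k => ‖x k‖ ^ 2) {U : ℤ → ℂ}
    (hU : ∀ k, HasSum (fun l => K k l * x l) (U k)) : Summable fun k => ‖U k‖ ^ 2 := by
  obtain ⟨m, hm, hK⟩ := h
  have hm0 : ∀ j, 0 ≤ m j := fun j => (norm_nonneg _).trans (by simpa using hK j 0)
  have hmn : Summable fun j => ‖(m j : ℂ)‖ := by
    simpa only [Complex.norm_real, Real.norm_eq_abs, abs_of_nonneg (hm0 _)] using hm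
  obtain ⟨F, hF, hFm⟩ := exists_ccoeff_eq (summable_sq_of_summable hmn)
  obtain ⟨g, hg, hgx⟩ := exists_ccoeff_eq (x := fun l => (‖x l‖ : ℂ)) (by simpa using hx)
  obtain ⟨hFs, M, hM⟩ := exists_bound_of_summable (hF.integrable (by norm_num))
    (by simpa only [hFm] using hmn)
  have hFg : MemLp (fun x => F x * g x) 2 volume :=
    hg.of_le_mul (c := M) (hFs.mul hg.1) (hM.mono fun x hx => by rw [norm_mul]; gcongr)
  refine ((hasSum_ccoeff_sq hFg).summable.mul_left ((2 * Real.pi) ^ 2)).of_nonneg_of_le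
    (fun k => by positivity) fun k => ?_
  have hs := hasSum_ccoeff_mul hF hg k
  simp only [hFm, hgx] at hs
  have hsr : HasSum (fun l => m (k - l) * ‖x l‖) (2 * Real.pi * ccoeff (fun x => F x * g x) k).re :=
    by simpa using Complex.hasSum_re hs
  rw [← mul_pow]
  refine pow_le_pow_left₀ (norm_nonneg _) ?_ 2
  rw [← (hU k).tsum_eq]
  have h1 : ‖∑' l, K k l * x l‖ ≤ ∑' l, m (k - l) * ‖x l‖ :=
    tsum_of_norm_bounded hsr.summable.hasSum fun l => by
      rw [norm_mul]; gcongr; exact hK k l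
  refine h1.trans ?_
  rw [hsr.tsum_eq]
  refine (Complex.re_le_norm _).trans (le_of_eq ?_)
  rw [norm_mul, norm_mul, Complex.norm_real, Real.norm_of_nonneg Real.pi_pos.le]
  simp

/-- The pairing of a function whose coefficients are `K x` with `w`. -/
theorem hasSum_pairing (h : Dominated K) (hx : Summable fun k => ‖x k‖ ^ 2) {U w : Torus → ℝ}
    (hUL : MemLp U 2 volume) (hw : MemLp w 2 volume)
    (hU : ∀ k, HasSum (fun l => K k l * x l) (coeff U k)) :
    HasSum (fun kl : ℤ × ℤ => K kl.1 kl.2 * x kl.2 * starRingEnd ℂ (coeff w kl.1))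
      ((2 * Real.pi * ∫ x, U x * w x : ℝ) : ℂ) := by
  have hs := h.summable hx (summable_coeff_sq hw)
  have h1 := hs.hasSum
  have h2 := h1.prod_fiberwise fun k => ((hU k).mul_right (starRingEnd ℂ (coeff w k)))
  rw [← h2.unique (hasSum_coeff_mul_conj hUL hw)]
  exact h1

end Dominated

/-! ### The spatial operator at a fixed time -/

theorem coeff_sub {f g : Torus → ℝ} (hf : MemLp f 2 volume) (hg : MemLp g 2 volume) (k : ℤ) :
    coeff (fun x => f x - g x) k = coeff f k - coeff g k := by
  have := ccoeff_sub (integrable_ofReal hf) (integrable_ofReal hg) k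
  simp only [coeff_eq_ccoeff]
  rw [← this]
  simp only [Complex.ofReal_sub]

theorem coeff_const_mul (c : ℝ) (f : Torus → ℝ) (k : ℤ) :
    coeff (fun x => c * f x) k = c * coeff f k := by
  have := ccoeff_const_mul c (fun x => (f x : ℂ)) k
  simp only [coeff_eq_ccoeff]
  rw [← this]
  simp only [Complex.ofReal_mul]

theorem hasSum_coeff_mul' {F g : Torus → ℝ} (hF : MemLp F 2 volume) (hg : MemLp g 2 volume)
    (k : ℤ) : HasSum (fun l => coeff F (k - l) / (2 * Real.pi) * coeff g l)
      (coeff (fun x => F x * g x) k) := by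
  have hπ : (Real.pi : ℂ) ≠ 0 := by exact_mod_cast Real.pi_ne_zero
  have := (hasSum_coeff_mul hF hg k).mul_left (2 * Real.pi : ℂ)⁻¹
  rw [← mul_assoc, inv_mul_cancel₀ (by simp [hπ]), one_mul] at this
  refine (congrArg (HasSum · _) (funext fun l => ?_)).mp this
  field_simp

section

/-- The sign of an integer, as a complex number. -/
local notation "sg" => fun k : ℤ => ((Int.sign k : ℤ) : ℂ)

theorem sign_mul_self (k : ℤ) : ((Int.sign k : ℤ) : ℂ) * k = (|(k : ℝ)| : ℝ) := by
  rw [← Int.cast_mul, Int.sign_mul_self_eq_abs, ← Int.cast_abs, Complex.ofReal_intCast]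

theorem norm_sign_sub_le (k l : ℤ) :
    |(l : ℝ)| * ‖((Int.sign l : ℤ) : ℂ) - (Int.sign k : ℤ)‖ ≤ 2 * |((k - l : ℤ) : ℝ)| := by
  by_cases h : Int.sign l = Int.sign k
  · rw [h]; simp
  rcases eq_or_ne l 0 with rfl | hl
  · simp
  have h1 : |l| ≤ |k - l| := by
    rcases lt_trichotomy l 0 with h2 | h2 | h2 <;> rcases lt_trichotomy k 0 with h3 | h3 | h3 <;>
      simp_all [Int.sign_eq_one_of_pos, Int.sign_eq_neg_one_of_neg] <;> grind
  have h1' : |(l : ℝ)| ≤ |((k - l : ℤ) : ℝ)| := by exact_mod_cast h1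
  have h2 := (norm_sub_le ((Int.sign l : ℤ) : ℂ) (Int.sign k : ℤ)).trans
    (add_le_add (norm_sign_le l) (norm_sign_le k))
  calc _ ≤ |((k - l : ℤ) : ℝ)| * (1 + 1) := by gcongr
    _ = _ := by ring

/-- `lam_eq` with the absolute values written in terms of signs. -/
theorem lam_eq_sign {k l : ℤ} (hk : k ≠ 0) (hl : l ≠ 0) :
    (lam k l : ℂ) = -2 * sg k * sg l * (sg (k - l) * (k - l : ℤ)) +
      (k - l : ℤ) ^ 2 * (sg (k - l) ^ 2 - sg k * sg (k - l)) * (sg l / l) +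
      (sg l * l) * (sg l - sg k) * sg (k - l) := by
  have h1 := sign_mul_self (k - l)
  have h2 := sign_mul_self l
  have hl' : (l : ℂ) ≠ 0 := by exact_mod_cast hl
  have h3 : ((Int.sign l : ℤ) : ℂ) ^ 2 = 1 := by
    rcases lt_or_gt_of_ne hl with h | h
    · simp [Int.sign_eq_neg_one_of_neg h]
    · simp [Int.sign_eq_one_of_pos h]
  have h4 : ((k - l : ℤ) : ℂ) ^ 2 * ((Int.sign (k - l) : ℤ) : ℂ) ^ 2 = ((k - l : ℤ) : ℂ) ^ 2 := by
    rcases lt_trichotomy (k - l) 0 with h | h | h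
    · simp [Int.sign_eq_neg_one_of_neg h]
    · simp [h]
    · simp [Int.sign_eq_one_of_pos h]
  have h5 : ((Int.sign l : ℤ) : ℂ) ≠ 0 := fun h => by simp [h] at h3
  have h6 : (1 : ℂ) / ((Int.sign l : ℤ) * l) = (Int.sign l : ℤ) / l := by
    field_simp
    linear_combination -h3
  rw [lam_eq hk hl]
  push_cast at h1 h2 h4 ⊢
  rw [← h1, ← h2, div_eq_mul_one_div _ (_ * _), h6]
  linear_combination -((Int.sign l : ℂ) / l) * h4

/-- In Fourier coefficients, the spatial part of the weak equation at a fixed time is the form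
with kernel `bKer`. The last term pairs `H X` with a derivative: it is computed with the roles of
the two functions exchanged, and then conjugated. -/
theorem hasSum_spatial {μ : ℝ} {c : ℤ → ℝ → ℂ} {t : ℝ} {f₀ f X w : Torus → ℝ}
    (hf₀ : MemLp f₀ 2 volume) (hc : ∀ j, c j t = coeff f₀ j / (2 * Real.pi))
    (hcs : Summable fun j : ℤ => ‖(j : ℂ) ^ 2 * c j t‖) (hf : coeff f 0 = 0)
    (hX : MemLp X 2 volume) (hXf : ∀ k, coeff X k = Complex.I * k * coeff f k)
    (hw : MemLp w 2 volume) (hw0 : coeff w 0 = 0) :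
    HasSum (fun kl : ℤ × ℤ => bKer μ c kl.1 kl.2 t * coeff X kl.2 * starRingEnd ℂ (coeff w kl.1))
      ((2 * Real.pi * ((∫ x, μ * (X x * w x)) +
        (∫ x, 2 * hilbert (fun y => dx (hilbert f₀) y * hilbert X y) x * w x) -
        (∫ x, comm (hilbert f) (dx (dx (hilbert f₀))) x * w x) +
        ∫ x, hilbert X x * dx (comm (hilbert f₀) w) x) : ℝ) : ℂ) := by
  have hπ : (Real.pi : ℂ) ≠ 0 := by exact_mod_cast Real.pi_ne_zero
  have hπ0 := Real.pi_pos
  have hcf : ∀ j, coeff f₀ j = 2 * Real.pi * c j t := fun j => by rw [hc]; field_simp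
  -- summability of the coefficients of the basic state
  set m : ℤ → ℝ := fun j => ‖(j : ℂ) ^ 2 * c j t‖ with hm
  have hsc : ∀ (e : ℤ → ℂ) (C : ℝ), (∀ j, ‖e j‖ ≤ C * m j) → Summable fun j => ‖e j‖ :=
    fun e C he => (hcs.mul_left C).of_nonneg_of_le (fun j => norm_nonneg _) he
  have hsI : ∀ j : ℤ, ‖-Complex.I * (Int.sign j : ℂ)‖ ≤ 1 := fun j => by
    rw [norm_mul, norm_neg, Complex.norm_I, one_mul]; exact norm_sign_le j
  have hj1 : ∀ j : ℤ, ‖(Int.sign j : ℂ)‖ ≤ ‖(j : ℂ)‖ := fun j => by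
    rcases eq_or_ne j 0 with rfl | h
    · simp
    · refine (norm_sign_le j).trans ?_
      rw [Complex.norm_intCast]; exact_mod_cast Int.one_le_abs h
  have hj2 : ∀ j : ℤ, ‖(j : ℂ)‖ ≤ ‖(j : ℂ)‖ ^ 2 := fun j => by
    rcases eq_or_ne j 0 with rfl | h
    · simp
    · refine le_self_pow₀ ?_ (by norm_num)
      rw [Complex.norm_intCast]; exact_mod_cast Int.one_le_abs h
  have hmj : ∀ j, m j = ‖(j : ℂ)‖ ^ 2 * ‖c j t‖ := fun j => by rw [hm]; simp
  have n2π : ‖(2 * Real.pi : ℂ)‖ = 2 * Real.pi := by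
    rw [norm_mul, Complex.norm_real, Real.norm_of_nonneg hπ0.le]; simp
  have n2c : ∀ j, ‖(2 * Real.pi : ℂ) * c j t‖ = 2 * Real.pi * ‖c j t‖ := fun j => by
    rw [norm_mul, n2π]
  -- `Φ₀ = H φ₀` and its derivatives
  obtain ⟨hh, hhc⟩ := hilbert_spec (summable_coeff_sq hf₀)
  set h := hilbert f₀ with hhdef
  have hhs : Summable fun j => ‖coeff h j‖ := hsc _ (2 * Real.pi) fun j => by
    rw [hhc, hcf, norm_mul, norm_mul, n2c, norm_neg, Complex.norm_I, one_mul, hmj]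
    have := (hj1 j).trans (hj2 j)
    calc _ = 2 * Real.pi * (‖(Int.sign j : ℂ)‖ * ‖c j t‖) := by ring
      _ ≤ _ := by gcongr
  have hh1s : Summable fun j : ℤ => ‖(j : ℂ) * coeff h j‖ := hsc _ (2 * Real.pi) fun j => by
    rw [norm_mul, hhc, hcf, norm_mul (-Complex.I * _), n2c, hmj]
    calc _ = 2 * Real.pi * (‖(j : ℂ)‖ * ‖-Complex.I * (Int.sign j : ℂ)‖ * ‖c j t‖) := by ring
      _ ≤ 2 * Real.pi * (‖(j : ℂ)‖ ^ 2 * 1 * ‖c j t‖) := by gcongr; exacts [hj2 j, hsI j]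
      _ = _ := by ring
  obtain ⟨hd, hdc⟩ := dx_spec (summable_sq_of_summable hh1s)
  set h' := dx h with hh'def
  have hds : Summable fun j => ‖coeff h' j‖ := by
    refine hh1s.congr fun j => ?_
    rw [hdc, mul_assoc, norm_mul Complex.I, Complex.norm_I, one_mul]
  have hd1s : Summable fun j : ℤ => ‖(j : ℂ) * coeff h' j‖ := hsc _ (2 * Real.pi) fun j => by
    rw [norm_mul, hdc, hhc, hcf, norm_mul (Complex.I * _), norm_mul Complex.I,
      norm_mul (-Complex.I * _), n2c, hmj, Complex.norm_I, one_mul]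
    calc _ = 2 * Real.pi * (‖(j : ℂ)‖ ^ 2 * ‖-Complex.I * (Int.sign j : ℂ)‖ * ‖c j t‖) := by ring
      _ ≤ 2 * Real.pi * (‖(j : ℂ)‖ ^ 2 * 1 * ‖c j t‖) := by gcongr; exact hsI j
      _ = _ := by ring
  obtain ⟨hdd, hddc⟩ := dx_spec (summable_sq_of_summable hd1s)
  set h'' := dx h' with hh''def
  have hdds : Summable fun j => ‖coeff h'' j‖ := by
    refine hd1s.congr fun j => ?_
    rw [hddc, mul_assoc, norm_mul Complex.I, Complex.norm_I, one_mul]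
  obtain ⟨hHdd, hHddc⟩ := hilbert_spec (summable_coeff_sq hdd)
  have hHdds : Summable fun j => ‖coeff (hilbert h'') j‖ := by
    refine hdds.of_nonneg_of_le (fun j => norm_nonneg _) fun j => ?_
    rw [hHddc, norm_mul]
    exact mul_le_of_le_one_left (norm_nonneg _) (hsI j)
  have nh : ∀ j, coeff h j / (2 * Real.pi) = -Complex.I * Int.sign j * c j t := fun j => by
    rw [hhc, hcf]; field_simp
  have nd : ∀ j, coeff h' j / (2 * Real.pi) =
      Complex.I * j * (-Complex.I * Int.sign j * c j t) := fun j => by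
    rw [hdc, mul_div_assoc, nh]
  have ndd : ∀ j, coeff h'' j / (2 * Real.pi) =
      Complex.I * j * (Complex.I * j * (-Complex.I * Int.sign j * c j t)) := fun j => by
    rw [hddc, mul_div_assoc, nd]
  have nHdd : ∀ j, coeff (hilbert h'') j / (2 * Real.pi) = -Complex.I * Int.sign j *
      (Complex.I * j * (Complex.I * j * (-Complex.I * Int.sign j * c j t))) := fun j => by
    rw [hHddc, mul_div_assoc, ndd]
  have hI : Complex.I ^ 4 = 1 := Complex.I_pow_four
  -- the unknown
  have hXs := summable_coeff_sq hX
  obtain ⟨hHX, hHXc⟩ := hilbert_spec hXs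
  have hfs : Summable fun k => ‖coeff f k‖ ^ 2 := by
    refine hXs.of_nonneg_of_le (fun k => by positivity) fun k => ?_
    rcases eq_or_ne k 0 with rfl | hk
    · simp [hf]
    · gcongr
      rw [hXf, norm_mul, norm_mul, Complex.norm_I, one_mul, Complex.norm_intCast]
      exact le_mul_of_one_le_left (norm_nonneg _) (by exact_mod_cast Int.one_le_abs hk)
  obtain ⟨hHf, hHfc⟩ := hilbert_spec hfs
  have hfX : ∀ l : ℤ, coeff (hilbert f) l = -((Int.sign l : ℂ) / l) * coeff X l := fun l => by
    rcases eq_or_ne l 0 with rfl | hl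
    · simp [hHfc]
    · have : (l : ℂ) ≠ 0 := by exact_mod_cast hl
      rw [hHfc, hXf]; field_simp
  have hws := summable_coeff_sq hw
  obtain ⟨hHw, hHwc⟩ := hilbert_spec hws
  -- domination of the four kernels
  have dom : ∀ (K : ℤ → ℤ → ℂ) (C : ℝ), (∀ k l, ‖K k l‖ ≤ C * m (k - l)) → Dominated K :=
    fun K C hK => ⟨fun j => C * m j, hcs.mul_left C, hK⟩
  set K₀ : ℤ → ℤ → ℂ := fun k l => if k = l then (μ : ℂ) else 0 with hK₀
  have d₀ : Dominated K₀ := by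
    refine ⟨fun j => if j = 0 then |μ| else 0, (hasSum_ite_eq 0 _).summable, fun k l => ?_⟩
    by_cases hkl : k = l
    · simp [hK₀, hkl]
    · simp [hK₀, hkl, sub_eq_zero]
  have t₀ := d₀.hasSum_pairing hXs (hX.const_mul μ) hw fun k => by
    rw [coeff_const_mul]
    have := hasSum_ite_eq k ((μ : ℂ) * coeff X k)
    refine (congrArg (HasSum · _) (funext fun l => ?_)).mp this
    simp only [hK₀]
    by_cases hkl : l = k
    · simp [hkl]
    · simp [hkl, Ne.symm hkl]
  set K₁ : ℤ → ℤ → ℂ := fun k l => -2 * sg k * sg l * (sg (k - l) * (k - l : ℤ)) * c (k - l) t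
    with hK₁
  have d₁ : Dominated K₁ := dom _ 2 fun k l => by
    simp only [hK₁, hmj]
    rw [norm_mul, norm_mul, norm_mul, norm_mul, norm_mul]
    have h1 := norm_sign_le k
    have h2 := norm_sign_le l
    have h3 := norm_sign_le (k - l)
    calc _ ≤ ‖(-2 : ℂ)‖ * 1 * 1 * (1 * ‖((k - l : ℤ) : ℂ)‖ ^ 2) * ‖c (k - l) t‖ := by
          gcongr; exact hj2 _
      _ = _ := by simp; ring
  have hprod := memLp_mul_of_summable hd hHX hds
  obtain ⟨hT1, hT1c⟩ := hilbert_spec (summable_coeff_sq hprod)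
  have t₁ := d₁.hasSum_pairing hXs (hT1.const_mul 2) hw fun k => by
    rw [coeff_const_mul, hT1c]
    have := ((hasSum_coeff_mul' hd hHX k).mul_left (-Complex.I * (Int.sign k : ℂ))).mul_left
      ((2 : ℝ) : ℂ)
    refine (congrArg (HasSum · _) (funext fun l => ?_)).mp this
    rw [nd, hHXc]
    simp only [hK₁]
    push_cast
    linear_combination (-2 * (Int.sign k : ℂ) * Int.sign l * Int.sign (k - l) * (k - l) *
      c (k - l) t * coeff X l) * hI
  set K₂ : ℤ → ℤ → ℂ := fun k l => (k - l : ℤ) ^ 2 * (sg (k - l) ^ 2 - sg k * sg (k - l)) *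
    (sg l / l) * c (k - l) t with hK₂
  have d₂ : Dominated K₂ := dom _ 2 fun k l => by
    simp only [hK₂, hmj]
    rw [norm_mul, norm_mul, norm_mul, norm_pow]
    have h1 := norm_sign_le k
    have h3 := norm_sign_le (k - l)
    have h4 : ‖((Int.sign l : ℤ) : ℂ) / l‖ ≤ 1 := by
      rw [norm_div]; exact div_le_one_of_le₀ (hj1 l) (norm_nonneg _)
    have h5 : ‖((Int.sign (k - l) : ℤ) : ℂ) ^ 2 - (Int.sign k : ℤ) * (Int.sign (k - l) : ℤ)‖ ≤ 2 := by
      refine (norm_sub_le _ _).trans ?_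
      rw [norm_mul, norm_pow]
      calc _ ≤ (1 : ℝ) ^ 2 + 1 * 1 := by gcongr
        _ = 2 := by norm_num
    calc _ ≤ ‖((k - l : ℤ) : ℂ)‖ ^ 2 * 2 * 1 * ‖c (k - l) t‖ := by gcongr
      _ = _ := by ring
  have hp1 : MemLp (fun x => hilbert f x * hilbert h'' x) 2 volume := by
    simpa only [mul_comm] using memLp_mul_of_summable hHdd hHf hHdds
  have hp2 : MemLp (fun x => hilbert f x * h'' x) 2 volume := by
    simpa only [mul_comm] using memLp_mul_of_summable hdd hHf hdds
  obtain ⟨hT2, hT2c⟩ := hilbert_spec (summable_coeff_sq hp2)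
  have hcomm2 : MemLp (comm (hilbert f) h'') 2 volume := hp1.sub hT2
  have t₂ := d₂.hasSum_pairing hXs (hcomm2.const_mul (-1)) hw fun k => by
    have e : coeff (comm (hilbert f) h'') k = _ := coeff_sub hp1 hT2 k
    rw [coeff_const_mul, e, hT2c]
    have s1 := hasSum_coeff_mul' hHdd hHf k
    have s2 := (hasSum_coeff_mul' hdd hHf k).mul_left (-Complex.I * (Int.sign k : ℂ))
    have := (s1.sub s2).mul_left ((-1 : ℝ) : ℂ)
    simp only [mul_comm (hilbert f _)]
    refine (congrArg (HasSum · _) (funext fun l => ?_)).mp this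
    rw [nHdd, ndd, hfX]
    simp only [hK₂]
    push_cast
    linear_combination ((Int.sign l : ℂ) / l) * ((k : ℂ) - l) ^ 2 * coeff X l * c (k - l) t *
      Int.sign (k - l) * (Int.sign (k - l) - Int.sign k) * hI
  have hprodw1 : MemLp (fun x => h x * hilbert w x) 2 volume := memLp_mul_of_summable hh hHw hhs
  have hprodw2 : MemLp (fun x => h x * w x) 2 volume := memLp_mul_of_summable hh hw hhs
  obtain ⟨hT3, hT3c⟩ := hilbert_spec (summable_coeff_sq hprodw2)
  have hcomm3 : MemLp (comm h w) 2 volume := hprodw1.sub hT3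
  set L : ℤ → ℤ → ℂ := fun l k => (l : ℂ) * ((sg l - sg k) * sg (l - k) * c (l - k) t) with hL
  have dL : Dominated L := dom _ 2 fun l k => by
    simp only [hL, hmj]
    rw [norm_mul, norm_mul, norm_mul, Complex.norm_intCast]
    have h1 := norm_sign_sub_le k l
    have h3 := norm_sign_le (l - k)
    have h5 : |((k - l : ℤ) : ℝ)| = ‖((l - k : ℤ) : ℂ)‖ := by
      rw [Complex.norm_intCast, ← Int.cast_abs, ← Int.cast_abs, abs_sub_comm]
    rw [h5] at h1
    calc _ = (|(l : ℝ)| * ‖((Int.sign l : ℤ) : ℂ) - (Int.sign k : ℤ)‖) *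
          ‖((Int.sign (l - k) : ℤ) : ℂ)‖ * ‖c (l - k) t‖ := by ring
      _ ≤ (2 * ‖((l - k : ℤ) : ℂ)‖ ^ 2) * 1 * ‖c (l - k) t‖ := by
          gcongr ?_ * ?_ * _
          exact h1.trans (by gcongr; exact hj2 _)
      _ = _ := by ring
  have hLs : ∀ l : ℤ, HasSum (fun k => L l k * coeff w k) ((l : ℂ) * coeff (comm h w) l) :=
    fun l => by
    have e : coeff (comm h w) l = _ := coeff_sub hprodw1 hT3 l
    rw [e, hT3c]
    have s1 := hasSum_coeff_mul' hh hHw l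
    have s2 := (hasSum_coeff_mul' hh hw l).mul_left (-Complex.I * (Int.sign l : ℂ))
    have := (s1.sub s2).mul_left (l : ℂ)
    refine (congrArg (HasSum · _) (funext fun k => ?_)).mp this
    rw [nh, hHwc]
    simp only [hL]
    linear_combination (l : ℂ) * (Int.sign (l - k) : ℂ) * c (l - k) t * coeff w k *
      ((Int.sign k : ℂ) - Int.sign l) * Complex.I_sq
  obtain ⟨hdcm, hdcmc⟩ := dx_spec (dL.summable_sq hws hLs)
  have dL' : Dominated fun l k => Complex.I * L l k := by
    obtain ⟨m', h1, h2⟩ := dL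
    exact ⟨m', h1, fun l k => by rw [norm_mul, Complex.norm_I, one_mul]; exact h2 l k⟩
  have t₃ := dL'.hasSum_pairing hws hdcm hHX fun l => by
    rw [hdcmc, mul_assoc]
    refine (congrArg (HasSum · _) (funext fun k => ?_)).mp ((hLs l).mul_left Complex.I)
    ring
  have t₃' := (Complex.hasSum_conj'.2 t₃)
  rw [← (Equiv.prodComm ℤ ℤ).hasSum_iff] at t₃'
  have hcconj : ∀ j, starRingEnd ℂ (c j t) = c (-j) t := fun j => by
    rw [hc, hc, coeff_neg, map_div₀, map_mul, Complex.conj_ofReal, map_ofNat]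
  -- the sum of the four contributions
  have total := (t₀.add t₁).add (t₂.add t₃')
  refine (congrArg₂ HasSum (funext fun kl => ?_) ?_).mp total
  · obtain ⟨k, l⟩ := kl
    rcases eq_or_ne k 0 with rfl | hk
    · simp [hw0, hL]
    rcases eq_or_ne l 0 with rfl | hl
    · simp [hXf, hL]
    have hs : ((Int.sign (l - k) : ℤ) : ℂ) = -Int.sign (k - l) := by
      rw [← neg_sub k l, Int.sign_neg]; push_cast; rfl
    have hkl : starRingEnd ℂ (c (l - k) t) = c (k - l) t := by rw [hcconj, neg_sub]
    rw [ModeCoeffs.bKer_eq, lam_eq_sign hk hl]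
    simp only [Function.comp_apply, Equiv.prodComm_apply, Prod.swap, map_mul, map_sub,
      Complex.conj_conj, Complex.conj_I, map_intCast, hL, hK₀, hK₁, hK₂, hkl, hs, hHXc]
    linear_combination ((l : ℂ) * (Int.sign l - Int.sign k) * (-Int.sign (k - l)) * c (k - l) t *
      starRingEnd ℂ (coeff w k) * Int.sign l * coeff X l) * Complex.I_sq
  · rw [Complex.conj_ofReal]
    rw [← Complex.ofReal_add, ← Complex.ofReal_add, ← Complex.ofReal_add]
    congr 1
    have e0 : ∫ x, μ * (X x * w x) = ∫ x, μ * X x * w x := by simp only [mul_assoc]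
    have e2 : ∫ x, -1 * comm (hilbert f) h'' x * w x = -∫ x, comm (hilbert f) h'' x * w x := by
      rw [← integral_neg]; congr 1; funext x; ring
    have e3 : ∫ x, dx (comm h w) x * hilbert X x = ∫ x, hilbert X x * dx (comm h w) x := by
      simp only [mul_comm]
    rw [e0, e2, e3]
    ring

end

/-! ### Fourier coefficients of functions of time and space -/

/-- The Fourier coefficients in `x` of a complex function of `(t, x)`. -/
def cmodes (G : ℝ × Torus → ℂ) (k : ℤ) (t : ℝ) : ℂ := ccoeff (fun x => G (t, x)) k

theorem lintegral_enorm_sq_eq {α : Type*} [MeasurableSpace α] {ν : Measure α} {f : α → ℂ}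
    (hf : MemLp f 2 ν) : ∫⁻ x, ‖f x‖ₑ ^ 2 ∂ν = ENNReal.ofReal (∫ x, ‖f x‖ ^ 2 ∂ν) := by
  rw [ofReal_integral_eq_lintegral_ofReal (hf.integrable_norm_pow (by norm_num))
    (Eventually.of_forall fun t => by positivity)]
  refine lintegral_congr fun t => ?_
  rw [ENNReal.ofReal_pow (norm_nonneg _), ofReal_norm]

theorem tsum_enorm_ccoeff_sq {f : Torus → ℂ} (hf : MemLp f 2 volume) :
    ∑' k, ‖ccoeff f k‖ₑ ^ 2 = ENNReal.ofReal (2 * Real.pi) * ∫⁻ x, ‖f x‖ₑ ^ 2 := by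
  have h := hasSum_ccoeff_sq hf
  rw [lintegral_enorm_sq_eq hf, ← ENNReal.ofReal_mul Real.two_pi_pos.le, ← h.tsum_eq,
    ENNReal.ofReal_tsum_of_nonneg (fun k => by positivity) h.summable]
  refine tsum_congr fun k => ?_
  rw [ENNReal.ofReal_pow (norm_nonneg _), ofReal_norm]

section

variable {G G' : ℝ × Torus → ℂ}

theorem ae_memLp_slice (hG : MemLp G 2 volume) : ∀ᵐ t, MemLp (fun x => G (t, x)) 2 volume := by
  obtain ⟨hm, hf⟩ := memLp_two_iff.1 hG
  rw [Measure.volume_eq_prod] at hm hf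
  rw [lintegral_prod _ (hm.enorm.pow_const 2)] at hf
  filter_upwards [hm.prodMk_left, ae_lt_top' (hm.enorm.pow_const 2).lintegral_prod_right' hf]
    with t h1 h2
  exact memLp_two_iff.2 ⟨h1, h2.ne⟩

theorem aestronglyMeasurable_cmodes (hG : AEStronglyMeasurable G volume) (k : ℤ) :
    AEStronglyMeasurable (cmodes G k) volume := by
  have : AEStronglyMeasurable (fun p : ℝ × Torus => G p * fourier (-k) p.2)
      (volume.prod volume) :=
    hG.mul ((fourier (-k)).continuous.comp continuous_snd).aestronglyMeasurable
  exact this.integral_prod_right'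

theorem tsum_lintegral_cmodes (hG : MemLp G 2 volume) :
    ∑' k, ∫⁻ t, ‖cmodes G k t‖ₑ ^ 2 =
      ENNReal.ofReal (2 * Real.pi) * ENNReal.ofReal (∫ p, ‖G p‖ ^ 2) := by
  have hm := hG.1
  rw [Measure.volume_eq_prod] at hm
  rw [← lintegral_tsum fun k => (aestronglyMeasurable_cmodes hG.1 k).enorm.pow_const 2]
  rw [← lintegral_enorm_sq_eq hG, Measure.volume_eq_prod, lintegral_prod _ (hm.enorm.pow_const 2),
    ← lintegral_const_mul' _ _ ENNReal.ofReal_ne_top]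
  refine lintegral_congr_ae ?_
  filter_upwards [ae_memLp_slice hG] with t ht
  exact tsum_enorm_ccoeff_sq ht

theorem l2Modes_cmodes (hG : MemLp G 2 volume) : L2Modes (cmodes G) :=
  ⟨aestronglyMeasurable_cmodes hG.1, by
    rw [tsum_lintegral_cmodes hG]; exact ENNReal.mul_ne_top ENNReal.ofReal_ne_top ENNReal.ofReal_ne_top⟩

theorem modeSq_cmodes (hG : MemLp G 2 volume) :
    modeSq (cmodes G) = 2 * Real.pi * ∫ p, ‖G p‖ ^ 2 := by
  rw [modeSq, tsum_lintegral_cmodes hG, ENNReal.toReal_mul, ENNReal.toReal_ofReal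
    Real.two_pi_pos.le, ENNReal.toReal_ofReal (integral_nonneg fun p => by positivity)]

theorem cmodes_congr (h : G =ᵐ[volume] G') (k : ℤ) : cmodes G k =ᵐ[volume] cmodes G' k := by
  rw [Measure.volume_eq_prod] at h
  filter_upwards [Measure.ae_ae_of_ae_prod h] with t ht
  exact congrFun (ccoeff_congr ht) k

theorem cmodes_add (hG : MemLp G 2 volume) (hG' : MemLp G' 2 volume) (k : ℤ) :
    cmodes (G + G') k =ᵐ[volume] fun t => cmodes G k t + cmodes G' k t := by
  filter_upwards [ae_memLp_slice hG, ae_memLp_slice hG'] with t h1 h2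
  exact ccoeff_add (h1.integrable (by norm_num)) (h2.integrable (by norm_num)) k

theorem cmodes_const_mul (c : ℂ) (G : ℝ × Torus → ℂ) (k : ℤ) (t : ℝ) :
    cmodes (fun p => c * G p) k t = c * cmodes G k t := ccoeff_const_mul c _ k

end

/-- The space of square integrable functions of time and space. -/
abbrev SpaceTime : Type := Lp ℂ 2 (volume : Measure (ℝ × Torus))

/-- Passage to the Fourier coefficients, as a bounded operator. -/
def analysisOp : SpaceTime →L[ℂ] ModeSpace :=
  LinearMap.mkContinuous
    { toFun := fun G => (l2Modes_cmodes (Lp.memLp G)).toSpace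
      map_add' := fun G G' => by
        rw [← L2Modes.toSpace_add]
        refine L2Modes.toSpace_congr _ ((l2Modes_cmodes (Lp.memLp G)).add
          (l2Modes_cmodes (Lp.memLp G'))) fun k => ?_
        exact (cmodes_congr (Lp.coeFn_add G G') k).trans
          (cmodes_add (Lp.memLp G) (Lp.memLp G') k)
      map_smul' := fun c G => by
        rw [RingHom.id_apply, ← L2Modes.toSpace_const_mul]
        refine L2Modes.toSpace_congr _ ((l2Modes_cmodes (Lp.memLp G)).const_mul c) fun k => ?_
        exact (cmodes_congr (Lp.coeFn_smul c G) k).trans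
          (Eventually.of_forall fun t => cmodes_const_mul c G k t) }
    (Real.sqrt (2 * Real.pi)) fun G => by
      have h1 : ‖(l2Modes_cmodes (Lp.memLp G)).toSpace‖ ^ 2 = 2 * Real.pi * ‖G‖ ^ 2 := by
        rw [L2Modes.norm_toSpace_sq, modeSq_cmodes (Lp.memLp G)]
        congr 1
        have h2 := inner_self_eq_norm_sq_to_K (𝕜 := ℂ) G
        rw [L2.inner_def] at h2
        have h3 : ∫ p, inner ℂ (G p) (G p) = ((∫ p, ‖G p‖ ^ 2 : ℝ) : ℂ) := by
          rw [← integral_complex_ofReal]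
          congr 1; funext p
          rw [inner_self_eq_norm_sq_to_K]; norm_cast
        rw [h3] at h2
        apply Complex.ofReal_injective
        rw [h2, Complex.ofReal_pow]; rfl
      refine le_of_sq_le_sq ?_ (by positivity)
      rw [mul_pow, Real.sq_sqrt Real.two_pi_pos.le]
      exact h1.le

theorem memLp_tensor {h : ℝ → ℂ} (hh : MemLp h 2 volume) (k : ℤ) :
    MemLp (fun p : ℝ × Torus => h p.1 * fourier k p.2) 2 volume := by
  have h1 : MemLp (fun p : ℝ × Torus => h p.1) 2 (volume.prod volume) := hh.comp_fst _
  refine h1.of_le (h1.1.mul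
    ((fourier k).continuous.comp continuous_snd).aestronglyMeasurable)
    (Eventually.of_forall fun p => ?_)
  rw [norm_mul, fourier_apply, Circle.norm_coe, mul_one]

theorem ccoeff_fourier (j k : ℤ) :
    ccoeff (fun x => fourier j x) k = if k = j then (2 * Real.pi : ℂ) else 0 := by
  rw [ccoeff_eq, fourierCoeff_fourier]
  by_cases h : k = j
  · simp [h]
  · simp [h]

theorem cmodes_tensor (h : ℝ → ℂ) (j k : ℤ) (t : ℝ) :
    cmodes (fun p : ℝ × Torus => h p.1 * fourier j p.2) k t =
      if k = j then 2 * Real.pi * h t else 0 := by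
  refine (ccoeff_const_mul (h t) (fun x => fourier j x) k).trans ?_
  rw [ccoeff_fourier]
  split_ifs <;> ring

/-- Every square summable family is the family of Fourier coefficients of a square integrable
function, which is found with the adjoint of the passage to Fourier coefficients. -/
theorem exists_cmodes_eq {x : ℤ → ℝ → ℂ} (hx : L2Modes x) :
    ∃ G : ℝ × Torus → ℂ, MemLp G 2 volume ∧ ∀ k, cmodes G k =ᵐ[volume] x k := by
  have hπ : (Real.pi : ℂ) ≠ 0 := by exact_mod_cast Real.pi_ne_zero
  set S : SpaceTime := ContinuousLinearMap.adjoint analysisOp hx.toSpace with hS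
  have hSm := Lp.memLp S
  have hSl := l2Modes_cmodes hSm
  refine ⟨fun p => (2 * Real.pi : ℂ)⁻¹ * S p, hSm.const_mul _, fun k => ?_⟩
  have key : ∀ h : ℝ → ℂ, MemLp h 2 volume →
      ∫ t, h t * starRingEnd ℂ (cmodes S k t - 2 * Real.pi * x k t) = 0 := fun h hh => by
    have hT := memLp_tensor hh k
    have h1 : inner ℂ S (hT.toLp _) = inner ℂ hx.toSpace (analysisOp (hT.toLp _)) :=
      ContinuousLinearMap.adjoint_inner_left _ _ _
    have hsing := L2Modes.single (hh.const_mul (2 * Real.pi : ℂ)) k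
    have h2 : analysisOp (hT.toLp _) = hsing.toSpace := by
      refine L2Modes.toSpace_congr (l2Modes_cmodes (Lp.memLp _)) hsing fun j => ?_
      refine (cmodes_congr hT.coeFn_toLp j).trans (Eventually.of_forall fun t => ?_)
      rw [cmodes_tensor]
      rcases eq_or_ne j k with rfl | hjk
      · simp
      · simp [hjk]
    rw [h2, L2Modes.inner_single_right, L2.inner_def] at h1
    have h3 : ∫ p, inner ℂ (S p) ((hT.toLp _ : ℝ × Torus → ℂ) p) =
        ∫ t, h t * starRingEnd ℂ (cmodes S k t) := by
      have e : ∫ p, inner ℂ (S p) ((hT.toLp _ : ℝ × Torus → ℂ) p) =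
          ∫ p : ℝ × Torus, (h p.1 * fourier k p.2) * starRingEnd ℂ (S p) := by
        refine integral_congr_ae ?_
        filter_upwards [hT.coeFn_toLp] with p hp
        rw [hp, RCLike.inner_apply]
      have hSc : MemLp (fun p => starRingEnd ℂ (S p)) 2 volume :=
        hSm.of_le (Complex.continuous_conj.comp_aestronglyMeasurable hSm.1) (by simp)
      have hint : Integrable (fun p : ℝ × Torus => (h p.1 * fourier k p.2) * starRingEnd ℂ (S p))
          (volume.prod volume) := hT.integrable_mul hSc
      refine e.trans ((integral_prod _ hint).trans ?_)
      congr 1; funext t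
      rw [cmodes, ccoeff, ← integral_conj, ← integral_const_mul]
      congr 1; funext x
      rw [map_mul, ← fourier_neg, neg_neg]; ring
    rw [h3] at h1
    have i1 : Integrable (fun t => h t * starRingEnd ℂ (cmodes S k t)) volume :=
      hh.integrable_mul (hSl.conj.memLp k)
    have i2 : Integrable (fun t => h t * starRingEnd ℂ (2 * Real.pi * x k t)) volume :=
      hh.integrable_mul ((hx.const_mul (2 * Real.pi : ℂ)).conj.memLp k)
    simp only [map_sub, mul_sub]
    rw [integral_sub i1 i2, h1, sub_eq_zero]
    congr 1; funext t
    simp only [map_mul, Complex.conj_ofReal, map_ofNat]; ring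
  have hd : MemLp (fun t => cmodes S k t - 2 * Real.pi * x k t) 2 volume :=
    (hSl.sub (hx.const_mul (2 * Real.pi : ℂ))).memLp k
  have h0 := key _ hd
  have h3 : ∫ t, ‖cmodes S k t - 2 * Real.pi * x k t‖ ^ 2 = 0 := by
    apply Complex.ofReal_injective
    rw [← integral_complex_ofReal, Complex.ofReal_zero, ← h0]
    congr 1; funext t
    rw [Complex.mul_conj, Complex.normSq_eq_norm_sq]
  rw [integral_eq_zero_iff_of_nonneg (fun t => by positivity)
    (hd.integrable_norm_pow (by norm_num))] at h3
  filter_upwards [h3] with t ht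
  rw [cmodes_const_mul]
  have : cmodes S k t = 2 * Real.pi * x k t := by
    rw [← sub_eq_zero]; simpa using ht
  rw [this]
  field_simp

/-- The Fourier coefficients in `x` of a real function of `(t, x)`. -/
def modes (f : ℝ → Torus → ℝ) (k : ℤ) (t : ℝ) : ℂ := coeff (f t) k

theorem exists_modes_eq {x : ℤ → ℝ → ℂ} (hx : L2Modes x)
    (hconj : ∀ k, ∀ᵐ t, x (-k) t = starRingEnd ℂ (x k t)) :
    ∃ f : ℝ → Torus → ℝ, MemLp (fun p : ℝ × Torus => f p.1 p.2) 2 volume ∧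
      ∀ k, modes f k =ᵐ[volume] x k := by
  obtain ⟨G, hG, hGx⟩ := exists_cmodes_eq hx
  refine ⟨fun t x => (G (t, x)).re, hG.re, fun k => ?_⟩
  filter_upwards [ae_memLp_slice hG, hGx k, hGx (-k), hconj k] with t h1 h2 h3 h4
  have hi := h1.integrable (by norm_num)
  have hc : Integrable (fun x => starRingEnd ℂ (G (t, x))) volume :=
    hi.congr' (Complex.continuous_conj.comp_aestronglyMeasurable hi.1) (by simp)
  have e : (fun x => (((G (t, x)).re : ℝ) : ℂ)) =
      fun x => (1 / 2 : ℂ) * (G (t, x) + starRingEnd ℂ (G (t, x))) := by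
    funext x; rw [Complex.add_conj]; push_cast; ring
  have h3' : ccoeff (fun x => G (t, x)) (-k) = x (-k) t := h3
  have h2' : ccoeff (fun x => G (t, x)) k = x k t := h2
  rw [modes, coeff_eq_ccoeff, e, ccoeff_const_mul, ccoeff_add hi hc, ccoeff_conj, h2', h3', h4,
    Complex.conj_conj]
  ring

/-! ### Weighted spaces -/

section

variable {γ : ℝ} {f : ℝ → Torus → ℝ}

theorem MemL2w.memLp_slice (hf : MemL2w γ f) : ∀ᵐ t, MemLp (f t) 2 volume := by
  filter_upwards [ae_memLp_slice (memLp_ofReal hf)] with t ht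
  have h1 := ht.re.const_mul (Real.exp (γ * t))
  refine (congrArg (MemLp · 2 volume) (funext fun x => ?_)).mp h1
  simp only [RCLike.re_to_complex, Complex.ofReal_re]
  rw [← mul_assoc, ← Real.exp_add]; simp

theorem modes_weight (γ : ℝ) (f : ℝ → Torus → ℝ) (k : ℤ) (t : ℝ) :
    cmodes (fun p => ((Real.exp (-γ * p.1) * f p.1 p.2 : ℝ) : ℂ)) k t =
      (Real.exp (-γ * t) : ℂ) * modes f k t :=
  coeff_const_mul (Real.exp (-γ * t)) (f t) k

theorem MemL2w.l2Modes (hf : MemL2w γ f) :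
    L2Modes fun k t => (Real.exp (-γ * t) : ℂ) * modes f k t := by
  have := l2Modes_cmodes (memLp_ofReal hf)
  simpa only [modes_weight] using this.congr fun k => Eventually.of_forall fun t =>
    modes_weight γ f k t

theorem MemL2w.modeSq_eq (hf : MemL2w γ f) :
    modeSq (fun k t => (Real.exp (-γ * t) : ℂ) * modes f k t) = 2 * Real.pi * normSqL2w γ f := by
  rw [modeSq_congr fun k => Eventually.of_forall fun t => (modes_weight γ f k t).symm,
    modeSq_cmodes (memLp_ofReal hf), normSqL2w]
  simp only [Complex.norm_real, Real.norm_eq_abs, sq_abs]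

/-- Every weighted square summable family with the symmetry of the coefficients of a real function
is the family of Fourier coefficients of a function in the weighted space. -/
theorem exists_memL2w {x : ℤ → ℝ → ℂ} (hx : L2Modes fun k t => (Real.exp (-γ * t) : ℂ) * x k t)
    (hconj : ∀ k, ∀ᵐ t, x (-k) t = starRingEnd ℂ (x k t)) :
    ∃ f : ℝ → Torus → ℝ, MemL2w γ f ∧ ∀ k, modes f k =ᵐ[volume] x k := by
  obtain ⟨F, hF, hFx⟩ := exists_modes_eq hx fun k => by
    filter_upwards [hconj k] with t ht
    rw [ht, map_mul, Complex.conj_ofReal]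
  refine ⟨fun t y => Real.exp (γ * t) * F t y, ?_, fun k => ?_⟩
  · unfold MemL2w
    refine (congrArg (MemLp · 2 volume) (funext fun p => ?_)).mp hF
    rw [← mul_assoc, ← Real.exp_add]; simp
  · filter_upwards [hFx k] with t ht
    have h1 : coeff (F t) k = (Real.exp (-γ * t) : ℂ) * x k t := ht
    rw [modes, coeff_const_mul, h1, ← mul_assoc, ← Complex.ofReal_mul, ← Real.exp_add]
    simp

end

/-! ### Test functions on `ℝ × 𝕋` -/

namespace IsTest

variable {ψ : ℝ → Torus → ℝ}

theorem isOpenQuotientMap_lift :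
    IsOpenQuotientMap (fun p : ℝ × ℝ => ((p.1, (p.2 : Torus)) : ℝ × Torus)) :=
  IsOpenQuotientMap.prodMap .id QuotientAddGroup.isOpenQuotientMap_mk

theorem continuous (h : IsTest ψ) : Continuous fun p : ℝ × Torus => ψ p.1 p.2 :=
  isOpenQuotientMap_lift.isQuotientMap.continuous_iff.2 h.smooth.continuous

theorem hasCompactSupport (h : IsTest ψ) :
    HasCompactSupport fun p : ℝ × Torus => ψ p.1 p.2 := by
  obtain ⟨R, hR⟩ := h.compact
  refine HasCompactSupport.of_support_subset_isCompact
    (K := Icc (-R) R ×ˢ univ) (isCompact_Icc.prod isCompact_univ) fun p hp => ?_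
  refine ⟨?_, mem_univ _⟩
  by_contra hp'
  refine hp (hR p.1 p.2 ?_)
  by_contra! hle
  exact hp' (abs_le.1 hle)

theorem memL2w (h : IsTest ψ) (γ : ℝ) : MemL2w γ ψ := by
  refine Continuous.memLp_of_hasCompactSupport ?_ ?_
  · have := h.continuous
    fun_prop
  · exact h.hasCompactSupport.mul_left

theorem exists_bound (h : IsTest ψ) : ∃ C, ∀ t x, |ψ t x| ≤ C := by
  obtain ⟨C, hC⟩ := h.hasCompactSupport.exists_bound_of_continuous h.continuous
  exact ⟨C, fun t x => hC (t, x)⟩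

theorem continuous_slice (h : IsTest ψ) (t : ℝ) : Continuous (ψ t) :=
  h.continuous.comp (by fun_prop : Continuous fun x : Torus => (t, x))

theorem memLp_slice (h : IsTest ψ) (t : ℝ) : MemLp (ψ t) 2 volume :=
  (h.continuous_slice t).memLp_of_hasCompactSupport (HasCompactSupport.of_compactSpace _)

theorem hasFDerivAt_lift (h : IsTest ψ) (p : ℝ × ℝ) :
    HasFDerivAt (fun p : ℝ × ℝ => ψ p.1 (p.2 : Torus))
      (fderiv ℝ (fun p : ℝ × ℝ => ψ p.1 (p.2 : Torus)) p) p :=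
  (h.smooth.differentiable (by simp) p).hasFDerivAt

theorem hasDerivAt_lift_left (h : IsTest ψ) (t y : ℝ) :
    HasDerivAt (fun s : ℝ => ψ s (y : Torus))
      (fderiv ℝ (fun p : ℝ × ℝ => ψ p.1 (p.2 : Torus)) (t, y) (1, 0)) t := by
  have h1 : HasDerivAt (fun s : ℝ => (s, y)) ((1 : ℝ), (0 : ℝ)) t :=
    (hasDerivAt_id t).prodMk (hasDerivAt_const t y)
  exact (h.hasFDerivAt_lift (t, y)).comp_hasDerivAt t h1

theorem hasDerivAt_lift_right (h : IsTest ψ) (t y : ℝ) :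
    HasDerivAt (fun z : ℝ => ψ t (z : Torus))
      (fderiv ℝ (fun p : ℝ × ℝ => ψ p.1 (p.2 : Torus)) (t, y) (0, 1)) y := by
  have h1 : HasDerivAt (fun z : ℝ => (t, z)) ((0 : ℝ), (1 : ℝ)) y :=
    (hasDerivAt_const y t).prodMk (hasDerivAt_id y)
  exact (h.hasFDerivAt_lift (t, y)).comp_hasDerivAt y h1

theorem testDt_lift (h : IsTest ψ) (t y : ℝ) : testDt ψ t (y : Torus) =
    fderiv ℝ (fun p : ℝ × ℝ => ψ p.1 (p.2 : Torus)) (t, y) (1, 0) :=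
  (h.hasDerivAt_lift_left t y).deriv

theorem testDx_lift (h : IsTest ψ) (t y : ℝ) : testDx ψ t (y : Torus) =
    fderiv ℝ (fun p : ℝ × ℝ => ψ p.1 (p.2 : Torus)) (t, y) (0, 1) := by
  have h1 : HasDerivAt (fun z : ℝ => y + z) 1 0 := (hasDerivAt_id (0 : ℝ)).const_add y
  have h3 := h.hasDerivAt_lift_right t y
  rw [← add_zero y] at h3
  have h2 := h3.comp 0 h1
  rw [mul_one, add_zero] at h2
  refine Eq.trans ?_ h2.deriv
  rfl

theorem hasDerivAt_time (h : IsTest ψ) (t : ℝ) (x : Torus) :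
    HasDerivAt (fun s => ψ s x) (testDt ψ t x) t := by
  induction x using QuotientAddGroup.induction_on with
  | _ y => exact (h.hasDerivAt_lift_left t y).differentiableAt.hasDerivAt

theorem hasDerivAt_space (h : IsTest ψ) (t y : ℝ) :
    HasDerivAt (fun z : ℝ => ψ t (z : Torus)) (testDx ψ t (y : Torus)) y := by
  rw [h.testDx_lift]; exact h.hasDerivAt_lift_right t y

theorem testDt (h : IsTest ψ) : IsTest (testDt ψ) where
  smooth := by
    have h1 : ContDiff ℝ ∞ (fderiv ℝ fun p : ℝ × ℝ => ψ p.1 (p.2 : Torus)) :=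
      h.smooth.fderiv_right (by simp)
    refine (congrArg (ContDiff ℝ ∞) (funext fun p => ?_)).mp
      (h1.clm_apply (contDiff_const (c := ((1 : ℝ), (0 : ℝ)))))
    exact (h.testDt_lift p.1 p.2).symm
  compact := by
    obtain ⟨R, hR⟩ := h.compact
    refine ⟨R, fun t x ht => ?_⟩
    have : (fun s => ψ s x) =ᶠ[𝓝 t] fun _ => 0 :=
      Filter.mem_of_superset ((isOpen_lt continuous_const continuous_abs).mem_nhds ht)
        fun s hs => hR s x hs
    rw [CurrentVortexSheet.testDt, this.deriv_eq, deriv_const]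

theorem testDx (h : IsTest ψ) : IsTest (testDx ψ) where
  smooth := by
    have h1 : ContDiff ℝ ∞ (fderiv ℝ fun p : ℝ × ℝ => ψ p.1 (p.2 : Torus)) :=
      h.smooth.fderiv_right (by simp)
    refine (congrArg (ContDiff ℝ ∞) (funext fun p => ?_)).mp
      (h1.clm_apply (contDiff_const (c := ((0 : ℝ), (1 : ℝ)))))
    exact (h.testDx_lift p.1 p.2).symm
  compact := by
    obtain ⟨R, hR⟩ := h.compact
    refine ⟨R, fun t x ht => ?_⟩
    simp [CurrentVortexSheet.testDx, hR t _ ht]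

theorem l2Modes (h : IsTest ψ) (γ : ℝ) :
    L2Modes fun k t => (Real.exp (γ * t) : ℂ) * modes ψ k t := by
  simpa using (h.memL2w (-γ)).l2Modes

theorem hasDerivAt_modes (h : IsTest ψ) (k : ℤ) (t : ℝ) :
    HasDerivAt (modes ψ k) (modes (CurrentVortexSheet.testDt ψ) k t) t := by
  obtain ⟨C, hC⟩ := h.testDt.exists_bound
  have hm : ∀ {χ : ℝ → Torus → ℝ}, IsTest χ → ∀ s, Continuous
      (fun x => (χ s x : ℂ) * fourier (-k) x) := fun hχ s =>
    (Complex.continuous_ofReal.comp (hχ.continuous_slice s)).mul (fourier (-k)).continuous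
  refine (hasDerivAt_integral_of_dominated_loc_of_deriv_le (μ := volume) (s := univ)
    (bound := fun _ => C) (F := fun s x => (ψ s x : ℂ) * fourier (-k) x)
    (F' := fun s x => (CurrentVortexSheet.testDt ψ s x : ℂ) * fourier (-k) x) univ_mem
    (Eventually.of_forall fun s => (hm h s).aestronglyMeasurable)
    ((hm h t).integrable_of_hasCompactSupport (HasCompactSupport.of_compactSpace _))
    (hm h.testDt t).aestronglyMeasurable (Eventually.of_forall fun x s _ => ?_)
    (integrable_const C) (Eventually.of_forall fun x s _ => ?_)).2
  · rw [norm_mul, fourier_apply, Circle.norm_coe, mul_one, Complex.norm_real]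
    exact hC s x
  · exact ((h.hasDerivAt_time s x).ofReal_comp).mul_const _

theorem isPrim_modes (h : IsTest ψ) (k : ℤ) :
    IsPrim (modes ψ k) (modes (CurrentVortexSheet.testDt ψ) k) :=
  .of_hasDerivAt (h.hasDerivAt_modes k)
    (continuous_iff_continuousAt.2 fun t => (h.testDt.hasDerivAt_modes k t).continuousAt)

theorem modes_testDx (h : IsTest ψ) (k : ℤ) (t : ℝ) :
    modes (CurrentVortexSheet.testDx ψ) k t = Complex.I * k * modes ψ k t := by
  have hπ : (Real.pi : ℂ) ≠ 0 := by exact_mod_cast Real.pi_ne_zero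
  have hd : ∀ y : ℝ, HasDerivAt (fun z : ℝ => (ψ t (z : Torus) : ℂ) * fourier (-k) (z : Torus))
      ((CurrentVortexSheet.testDx ψ t (y : Torus) : ℂ) * fourier (-k) (y : Torus) -
        Complex.I * k * ((ψ t (y : Torus) : ℂ) * fourier (-k) (y : Torus))) y := fun y => by
    refine (((h.hasDerivAt_space t y).ofReal_comp).mul
      (hasDerivAt_fourier_neg (2 * Real.pi) k y)).congr_deriv ?_
    push_cast
    field_simp
    ring
  have hc : ∀ {χ : ℝ → Torus → ℝ}, IsTest χ → Continuous
      (fun y : ℝ => (χ t (y : Torus) : ℂ) * fourier (-k) (y : Torus)) := fun hχ =>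
    ((Complex.continuous_ofReal.comp (hχ.continuous_slice t)).mul (fourier (-k)).continuous).comp
      (AddCircle.continuous_mk' _)
  have e : ∀ F : Torus → ℂ, ∫ y in (0 : ℝ)..0 + 2 * Real.pi, F (y : Torus) = ∫ x, F x :=
    fun F => AddCircle.intervalIntegral_preimage (2 * Real.pi) 0 F
  have i1 := (hc h.testDx).intervalIntegrable (μ := volume) 0 (0 + 2 * Real.pi)
  have i2 := ((hc h).const_mul (Complex.I * k)).intervalIntegrable (μ := volume) 0 (0 + 2 * Real.pi)
  have h1 := intervalIntegral.integral_eq_sub_of_hasDerivAt (fun y _ => hd y) (i1.sub i2)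
  rw [intervalIntegral.integral_sub i1 i2, intervalIntegral.integral_const_mul,
    e (fun x => (CurrentVortexSheet.testDx ψ t x : ℂ) * fourier (-k) x),
    e (fun x => (ψ t x : ℂ) * fourier (-k) x)] at h1
  have hp : ((0 + 2 * Real.pi : ℝ) : Torus) = ((0 : ℝ) : Torus) := by
    rw [AddCircle.coe_add, AddCircle.coe_period, add_zero]
  rw [hp, sub_self, sub_eq_zero] at h1
  exact h1

end IsTest

/-- The real part of `z e^{-ikx}`. -/
def wave (z : ℂ) (k : ℤ) (x : Torus) : ℝ := (z * fourier (-k) x).re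

theorem integral_mul_wave {f : Torus → ℝ} (hf : Integrable f volume) (z : ℂ) (k : ℤ) :
    ∫ x, f x * wave z k x = (z * coeff f k).re := by
  have hi := (integrable_mul_fourier hf.ofReal (-k)).const_mul z
  have h1 := integral_re hi
  simp only [RCLike.re_to_complex, integral_const_mul] at h1
  refine Eq.trans ?_ h1
  congr 1; funext x
  rw [wave, mul_left_comm]
  exact (Complex.re_ofReal_mul _ _).symm

theorem hasDerivAt_wave (z : ℂ) (k : ℤ) (y : ℝ) :
    HasDerivAt (fun y : ℝ => wave z k (y : Torus)) (wave (-Complex.I * k * z) k (y : Torus)) y := by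
  have hπ : (Real.pi : ℂ) ≠ 0 := by exact_mod_cast Real.pi_ne_zero
  have h1 := (hasDerivAt_fourier_neg (2 * Real.pi) k y).const_mul z
  have h2 := (Complex.reCLM.hasFDerivAt.comp_hasDerivAt y h1)
  refine h2.congr_deriv ?_
  rw [Complex.reCLM_apply, wave]
  congr 1
  push_cast
  field_simp

theorem contDiff_wave (z : ℂ) (k : ℤ) : ContDiff ℝ ∞ fun y : ℝ => wave z k (y : Torus) := by
  simp only [wave, fourier_coe_apply]
  refine Complex.reCLM.contDiff.comp (contDiff_const.mul ?_)
  refine ContDiff.cexp ?_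
  refine ContDiff.div_const ?_ _
  exact contDiff_const.mul Complex.ofRealCLM.contDiff

theorem isTest_wave {η : ℝ → ℝ} (hη : IsTest1 η) (z : ℂ) (k : ℤ) :
    IsTest fun t x => η t * wave z k x where
  smooth := (hη.contDiff.comp contDiff_fst).mul ((contDiff_wave z k).comp contDiff_snd)
  compact := by
    obtain ⟨R, hR⟩ := hη.compact.isCompact.isBounded.subset_closedBall 0
    refine ⟨R, fun t x ht => ?_⟩
    have : η t = 0 := by
      by_contra h
      have := hR (subset_tsupport η h)
      rw [mem_closedBall_zero_iff, Real.norm_eq_abs] at this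
      linarith
    simp [this]

theorem testDt_wave {η : ℝ → ℝ} (hη : IsTest1 η) (z : ℂ) (k : ℤ) (t : ℝ) (x : Torus) :
    testDt (fun t x => η t * wave z k x) t x = deriv η t * wave z k x :=
  ((hη.hasDerivAt t).mul_const _).deriv

theorem testDx_wave {η : ℝ → ℝ} (hη : IsTest1 η) (z : ℂ) (k : ℤ) (t : ℝ) (x : Torus) :
    testDx (fun t x => η t * wave z k x) t x = η t * wave (-Complex.I * k * z) k x := by
  induction x using QuotientAddGroup.induction_on with
  | _ y =>
    have h1 := (isTest_wave hη z k).hasDerivAt_space t y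
    exact h1.unique ((hasDerivAt_wave z k y).const_mul (η t))

theorem coeff_wave (z : ℂ) (k j : ℤ) : coeff (wave z k) j =
    Real.pi * ((if j = -k then z else 0) + if j = k then starRingEnd ℂ z else 0) := by
  have e : (fun x => ((wave z k x : ℝ) : ℂ)) =
      fun x => (z / 2) * fourier (-k) x + (starRingEnd ℂ z / 2) * fourier k x := by
    funext x
    rw [wave, Complex.re_eq_add_conj, map_mul, ← fourier_neg, neg_neg]
    ring
  have hi : ∀ (c : ℂ) (n : ℤ), Integrable (fun x : Torus => c * fourier n x) volume := fun c n =>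
    (continuous_const.mul (fourier n).continuous).integrable_of_hasCompactSupport
      (HasCompactSupport.of_compactSpace _)
  rw [coeff_eq_ccoeff, e, ccoeff_add (hi _ _) (hi _ _), ccoeff_const_mul, ccoeff_const_mul,
    ccoeff_fourier, ccoeff_fourier]
  split_ifs <;> ring

/-! ### Weak time derivatives in terms of Fourier coefficients -/

/-- The Fourier coefficients of a weak time derivative are the weak derivatives of the Fourier
coefficients. -/
theorem isWeakDeriv_modes {f u : ℝ → Torus → ℝ} (hf : ∀ᵐ t, Integrable (f t) volume)
    (hu : ∀ᵐ t, Integrable (u t) volume) {k : ℤ} (hfl : LocallyIntegrable (modes f k) volume)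
    (hul : LocallyIntegrable (modes u k) volume) (h : IsWeakDt f u) :
    IsWeakDeriv (modes f k) (modes u k) := by
  intro η hη
  have i1 := hη.deriv.integrable_mul hfl
  have i2 := hη.integrable_mul hul
  have re : ∀ {F : ℝ → ℂ}, Integrable F volume → ∀ z : ℂ, ∫ t, (z * F t).re = (z * ∫ t, F t).re :=
    fun hF z => by
      have := integral_re (hF.const_mul z)
      simp only [RCLike.re_to_complex, integral_const_mul] at this
      exact this
  have key : ∀ z : ℂ, (z * ∫ t, modes f k t * ((deriv η t : ℝ) : ℂ)).re =
      (z * -∫ t, modes u k t * (η t : ℂ)).re := fun z => by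
    have h1 := h _ (isTest_wave hη z k)
    have e1 : ∫ t : ℝ, ∫ x, f t x * testDt (fun t x => η t * wave z k x) t x =
        ∫ t, (z * (modes f k t * ((deriv η t : ℝ) : ℂ))).re := by
      refine integral_congr_ae ?_
      filter_upwards [hf] with t ht
      simp only [testDt_wave hη, mul_left_comm _ (deriv η t), integral_const_mul,
        integral_mul_wave ht, modes]
      rw [← Complex.re_ofReal_mul]
      congr 1; ring
    have e2 : ∫ t : ℝ, ∫ x, u t x * (η t * wave z k x) =
        ∫ t, (z * (modes u k t * (η t : ℂ))).re := by
      refine integral_congr_ae ?_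
      filter_upwards [hu] with t ht
      simp only [mul_left_comm _ (η t), integral_const_mul, integral_mul_wave ht, modes]
      rw [← Complex.re_ofReal_mul]
      congr 1; ring
    rw [e1, e2, re i1, re i2] at h1
    rw [h1, mul_neg, Complex.neg_re]
  -- `z = 1` gives the real part and `z = -i` the imaginary part
  have k1 := key 1
  have k2 := key (-Complex.I)
  refine Complex.ext (by simpa using k1) (by simpa using k2)

theorem locallyIntegrable_of_bound {f : ℝ → ℂ} (hf : AEStronglyMeasurable f volume) {C : ℝ}
    (h : ∀ᵐ t, ‖f t‖ ≤ C) : LocallyIntegrable f volume :=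
  (locallyIntegrable_const C).mono hf (h.mono fun t ht => by
    rw [Real.norm_eq_abs]; exact ht.trans (le_abs_self C))

/-! ### The basic state -/

/-- The sum of `1 / j²` over the nonzero integers; the term with `j = 0` is `0`. -/
def zetaSum : ℝ := ∑' j : ℤ, 1 / (j : ℝ) ^ 2

theorem zetaSum_nonneg : 0 ≤ zetaSum := tsum_nonneg fun j => by positivity

/-- A bound for the `ℓ¹` norm of Fourier coefficients in terms of a Sobolev norm `N`. -/
def coeffBound (N : ℝ) : ℝ := zetaSum + 2 * Real.pi * N ^ 2

theorem coeffBound_nonneg (N : ℝ) : 0 ≤ coeffBound N :=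
  add_nonneg zetaSum_nonneg (by positivity)

theorem tsum_sobolev_le {s : ℕ} {f : Torus → ℝ} {N : ℝ≥0∞} (h : sobolevNorm s f ≤ N) :
    ∑' k : ℤ, ENNReal.ofReal ((1 + |(k : ℝ)|) ^ (2 * s) * ‖coeff f k‖ ^ 2) ≤
      ENNReal.ofReal (2 * Real.pi) * N ^ 2 := by
  have h1 : ENNReal.ofReal (1 / (2 * Real.pi)) *
      ∑' k : ℤ, ENNReal.ofReal ((1 + |(k : ℝ)|) ^ (2 * s) * ‖coeff f k‖ ^ 2) ≤ N ^ 2 := by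
    have := pow_le_pow_left₀ zero_le h 2
    rw [sobolevNorm, ← ENNReal.rpow_natCast, ← ENNReal.rpow_mul] at this
    norm_num at this
    simpa using this
  calc _ = ENNReal.ofReal (2 * Real.pi) * (ENNReal.ofReal (1 / (2 * Real.pi)) *
        ∑' k : ℤ, ENNReal.ofReal ((1 + |(k : ℝ)|) ^ (2 * s) * ‖coeff f k‖ ^ 2)) := by
        rw [← mul_assoc, ← ENNReal.ofReal_mul Real.two_pi_pos.le,
          mul_one_div_cancel Real.two_pi_pos.ne', ENNReal.ofReal_one, one_mul]
    _ ≤ _ := by gcongr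

/-- The Fourier coefficients of `∂ₓˢ f` are summable if `f` has one more derivative in `L²`. -/
theorem tsum_enorm_coeff_le {s : ℕ} (hs : s ≠ 0) {f : Torus → ℝ} {N : ℝ≥0∞} (hN : N ≠ ⊤)
    (h : sobolevNorm (s + 1) f ≤ N) :
    ∑' j : ℤ, ‖(j : ℂ) ^ s * (coeff f j / (2 * Real.pi))‖ₑ ≤
      ENNReal.ofReal (coeffBound N.toReal) := by
  have hsum : Summable fun j : ℤ => 1 / (j : ℝ) ^ 2 :=
    Real.summable_one_div_int_pow.2 (by norm_num)
  rw [coeffBound, ENNReal.ofReal_add zetaSum_nonneg (by positivity), zetaSum,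
    ENNReal.ofReal_tsum_of_nonneg (fun j => by positivity) hsum,
    ENNReal.ofReal_mul Real.two_pi_pos.le, ENNReal.ofReal_pow ENNReal.toReal_nonneg,
    ENNReal.ofReal_toReal hN]
  refine le_trans ?_ (add_le_add_right (tsum_sobolev_le h) _)
  rw [← ENNReal.tsum_add]
  refine ENNReal.tsum_le_tsum fun j => ?_
  rw [← ofReal_norm, ← ENNReal.ofReal_add (by positivity) (by positivity)]
  refine ENNReal.ofReal_le_ofReal ?_
  rcases eq_or_ne j 0 with rfl | hj
  · simp only [Int.cast_zero, zero_pow hs, zero_mul, norm_zero]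
    positivity
  · have hj' : 0 < |(j : ℝ)| := abs_pos.2 (by exact_mod_cast hj)
    have h2π : 1 ≤ 2 * Real.pi := by have := Real.pi_gt_three; linarith
    rw [norm_mul, norm_div, norm_pow, Complex.norm_intCast, norm_mul, Complex.norm_real,
      Real.norm_of_nonneg Real.pi_pos.le, Complex.norm_ofNat]
    have e1 : 1 / (j : ℝ) ^ 2 = (1 / |(j : ℝ)|) ^ 2 := by rw [div_pow, sq_abs, one_pow]
    -- the Cauchy-Schwarz inequality in the form `x y ≤ x² + y²`
    have e2 : |(j : ℝ)| ^ s * ‖coeff f j‖ =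
        (1 / |(j : ℝ)|) * (|(j : ℝ)| ^ (s + 1) * ‖coeff f j‖) := by
      rw [pow_succ]; field_simp
    calc |(j : ℝ)| ^ s * (‖coeff f j‖ / (2 * Real.pi)) ≤ |(j : ℝ)| ^ s * ‖coeff f j‖ := by
          gcongr; exact div_le_self (norm_nonneg _) h2π
      _ ≤ (1 / |(j : ℝ)|) ^ 2 + (|(j : ℝ)| ^ (s + 1) * ‖coeff f j‖) ^ 2 := by
          rw [e2]
          have := two_mul_le_add_sq (1 / |(j : ℝ)|) (|(j : ℝ)| ^ (s + 1) * ‖coeff f j‖)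
          have : 0 ≤ (1 / |(j : ℝ)|) * (|(j : ℝ)| ^ (s + 1) * ‖coeff f j‖) := by positivity
          linarith
      _ ≤ _ := by
          rw [e1, mul_pow, ← pow_mul, mul_comm (s + 1) 2]
          gcongr
          linarith

theorem norm_coeff_le {s : ℕ} {f : Torus → ℝ} {N : ℝ≥0∞} (hN : N ≠ ⊤) (h : sobolevNorm s f ≤ N)
    (k : ℤ) : ‖coeff f k‖ ^ 2 ≤ 2 * Real.pi * N.toReal ^ 2 := by
  have h1 := (ENNReal.le_tsum k).trans (tsum_sobolev_le h)
  have h2 : ENNReal.ofReal (2 * Real.pi) * N ^ 2 =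
      ENNReal.ofReal (2 * Real.pi * N.toReal ^ 2) := by
    rw [ENNReal.ofReal_mul Real.two_pi_pos.le, ENNReal.ofReal_pow ENNReal.toReal_nonneg,
      ENNReal.ofReal_toReal hN]
  rw [h2, ENNReal.ofReal_le_ofReal_iff (by positivity)] at h1
  refine le_trans ?_ h1
  refine le_mul_of_one_le_left (by positivity) (one_le_pow₀ ?_)
  have := abs_nonneg (k : ℝ)
  linarith

namespace MemLinftyH

variable {s : ℕ} {f : ℝ → Torus → ℝ}

theorem ae_le (_ : MemLinftyH s f) : ∀ᵐ t, sobolevNorm s (f t) ≤ normLinftyH s f :=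
  ae_le_essSup

theorem aestronglyMeasurable_modes (h : MemLinftyH s f) (k : ℤ) :
    AEStronglyMeasurable (modes f k) volume :=
  aestronglyMeasurable_cmodes (G := fun p => (f p.1 p.2 : ℂ))
    (Complex.continuous_ofReal.comp_aestronglyMeasurable h.aestronglyMeasurable) k

theorem locallyIntegrable_modes (h : MemLinftyH s f) (k : ℤ) :
    LocallyIntegrable (modes f k) volume := by
  refine locallyIntegrable_of_bound (h.aestronglyMeasurable_modes k)
    (C := Real.sqrt (2 * Real.pi * (normLinftyH s f).toReal ^ 2)) ?_
  filter_upwards [h.ae_le] with t ht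
  exact Real.le_sqrt_of_sq_le (norm_coeff_le h.norm_lt_top.ne ht k)

end MemLinftyH

theorem summable_of_tsum_enorm_le {x : ℤ → ℂ} {C : ℝ} (h : ∑' j, ‖x j‖ₑ ≤ ENNReal.ofReal C) :
    Summable fun j => ‖x j‖ :=
  tsum_enorm_ne_top_iff_summable_norm.1 (ne_top_of_le_ne_top ENNReal.ofReal_ne_top h)

/-- Stability in terms of Fourier coefficients: multiplication by `μ - 2 Φ₀_x` is coercive. -/
theorem aKer_pos {μ δ : ℝ} {c : ℤ → ℝ → ℂ} {t : ℝ} {f₀ : Torus → ℝ} (hf₀ : MemLp f₀ 2 volume)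
    (hc : ∀ j, c j t = coeff f₀ j / (2 * Real.pi))
    (hcs : Summable fun j : ℤ => ‖(j : ℂ) ^ 2 * c j t‖)
    (hpos : ∀ᵐ x : Torus, δ / 2 ≤ μ - 2 * dx (hilbert f₀) x) {x : ℤ → ℂ}
    (hx : Summable fun k => ‖x k‖ ^ 2) :
    δ / 2 * ∑' k, ‖x k‖ ^ 2 ≤
      (∑' kl : ℤ × ℤ, aKer μ c kl.1 kl.2 t * x kl.2 * starRingEnd ℂ (x kl.1)).re := by
  have hπ : (Real.pi : ℂ) ≠ 0 := by exact_mod_cast Real.pi_ne_zero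
  have n2π : ‖(2 * Real.pi : ℂ)‖ = 2 * Real.pi := by
    rw [norm_mul, Complex.norm_real, Real.norm_of_nonneg Real.pi_pos.le]; simp
  have hcf : ∀ j, coeff f₀ j = 2 * Real.pi * c j t := fun j => by rw [hc]; field_simp
  obtain ⟨hh, hhc⟩ := hilbert_spec (summable_coeff_sq hf₀)
  have e1 : ∀ j : ℤ, (j : ℂ) * coeff (hilbert f₀) j =
      2 * Real.pi * (-Complex.I * ((|(j : ℝ)| : ℝ) * c j t)) := fun j => by
    rw [hhc, hcf, ← sign_mul_self]; ring
  have hj2 : ∀ j : ℤ, |(j : ℝ)| ≤ ‖(j : ℂ) ^ 2‖ := fun j => by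
    rw [norm_pow, Complex.norm_intCast]
    rcases eq_or_ne j 0 with rfl | h
    · simp
    · exact le_self_pow₀ (by exact_mod_cast Int.one_le_abs h) (by norm_num)
  have hcs1 : Summable fun j : ℤ => ‖((|(j : ℝ)| : ℝ) : ℂ) * c j t‖ := by
    refine hcs.of_nonneg_of_le (fun j => norm_nonneg _) fun j => ?_
    rw [norm_mul, norm_mul, Complex.norm_real, Real.norm_of_nonneg (abs_nonneg _)]
    gcongr
    exact hj2 j
  have hs1 : Summable fun j : ℤ => ‖(j : ℂ) * coeff (hilbert f₀) j‖ := by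
    refine (hcs1.mul_left (2 * Real.pi)).congr fun j => ?_
    rw [e1, norm_mul (2 * Real.pi : ℂ), n2π, norm_mul (-Complex.I), norm_neg, Complex.norm_I,
      one_mul]
  obtain ⟨hd, hdc⟩ := dx_spec (summable_sq_of_summable hs1)
  set h' := dx (hilbert f₀) with hh'
  have hd' : ∀ j : ℤ, coeff h' j = 2 * Real.pi * ((|(j : ℝ)| : ℝ) * c j t) := fun j => by
    rw [hdc, mul_assoc, e1]
    linear_combination -(2 * Real.pi * (((|(j : ℝ)| : ℝ) : ℂ) * c j t)) * Complex.I_sq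
  have hds : Summable fun j => ‖coeff h' j‖ := by
    refine hs1.congr fun j => ?_
    rw [hdc, mul_assoc, norm_mul Complex.I, Complex.norm_I, one_mul]
  obtain ⟨hm', M, hM⟩ := exists_bound_of_summable (integrable_ofReal hd) hds
  obtain ⟨X, hX, hXx⟩ := exists_ccoeff_eq hx
  have hhX : MemLp (fun y => (h' y : ℂ) * X y) 2 volume :=
    hX.of_le_mul (c := M) (hm'.mul hX.1) (hM.mono fun y hy => by rw [norm_mul]; gcongr)
  set U : Torus → ℂ := fun y => (μ : ℂ) * X y - 2 * ((h' y : ℂ) * X y) with hU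
  have hUL : MemLp U 2 volume := (hX.const_mul (μ : ℂ)).sub (hhX.const_mul 2)
  have hUc : ∀ k, HasSum (fun l => aKer μ c k l t * x l) (ccoeff U k) := fun k => by
    have s1 := hasSum_ite_eq k ((μ : ℂ) * x k)
    have s2 := ((hasSum_ccoeff_mul (memLp_ofReal hd) hX k).mul_left (2 * Real.pi : ℂ)⁻¹).mul_left 2
    have s3 := s1.sub s2
    have e : ccoeff U k = μ * x k - 2 * ((2 * Real.pi : ℂ)⁻¹ *
        (2 * Real.pi * ccoeff (fun y => (h' y : ℂ) * X y) k)) := by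
      rw [hU, ccoeff_sub ((hX.const_mul (μ : ℂ)).integrable (by norm_num))
        ((hhX.const_mul 2).integrable (by norm_num)), ccoeff_const_mul, ccoeff_const_mul, hXx]
      field_simp
    rw [e]
    refine (congrArg (HasSum · _) (funext fun l => ?_)).mp s3
    have e3 : ccoeff (fun y => (h' y : ℂ)) (k - l) = _ := hd' (k - l)
    rw [e3, hXx, aKer]
    push_cast
    by_cases hkl : l = k
    · subst hkl; simp
    · simp only [hkl, Ne.symm hkl, if_false]
      field_simp
      ring
  have hdom : Dominated fun k l => aKer μ c k l t := by
    have d1 : Dominated fun k l : ℤ => if k = l then (μ : ℂ) else 0 := by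
      refine ⟨fun j => if j = 0 then |μ| else 0, (hasSum_ite_eq 0 _).summable, fun k l => ?_⟩
      by_cases hkl : k = l
      · simp [hkl]
      · simp [hkl, sub_eq_zero]
    refine d1.add ⟨fun j => 2 * ‖((|(j : ℝ)| : ℝ) : ℂ) * c j t‖, hcs1.mul_left 2, fun k l => ?_⟩
    simp only [norm_mul, Complex.norm_real, Real.norm_eq_abs, abs_neg, abs_abs]
    push_cast
    rw [abs_two, mul_assoc]
  have hs := hdom.summable hx hx
  have h1 := hs.hasSum
  have h2 := h1.prod_fiberwise fun k => ((hUc k).mul_right (starRingEnd ℂ (x k)))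
  have h3 := hasSum_ccoeff_mul_conj hUL hX
  simp only [hXx] at h3
  rw [h2.unique h3]
  have h4 := (hasSum_ccoeff_sq hX)
  simp only [hXx] at h4
  have e5 : ∫ y, U y * starRingEnd ℂ (X y) = ((∫ y, (μ - 2 * h' y) * ‖X y‖ ^ 2 : ℝ) : ℂ) := by
    rw [← integral_complex_ofReal]
    congr 1; funext y
    push_cast
    rw [← Complex.ofReal_pow, ← Complex.normSq_eq_norm_sq, ← Complex.mul_conj]
    simp only [hU]; ring
  have hXc : MemLp (fun y => starRingEnd ℂ (X y)) 2 volume :=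
    hX.of_le (Complex.continuous_conj.comp_aestronglyMeasurable hX.1) (by simp)
  have hint : Integrable (fun y => (μ - 2 * h' y) * ‖X y‖ ^ 2) volume := by
    have : Integrable (fun y => U y * starRingEnd ℂ (X y)) volume := hUL.integrable_mul hXc
    refine this.re.congr (Eventually.of_forall fun y => ?_)
    have e6 : U y * starRingEnd ℂ (X y) = (((μ - 2 * h' y) * ‖X y‖ ^ 2 : ℝ) : ℂ) := by
      push_cast
      rw [← Complex.ofReal_pow, ← Complex.normSq_eq_norm_sq, ← Complex.mul_conj]
      simp only [hU]; ring
    simp only [e6, RCLike.re_to_complex, Complex.ofReal_re]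
  have h6 : δ / 2 * ∫ y, ‖X y‖ ^ 2 ≤ ∫ y, (μ - 2 * h' y) * ‖X y‖ ^ 2 := by
    rw [← integral_const_mul]
    refine integral_mono_ae ((hX.integrable_norm_pow (by norm_num)).const_mul _) hint ?_
    filter_upwards [hpos] with y hy
    gcongr
  rw [h4.tsum_eq, e5]
  have e7 : (2 * (Real.pi : ℂ) * ((∫ y, (μ - 2 * h' y) * ‖X y‖ ^ 2 : ℝ) : ℂ)).re =
      2 * Real.pi * ∫ y, (μ - 2 * h' y) * ‖X y‖ ^ 2 := by
    rw [← Complex.ofReal_ofNat, ← Complex.ofReal_mul, ← Complex.ofReal_mul, Complex.ofReal_re]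
  rw [e7]
  have := Real.two_pi_pos
  nlinarith

/-- The Fourier coefficients of a basic state, in their continuous representatives and divided by
`2π`, satisfy the assumptions of the proof. -/
theorem IsBasicState.exists_modeCoeffs {μ δ : ℝ} {φ₀ φ₀t : ℝ → Torus → ℝ}
    (h : IsBasicState μ δ φ₀ φ₀t) :
    ∃ c d, ModeCoeffs μ δ (coeffBound (normLinftyH 3 φ₀).toReal)
        (coeffBound (normLinftyH 2 φ₀t).toReal) c d ∧
      ∀ᵐ t, ∀ j, c j t = coeff (φ₀ t) j / (2 * Real.pi) := by
  have i1 : ∀ᵐ t, Integrable (φ₀ t) volume := h.mem.memLp.mono fun t ht =>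
    ht.integrable (by norm_num)
  have i2 : ∀ᵐ t, Integrable (φ₀t t) volume := h.memDt.memLp.mono fun t ht =>
    ht.integrable (by norm_num)
  choose F hF hFe using fun j => (isWeakDeriv_modes i1 i2 (h.mem.locallyIntegrable_modes j)
    (h.memDt.locallyIntegrable_modes j) h.weakDt).exists_isPrim
    (h.mem.locallyIntegrable_modes j) (h.memDt.locallyIntegrable_modes j)
  set c : ℤ → ℝ → ℂ := fun j t => (2 * Real.pi : ℂ)⁻¹ * F j t with hc
  set d : ℤ → ℝ → ℂ := fun j t => (2 * Real.pi : ℂ)⁻¹ * modes φ₀t j t with hd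
  have hce : ∀ᵐ t, ∀ j, c j t = coeff (φ₀ t) j / (2 * Real.pi) := by
    rw [ae_all_iff]
    intro j
    filter_upwards [hFe j] with t ht
    rw [hc]; simp only
    rw [← ht, modes]; ring
  have hb : ∀ᵐ t, ∑' j : ℤ, ‖(j : ℂ) ^ 2 * c j t‖ₑ ≤
      ENNReal.ofReal (coeffBound (normLinftyH 3 φ₀).toReal) := by
    filter_upwards [hce, h.mem.ae_le] with t h1 h2
    simp only [h1]
    exact tsum_enorm_coeff_le two_ne_zero h.mem.norm_lt_top.ne h2
  refine ⟨c, d, ⟨fun j => (hF j).const_mul _, fun j => ?_, coeffBound_nonneg _,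
    coeffBound_nonneg _, hb, ?_, ?_⟩, hce⟩
  · filter_upwards [hce] with t ht
    rw [ht, ht, coeff_neg, map_div₀, map_mul, Complex.conj_ofReal, map_ofNat]
  · filter_upwards [h.memDt.ae_le] with t ht
    refine le_trans (le_of_eq ?_) (tsum_enorm_coeff_le one_ne_zero h.memDt.norm_lt_top.ne ht)
    refine tsum_congr fun j => ?_
    simp only [hd, modes, pow_one, div_eq_inv_mul]
  · filter_upwards [hce, h.mem.memLp, hb, h.stability] with t h1 h2 h3 h4 x hx
    exact aKer_pos h2 h1 (summable_of_tsum_enorm_le h3) h4 hx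

/-! ### The weak equation in terms of Fourier coefficients -/

/-- The contribution of the `k`-th Fourier coefficients to the weak equation, tested against `q`
with time derivative `q'`. -/
def residual (μ : ℝ) (c g p v : ℤ → ℝ → ℂ) (q q' : ℝ → ℂ) (k : ℤ) (t : ℝ) : ℂ :=
  -(v k t * starRingEnd ℂ (q' t)) + modeOp μ c p k t * starRingEnd ℂ (q t) -
    g k t * starRingEnd ℂ (q t)

theorem exp_mul_exp_neg (γ t : ℝ) :
    (Real.exp (-γ * t) : ℂ) * (Real.exp (γ * t) : ℂ) = 1 := by
  rw [← Complex.ofReal_mul, ← Real.exp_add]; simp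

theorem L2Modes.sumInt_weight {γ : ℝ} {x y : ℤ → ℝ → ℂ}
    (hx : L2Modes fun k t => (Real.exp (-γ * t) : ℂ) * x k t)
    (hy : L2Modes fun k t => (Real.exp (γ * t) : ℂ) * y k t) :
    SumInt volume fun k t => x k t * starRingEnd ℂ (y k t) := by
  refine (hx.sumInt hy).congr fun k => Eventually.of_forall fun t => ?_
  simp only [map_mul, Complex.conj_ofReal]
  linear_combination (x k t * starRingEnd ℂ (y k t)) * exp_mul_exp_neg γ t

theorem ModeCoeffs.sumInt_bKer_weight {μ δ a b γ : ℝ} {c d : ℤ → ℝ → ℂ}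
    (hc : ModeCoeffs μ δ a b c d) {x y : ℤ → ℝ → ℂ}
    (hx : L2Modes fun k t => (Real.exp (-γ * t) : ℂ) * x k t)
    (hy : L2Modes fun k t => (Real.exp (γ * t) : ℂ) * y k t) :
    SumInt volume fun (kl : ℤ × ℤ) t =>
      bKer μ c kl.1 kl.2 t * x kl.2 t * starRingEnd ℂ (y kl.1 t) := by
  refine (hc.form_bKer hx hy).congr fun kl => Eventually.of_forall fun t => ?_
  simp only [map_mul, Complex.conj_ofReal]
  linear_combination (bKer μ c kl.1 kl.2 t * x kl.2 t * starRingEnd ℂ (y kl.1 t)) *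
    exp_mul_exp_neg γ t

theorem ModeCoeffs.integrable_residual {μ δ a b γ : ℝ} {c d : ℤ → ℝ → ℂ}
    (hc : ModeCoeffs μ δ a b c d) {g p v : ℤ → ℝ → ℂ} {q q' : ℤ → ℝ → ℂ}
    (hg : L2Modes fun k t => (Real.exp (-γ * t) : ℂ) * g k t)
    (hv : L2Modes fun k t => (Real.exp (-γ * t) : ℂ) * v k t)
    (hp : L2Modes fun k t => (Real.exp (-γ * t) : ℂ) * (k * p k t))
    (hq : L2Modes fun k t => (Real.exp (γ * t) : ℂ) * q k t)
    (hkq : L2Modes fun k t => (Real.exp (γ * t) : ℂ) * (k * q k t))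
    (hq' : L2Modes fun k t => (Real.exp (γ * t) : ℂ) * q' k t) :
    (∀ k, Integrable (residual μ c g p v (q k) (q' k) k) volume) ∧
    HasSum (fun k => ∫ t, residual μ c g p v (q k) (q' k) k t)
      ((-∫ t, ∑' k, v k t * starRingEnd ℂ (q' k t)) +
        (∫ t, ∑' kl : ℤ × ℤ, bKer μ c kl.1 kl.2 t * (kl.2 * p kl.2 t) *
          starRingEnd ℂ (kl.1 * q kl.1 t)) -
        ∫ t, ∑' k, g k t * starRingEnd ℂ (q k t)) := by
  have s1 := hv.sumInt_weight hq'
  have s2 := hc.sumInt_bKer_weight hp hkq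
  have s3 := hg.sumInt_weight hq
  have e : ∀ k t, ∑' l, bKer μ c k l t * (l * p l t) * starRingEnd ℂ (k * q k t) =
      modeOp μ c p k t * starRingEnd ℂ (q k t) := fun k t => by
    rw [tsum_mul_right, modeOp, map_mul, map_intCast]; ring
  have s2' := s2.tsum_fiber
  simp only [e] at s2'
  have h1 : ∀ k, Integrable (fun t => -(v k t * starRingEnd ℂ (q' k t))) volume :=
    fun k => (s1.integrable k).neg
  have h2 : ∀ k, Integrable (fun t => -(v k t * starRingEnd ℂ (q' k t)) +
      modeOp μ c p k t * starRingEnd ℂ (q k t)) volume := fun k => (h1 k).add (s2'.integrable k)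
  refine ⟨fun k => (h2 k).sub (s3.integrable k), ?_⟩
  have e2 : ∫ t, ∑' kl : ℤ × ℤ, bKer μ c kl.1 kl.2 t * (kl.2 * p kl.2 t) *
      starRingEnd ℂ (kl.1 * q kl.1 t) = ∑' k, ∫ t, modeOp μ c p k t * starRingEnd ℂ (q k t) := by
    rw [← s2.integral_tsum, s2.tsum_prod]
    simp only [e]
  rw [e2]
  refine (congrArg (HasSum · _) (funext fun k => ?_)).mp
    ((s1.hasSum.neg.add s2'.summable.hasSum).sub s3.hasSum)
  unfold residual
  rw [integral_sub (h2 k) (s3.integrable k), integral_add (h1 k) (s2'.integrable k), integral_neg]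

/-- The left hand side of the weak equation at time `t`. -/
def weakIntegrand (μ : ℝ) (φ₀ φ φt φx ψ : ℝ → Torus → ℝ) (t : ℝ) : ℝ :=
  (∫ x, -(φt t x * testDt ψ t x))
    + (∫ x, μ * (φx t x * testDx ψ t x))
    + (∫ x, 2 * hilbert (fun y => dx (hilbert (φ₀ t)) y * hilbert (φx t) y) x
        * testDx ψ t x)
    - (∫ x, comm (hilbert (φ t)) (dx (dx (hilbert (φ₀ t)))) x * testDx ψ t x)
    + ∫ x, hilbert (φx t) x * dx (comm (hilbert (φ₀ t)) (testDx ψ t)) x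

/-- Parseval's identity turns the weak equation into the sum over the Fourier coefficients of the
weak equations on the line. -/
theorem hasSum_residual {μ δ a b γ : ℝ} {c d : ℤ → ℝ → ℂ} {φ₀ g φ φt φx : ℝ → Torus → ℝ}
    {p v : ℤ → ℝ → ℂ} (hc : ModeCoeffs μ δ a b c d) (hφ₀ : ∀ᵐ t, MemLp (φ₀ t) 2 volume)
    (hcφ : ∀ᵐ t, ∀ j, c j t = coeff (φ₀ t) j / (2 * Real.pi))
    (hg : MemL2w γ g) (hφt : MemL2w γ φt) (hφx : MemL2w γ φx)
    (hv : ∀ k, modes φt k =ᵐ[volume] v k) (hp : ∀ k, modes φ k =ᵐ[volume] p k)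
    (hx : ∀ k, modes φx k =ᵐ[volume] fun t => Complex.I * (k * p k t))
    (h0 : p 0 =ᵐ[volume] 0) {ψ : ℝ → Torus → ℝ} (hψ : IsTest ψ) :
    (∀ k, Integrable (residual μ c (modes g) p v (modes ψ k) (modes (testDt ψ) k) k) volume) ∧
    HasSum (fun k => ∫ t, residual μ c (modes g) p v (modes ψ k) (modes (testDt ψ) k) k t)
      ((2 * Real.pi * ((∫ t, weakIntegrand μ φ₀ φ φt φx ψ t) -
        ∫ t : ℝ, ∫ x, g t x * ψ t x) : ℝ) : ℂ) := by
  have lv : L2Modes fun k t => (Real.exp (-γ * t) : ℂ) * v k t := hφt.l2Modes.congr fun k => by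
    filter_upwards [hv k] with t ht
    rw [ht]
  have lp : L2Modes fun k t => (Real.exp (-γ * t) : ℂ) * (k * p k t) :=
    (hφx.l2Modes.const_mul (-Complex.I)).congr fun k => by
      filter_upwards [hx k] with t ht
      rw [ht]
      linear_combination -((Real.exp (-γ * t) : ℂ) * (k * p k t)) * Complex.I_sq
  have lq := hψ.l2Modes γ
  have lq' := hψ.testDt.l2Modes γ
  have lkq : L2Modes fun k t => (Real.exp (γ * t) : ℂ) * (k * modes ψ k t) :=
    ((hψ.testDx.l2Modes γ).const_mul (-Complex.I)).congr fun k =>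
      Eventually.of_forall fun t => by
        simp only [hψ.modes_testDx]
        linear_combination -((Real.exp (γ * t) : ℂ) * (k * modes ψ k t)) * Complex.I_sq
  obtain ⟨hi, hs⟩ := hc.integrable_residual hg.l2Modes lv lp lq lkq lq'
  refine ⟨hi, ?_⟩
  have i1 := (lv.sumInt_weight lq').integrable_tsum
  have i2 := (hc.sumInt_bKer_weight lp lkq).integrable_tsum
  convert hs using 1
  have eL : ∀ᵐ t, ((2 * Real.pi * weakIntegrand μ φ₀ φ φt φx ψ t : ℝ) : ℂ) =
      -(∑' k, v k t * starRingEnd ℂ (modes (testDt ψ) k t)) +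
      ∑' kl : ℤ × ℤ, bKer μ c kl.1 kl.2 t * (kl.2 * p kl.2 t) *
          starRingEnd ℂ (kl.1 * modes ψ kl.1 t) := by
    filter_upwards [hφ₀, hcφ, hc.bound, hφt.memLp_slice, hφx.memLp_slice, ae_all_iff.2 hv,
      ae_all_iff.2 hp, ae_all_iff.2 hx, h0] with t t1 t2 t3 t4 t5 t6 t7 t8 t9
    have c0 : coeff (φ t) 0 = 0 := by
      have := t7 0
      rw [t9] at this
      exact this
    have cx : ∀ k, coeff (φx t) k = Complex.I * k * coeff (φ t) k := fun k => by
      have h1 := t8 k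
      have h2 := t7 k
      simp only [modes] at h1 h2
      rw [h1, h2]; ring
    have w0 : coeff (testDx ψ t) 0 = 0 := by
      have := hψ.modes_testDx 0 t
      simpa [modes] using this
    have S1 := hasSum_spatial (μ := μ) t1 t2 (summable_of_tsum_enorm_le t3) c0 t5 cx
      (hψ.testDx.memLp_slice t) w0
    have S2 := hasSum_coeff_mul_conj t4 (hψ.testDt.memLp_slice t)
    have E1 : ∑' kl : ℤ × ℤ, bKer μ c kl.1 kl.2 t * (kl.2 * p kl.2 t) *
          starRingEnd ℂ (kl.1 * modes ψ kl.1 t) = ∑' kl : ℤ × ℤ, bKer μ c kl.1 kl.2 t *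
            coeff (φx t) kl.2 * starRingEnd ℂ (coeff (testDx ψ t) kl.1) := by
      refine tsum_congr fun kl => ?_
      have h1 := t8 kl.2
      have h2 := hψ.modes_testDx kl.1 t
      simp only [modes] at h1 h2
      rw [h1, h2]
      simp only [modes, map_mul, Complex.conj_I]
      linear_combination (bKer μ c kl.1 kl.2 t * (kl.2 * p kl.2 t) *
          (starRingEnd ℂ (kl.1 : ℂ) * starRingEnd ℂ (coeff (ψ t) kl.1))) * Complex.I_sq
    have E2 : ∑' k, v k t * starRingEnd ℂ (modes (testDt ψ) k t) =
        ∑' k, coeff (φt t) k * starRingEnd ℂ (coeff (testDt ψ t) k) := by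
      refine tsum_congr fun k => ?_
      have h1 := t6 k
      simp only [modes] at h1
      rw [h1]; rfl
    rw [E1, E2, S1.tsum_eq, S2.tsum_eq, weakIntegrand, integral_neg]
    push_cast
    ring
  have eG : ∀ᵐ t, ((2 * Real.pi * ∫ x, g t x * ψ t x : ℝ) : ℂ) =
      ∑' k, modes g k t * starRingEnd ℂ (modes ψ k t) := by
    filter_upwards [hg.memLp_slice] with t ht
    exact (hasSum_coeff_mul_conj ht (hψ.memLp_slice t)).tsum_eq.symm
  have e3 : (-∫ t, ∑' k, v k t * starRingEnd ℂ (modes (testDt ψ) k t)) +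
      ∫ t, ∑' kl : ℤ × ℤ, bKer μ c kl.1 kl.2 t * (kl.2 * p kl.2 t) *
          starRingEnd ℂ (kl.1 * modes ψ kl.1 t) =
      ((2 * Real.pi * ∫ t, weakIntegrand μ φ₀ φ φt φx ψ t : ℝ) : ℂ) := by
    have i1' : Integrable
        (fun t => -∑' k, v k t * starRingEnd ℂ (modes (testDt ψ) k t)) volume := i1.neg
    rw [← integral_neg, ← integral_add i1' i2, ← integral_const_mul, ← integral_complex_ofReal]
    exact integral_congr_ae (eL.mono fun t ht => ht.symm)
  have e4 : ∫ t, ∑' k, modes g k t * starRingEnd ℂ (modes ψ k t) =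
      ((2 * Real.pi * ∫ t : ℝ, ∫ x, g t x * ψ t x : ℝ) : ℂ) := by
    rw [← integral_const_mul, ← integral_complex_ofReal]
    exact integral_congr_ae (eG.mono fun t ht => ht.symm)
  rw [e3, e4]
  push_cast
  ring

/-! ### The Fourier coefficients of a solution -/

section

variable {G : ℝ × Torus → ℂ}

theorem integrable_prod_of_locallyIntegrable (hG : LocallyIntegrable G volume) (R : ℝ) :
    Integrable G ((volume.restrict (Icc (-R) R)).prod volume) := by
  have h := hG.integrableOn_isCompact ((isCompact_Icc (a := -R) (b := R)).prod
    (isCompact_univ (X := Torus)))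
  rw [IntegrableOn, Measure.volume_eq_prod, ← Measure.prod_restrict, Measure.restrict_univ] at h
  exact h

theorem ae_integrable_slice (hG : LocallyIntegrable G volume) :
    ∀ᵐ t, Integrable (fun x => G (t, x)) volume := by
  have h : ∀ n : ℕ, ∀ᵐ t : ℝ, t ∈ Icc (-(n : ℝ)) n → Integrable (fun x => G (t, x)) volume :=
    fun n => (ae_restrict_iff' measurableSet_Icc).1
      (integrable_prod_of_locallyIntegrable hG n).prod_right_ae
  filter_upwards [ae_all_iff.2 h] with t ht
  obtain ⟨n, hn⟩ := exists_nat_ge |t|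
  exact ht n (abs_le.1 hn)

theorem locallyIntegrable_cmodes (hG : LocallyIntegrable G volume) (k : ℤ) :
    LocallyIntegrable (cmodes G k) volume := by
  rw [locallyIntegrable_iff]
  intro K hK
  obtain ⟨R, hR⟩ := hK.isBounded.subset_closedBall 0
  rw [Real.closedBall_eq_Icc, zero_sub, zero_add] at hR
  have h := integrable_prod_of_locallyIntegrable hG R
  have h1 : Integrable (fun p : ℝ × Torus => G p * fourier (-k) p.2)
      ((volume.restrict (Icc (-R) R)).prod volume) := by
    refine h.congr' (h.1.mul ((fourier (-k)).continuous.comp continuous_snd).aestronglyMeasurable)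
      (Eventually.of_forall fun p => ?_)
    rw [norm_mul, fourier_apply, Circle.norm_coe, mul_one]
  exact IntegrableOn.mono_set h1.integral_prod_left hR

end

theorem MemL2w.ae_integrable {γ : ℝ} {f : ℝ → Torus → ℝ} (hf : MemL2w γ f) :
    ∀ᵐ t, Integrable (f t) volume :=
  hf.memLp_slice.mono fun t ht => ht.integrable (by norm_num)

theorem locallyIntegrable_of_weight (γ : ℝ) {f : ℝ → ℂ}
    (hf : LocallyIntegrable (fun t => (Real.exp (-γ * t) : ℂ) * f t) volume) :
    LocallyIntegrable f volume := by
  have hexp : Continuous fun s : ℝ => (Real.exp (γ * s) : ℂ) := by fun_prop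
  refine (congrArg (LocallyIntegrable · volume) (funext fun t => ?_)).mp
    (hf.continuous_smul hexp)
  rw [smul_eq_mul]
  linear_combination f t * exp_mul_exp_neg γ t

theorem MemL2w.locallyIntegrable_modes {γ : ℝ} {f : ℝ → Torus → ℝ} (hf : MemL2w γ f) (k : ℤ) :
    LocallyIntegrable (modes f k) volume :=
  locallyIntegrable_of_weight γ ((hf.l2Modes.memLp k).locallyIntegrable (by norm_num))

theorem ModeCoeffs.locallyIntegrable_modeOp {μ δ a b γ : ℝ} {c d p : ℤ → ℝ → ℂ}
    (hc : ModeCoeffs μ δ a b c d)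
    (hp : L2Modes fun k t => (Real.exp (-γ * t) : ℂ) * (k * p k t)) (k : ℤ) :
    LocallyIntegrable (modeOp μ c p k) volume := by
  refine locallyIntegrable_of_weight γ ?_
  refine (congrArg (LocallyIntegrable · volume) (funext fun t => ?_)).mp
    ((hc.locallyIntegrable_row hp k).smul (k : ℂ))
  have e : ∑' l : ℤ, bKer μ c k l t * ((Real.exp (-γ * t) : ℂ) * (l * p l t)) =
      (Real.exp (-γ * t) : ℂ) * ∑' l : ℤ, bKer μ c k l t * (l * p l t) := by
    rw [← tsum_mul_left]
    exact tsum_congr fun l => by ring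
  rw [modeOp, Pi.smul_apply, smul_eq_mul, e]
  ring

theorem coeff_zero_eq (f : Torus → ℝ) : coeff f 0 = ((∫ x, f x : ℝ) : ℂ) := by
  rw [coeff, ← integral_complex_ofReal]
  simp

theorem ZeroMean.modes_zero {f : ℝ → Torus → ℝ} (h : ZeroMean f) : modes f 0 =ᵐ[volume] 0 := by
  filter_upwards [h] with t ht
  rw [modes, coeff_zero_eq, ht]; rfl

/-- The Fourier coefficients of a weak space derivative. -/
theorem modes_eq_of_isWeakDx {f u : ℝ → Torus → ℝ} (hf : ∀ᵐ t, Integrable (f t) volume)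
    (hu : ∀ᵐ t, Integrable (u t) volume) {k : ℤ} (hfl : LocallyIntegrable (modes f k) volume)
    (hul : LocallyIntegrable (modes u k) volume) (h : IsWeakDx f u) :
    modes u k =ᵐ[volume] fun t => Complex.I * (k * modes f k t) := by
  have re : ∀ {F : ℝ → ℂ}, Integrable F volume → ∀ z : ℂ, ∫ t, (z * F t).re = (z * ∫ t, F t).re :=
    fun hF z => by
      have := integral_re (hF.const_mul z)
      simp only [RCLike.re_to_complex, integral_const_mul] at this
      exact this
  have hl : LocallyIntegrable (fun t => modes u k t - Complex.I * (k * modes f k t)) volume := by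
    refine (congrArg (LocallyIntegrable · volume) (funext fun t => ?_)).mp
      (hul.sub (hfl.smul (Complex.I * (k : ℂ))))
    simp only [Pi.sub_apply, Pi.smul_apply, smul_eq_mul]; ring
  have h0 := ae_eq_zero_of_integral_contDiff_smul_eq_zero hl fun η hη hηc => ?_
  · filter_upwards [h0] with t ht
    exact sub_eq_zero.1 ht
  have hη' : IsTest1 η := ⟨hη, hηc⟩
  have i1 := hη'.integrable_mul hfl
  have i2 := hη'.integrable_mul hul
  have key : ∀ z : ℂ, (z * (∫ t, modes u k t * (η t : ℂ))).re =
      (z * (Complex.I * k * ∫ t, modes f k t * (η t : ℂ))).re := fun z => by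
    have h1 := h _ (isTest_wave hη' z k)
    have e1 : ∫ t : ℝ, ∫ x, f t x * testDx (fun t x => η t * wave z k x) t x =
        ∫ t, ((-Complex.I * k * z) * (modes f k t * (η t : ℂ))).re := by
      refine integral_congr_ae ?_
      filter_upwards [hf] with t ht
      simp only [testDx_wave hη', mul_left_comm _ (η t), integral_const_mul,
        integral_mul_wave ht, modes]
      rw [← Complex.re_ofReal_mul]
      congr 1; ring
    have e2 : ∫ t : ℝ, ∫ x, u t x * (η t * wave z k x) =
        ∫ t, (z * (modes u k t * (η t : ℂ))).re := by
      refine integral_congr_ae ?_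
      filter_upwards [hu] with t ht
      simp only [mul_left_comm _ (η t), integral_const_mul, integral_mul_wave ht, modes]
      rw [← Complex.re_ofReal_mul]
      congr 1; ring
    rw [e1, e2, re i1, re i2, ← neg_eq_iff_eq_neg] at h1
    rw [← h1, ← Complex.neg_re]
    congr 1; ring
  -- `z = 1` gives the real part and `z = -i` the imaginary part
  have k1 := key 1
  have k2 := key (-Complex.I)
  have k3 : ∫ t, modes u k t * (η t : ℂ) = Complex.I * k * ∫ t, modes f k t * (η t : ℂ) :=
    Complex.ext (by simpa using k1) (by simpa using k2)
  have e : (fun t => η t • (modes u k t - Complex.I * (k * modes f k t))) = fun t =>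
      modes u k t * (η t : ℂ) - Complex.I * k * (modes f k t * (η t : ℂ)) := by
    funext t; rw [Complex.real_smul]; ring
  rw [e, integral_sub i2 (i1.const_mul _), integral_const_mul, k3, sub_self]

/-- The Fourier coefficients of a solution solve the linearized equation. -/
theorem IsSolution.exists_modeSol {μ δ a b γ : ℝ} {c d : ℤ → ℝ → ℂ}
    {φ₀ g φ φt φx : ℝ → Torus → ℝ} (hc : ModeCoeffs μ δ a b c d)
    (hφ₀ : ∀ᵐ t, MemLp (φ₀ t) 2 volume)
    (hcφ : ∀ᵐ t, ∀ j, c j t = coeff (φ₀ t) j / (2 * Real.pi)) (hg : MemL2w γ g)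
    (h : IsSolution μ γ φ₀ g φ φt φx) :
    ∃ p v, ModeSol μ γ c (modes g) p v ∧ ∀ k, modes φ k =ᵐ[volume] p k := by
  have hl : LocallyIntegrable (fun p : ℝ × Torus => (φ p.1 p.2 : ℂ)) volume := by
    intro x
    obtain ⟨s, hs, hi⟩ := h.locallyIntegrable x
    exact ⟨s, hs, hi.ofReal⟩
  have hφi : ∀ᵐ t, Integrable (φ t) volume := by
    filter_upwards [ae_integrable_slice hl] with t ht
    simpa using ht.re
  have hφl : ∀ k, LocallyIntegrable (modes φ k) volume := locallyIntegrable_cmodes hl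
  choose p hp hpe using fun k => (isWeakDeriv_modes hφi h.memDt.ae_integrable (hφl k)
    (h.memDt.locallyIntegrable_modes k) h.weakDt).exists_isPrim (hφl k)
    (h.memDt.locallyIntegrable_modes k)
  have hx : ∀ k, modes φx k =ᵐ[volume] fun t => Complex.I * (k * p k t) := fun k => by
    filter_upwards [modes_eq_of_isWeakDx hφi h.memDx.ae_integrable (hφl k)
      (h.memDx.locallyIntegrable_modes k) h.weakDx, hpe k] with t h1 h2
    rw [h1, h2]
  have h0 : p 0 =ᵐ[volume] 0 := (hpe 0).symm.trans h.zeroMean.modes_zero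
  have lp : L2Modes fun k t => (Real.exp (-γ * t) : ℂ) * (k * p k t) :=
    (h.memDx.l2Modes.const_mul (-Complex.I)).congr fun k => by
      filter_upwards [hx k] with t ht
      rw [ht]
      linear_combination -((Real.exp (-γ * t) : ℂ) * (k * p k t)) * Complex.I_sq
  have hw : ∀ k, IsWeakDeriv (modes φt k) (fun t => modes g k t - modeOp μ c p k t) := by
    intro k η hη
    set ε : ℤ → ℂ := fun j => ∫ t, (-(modes φt j t * ((deriv η t : ℝ) : ℂ)) +
      modeOp μ c p j t * (η t : ℂ) - modes g j t * (η t : ℂ)) with hε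
    -- the equation tested with the real functions `η(t) Re (z e^{-ikx})`
    have key : ∀ z : ℂ, starRingEnd ℂ z * ε (-k) + z * ε k = 0 := fun z => by
      have hψ := isTest_wave hη z k
      have hs := (hasSum_residual hc hφ₀ hcφ hg h.memDt h.memDx
        (fun k => EventuallyEq.rfl) hpe hx h0 hψ).2
      have heq : ∫ t, weakIntegrand μ φ₀ φ φt φx (fun t x => η t * wave z k x) t =
        ∫ t : ℝ, ∫ x, g t x * (η t * wave z k x) := h.equation _ hψ
      rw [heq, sub_self, mul_zero, Complex.ofReal_zero] at hs
      have e : ∀ j, ∫ t, residual μ c (modes g) p (modes φt)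
          (modes (fun t x => η t * wave z k x) j)
          (modes (testDt fun t x => η t * wave z k x) j) j t =
          (if j = -k then Real.pi * (starRingEnd ℂ z * ε (-k)) else 0) +
            if j = k then Real.pi * (z * ε k) else 0 := fun j => by
        have e1 : ∀ t, modes (fun t x => η t * wave z k x) j t = η t * coeff (wave z k) j :=
          fun t => coeff_const_mul _ _ j
        have e2 : ∀ t, modes (testDt fun t x => η t * wave z k x) j t =
            ((deriv η t : ℝ) : ℂ) * coeff (wave z k) j := fun t => by
          have : testDt (fun t x => η t * wave z k x) t = fun x => deriv η t * wave z k x :=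
            funext fun x => testDt_wave hη z k t x
          rw [modes, this]
          exact coeff_const_mul _ _ j
        have e3 : ∫ t, residual μ c (modes g) p (modes φt)
            (modes (fun t x => η t * wave z k x) j)
            (modes (testDt fun t x => η t * wave z k x) j) j t =
            starRingEnd ℂ (coeff (wave z k) j) * ε j := by
          rw [hε, ← integral_const_mul]
          congr 1; funext t
          simp only [residual, e1, e2, map_mul, Complex.conj_ofReal]
          ring
        have a1 : starRingEnd ℂ (if j = -k then z else 0) * ε j =
            if j = -k then starRingEnd ℂ z * ε (-k) else 0 := by
          split_ifs with hj
          · rw [hj]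
          · rw [map_zero, zero_mul]
        have a2 : starRingEnd ℂ (if j = k then starRingEnd ℂ z else 0) * ε j =
            if j = k then z * ε k else 0 := by
          split_ifs with hj
          · rw [hj, Complex.conj_conj]
          · rw [map_zero, zero_mul]
        rw [e3, coeff_wave, map_mul, Complex.conj_ofReal, map_add, mul_assoc, add_mul, a1, a2,
          mul_add, mul_ite, mul_ite, mul_zero]
      simp only [e] at hs
      have hs' := hs.unique ((hasSum_ite_eq (-k) _).add (hasSum_ite_eq k _))
      have hπ : (Real.pi : ℂ) ≠ 0 := by exact_mod_cast Real.pi_ne_zero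
      rw [← mul_add] at hs'
      exact (mul_eq_zero.1 hs'.symm).resolve_left hπ
    -- `z = 1` and `z = i` separate the frequencies `k` and `-k`
    have hεk : ε k = 0 := by
      have k1 := key 1
      have k2 := key Complex.I
      simp only [map_one, Complex.conj_I] at k1 k2
      linear_combination (1 / 2 : ℂ) * k1 - (Complex.I / 2) * k2 +
        (1 / 2 : ℂ) * (ε k - ε (-k)) * Complex.I_sq
    have i1 := hη.deriv.integrable_mul (h.memDt.locallyIntegrable_modes k)
    have i2 := hη.integrable_mul (hc.locallyIntegrable_modeOp lp k)
    have i3 := hη.integrable_mul (hg.locallyIntegrable_modes k)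
    have i1' : Integrable (fun t => -(modes φt k t * ((deriv η t : ℝ) : ℂ))) volume := i1.neg
    have i12 : Integrable (fun t => -(modes φt k t * ((deriv η t : ℝ) : ℂ)) +
      modeOp μ c p k t * (η t : ℂ)) volume := i1'.add i2
    simp only [hε] at hεk
    rw [integral_sub i12 i3, integral_add i1' i2, integral_neg] at hεk
    simp only [sub_mul]
    rw [integral_sub i3 i2]
    linear_combination -hεk
  choose v hv hve using fun k => (hw k).exists_isPrim (h.memDt.locallyIntegrable_modes k)
    (by
      have := (hg.locallyIntegrable_modes k).sub (hc.locallyIntegrable_modeOp lp k)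
      exact this)
  refine ⟨p, v, ⟨fun k => (hp k).congr_ae (hve k), hv, fun t => ?_, ?_, lp⟩, hpe⟩
  · have := (Continuous.ae_eq_iff_eq volume (hp 0).continuous continuous_const).1 h0
    exact congrFun this t
  · exact h.memDt.l2Modes.congr fun k => by
      filter_upwards [hve k] with t ht
      rw [ht]

/-! ### Construction of the solution from its Fourier coefficients -/

theorem L2Modes.reflect {x : ℤ → ℝ → ℂ} (h : L2Modes x) : L2Modes fun k => x (-k) :=
  ⟨fun k => h.meas _, by
    have := (Equiv.neg ℤ).tsum_eq fun k => ∫⁻ t, ‖x k t‖ₑ ^ 2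
    simp only [Equiv.neg_apply] at this
    rw [this]; exact h.fin⟩

theorem IsPrim.ae_eq {F f f' : ℝ → ℂ} (h : IsPrim F f) (h' : IsPrim F f') : f =ᵐ[volume] f' := by
  filter_upwards [h.ae_hasDerivAt, h'.ae_hasDerivAt] with t h1 h2
  exact h1.unique h2

theorem modes_neg (f : ℝ → Torus → ℝ) (k : ℤ) (t : ℝ) :
    modes f (-k) t = starRingEnd ℂ (modes f k t) := coeff_neg (f t) k

section

variable {μ δ a b γ : ℝ} {c d g p v : ℤ → ℝ → ℂ}

/-- The linearized operator is real. -/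
theorem ModeCoeffs.modeOp_conj (hc : ModeCoeffs μ δ a b c d) (p : ℤ → ℝ → ℂ) (k : ℤ) :
    ∀ᵐ t, modeOp μ c (fun k t => starRingEnd ℂ (p (-k) t)) k t =
      starRingEnd ℂ (modeOp μ c p (-k) t) := by
  filter_upwards [ae_all_iff.2 hc.herm] with t ht
  have hb : ∀ l, starRingEnd ℂ (bKer μ c (-k) (-l) t) = bKer μ c k l t := fun l => by
    have e : -k - -l = -(k - l) := by ring
    rw [bKer_eq, bKer_eq, map_add, map_mul, lam_neg, e, ht, Complex.conj_ofReal,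
      Complex.conj_conj, apply_ite (starRingEnd ℂ), Complex.conj_ofReal, map_zero]
    simp only [neg_inj]
  rw [modeOp, modeOp, map_mul, Complex.conj_tsum,
    ← (Equiv.neg ℤ).tsum_eq fun l => starRingEnd ℂ (bKer μ c (-k) l t * (l * p l t)),
    ← tsum_mul_left, ← tsum_mul_left]
  refine tsum_congr fun l => ?_
  rw [Equiv.neg_apply, map_mul, hb, map_mul, map_intCast, map_intCast]
  push_cast
  ring

theorem ModeSol.reflect_conj (hc : ModeCoeffs μ δ a b c d) (h : ModeSol μ γ c g p v)
    (hg : ∀ k t, g (-k) t = starRingEnd ℂ (g k t)) :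
    ModeSol μ γ c g (fun k t => starRingEnd ℂ (p (-k) t))
      (fun k t => starRingEnd ℂ (v (-k) t)) where
  prim_p k := (h.prim_p (-k)).conj
  prim_v k := (h.prim_v (-k)).conj.congr_ae (by
    filter_upwards [hc.modeOp_conj p k] with t ht
    rw [ht, map_sub, hg, Complex.conj_conj])
  zero t := by simp [h.zero t]
  memDt := h.memDt.reflect.conj.congr fun k => Eventually.of_forall fun t => by
    simp only [map_mul, Complex.conj_ofReal]
  memDx := h.memDx.reflect.conj.neg.congr fun k => Eventually.of_forall fun t => by
    simp only [map_mul, Complex.conj_ofReal, map_intCast]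
    push_cast
    ring

/-- By uniqueness, the coefficients of the solution are those of a real function. -/
theorem ModeSol.herm (hc : ModeCoeffs μ δ a b c d) (hγ : 0 < γ) (hγa : 2 * a < γ)
    (hγb : b + 2 * a ≤ γ * (δ / 2)) (h : ModeSol μ γ c g p v)
    (hg : ∀ k t, g (-k) t = starRingEnd ℂ (g k t)) :
    (∀ k t, p (-k) t = starRingEnd ℂ (p k t)) ∧
      ∀ k, ∀ᵐ t, v (-k) t = starRingEnd ℂ (v k t) := by
  have hr := h.reflect_conj hc hg
  have h0 := (h.sub hc hr).eq_zero hc hγ hγa hγb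
  have h1 : ∀ k t, p (-k) t = starRingEnd ℂ (p k t) := fun k t => by
    have := sub_eq_zero.1 (h0 (-k) t)
    rwa [neg_neg] at this
  refine ⟨h1, fun k => ?_⟩
  have e := (h.prim_p k).conj
  rw [← funext (h1 k)] at e
  exact (h.prim_p (-k)).ae_eq e

theorem ModeSol.l2Modes (h : ModeSol μ γ c g p v) :
    L2Modes fun k t => (Real.exp (-γ * t) : ℂ) * p k t := by
  refine h.memDx.of_le (c := 1) ENNReal.one_ne_top (fun k => ?_) fun k => ?_
  · have hexp : Continuous fun s : ℝ => (Real.exp (-γ * s) : ℂ) := by fun_prop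
    exact (hexp.mul (h.prim_p k).continuous).aestronglyMeasurable
  · rw [one_mul]
    refine lintegral_mono fun t => ?_
    rcases eq_or_ne k 0 with rfl | hk
    · simp [h.zero t]
    · have h1 : (1 : ℝ≥0∞) ≤ ‖(k : ℂ)‖ₑ := by
        rw [← ofReal_norm, Complex.norm_intCast]
        exact ENNReal.one_le_ofReal.2 (by exact_mod_cast Int.one_le_abs hk)
      simp only [enorm_mul]
      gcongr
      exact le_mul_of_one_le_left' h1

end

section

variable {γ : ℝ} {f : ℝ → Torus → ℝ}

theorem MemL2w.locallyIntegrable (hf : MemL2w γ f) :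
    LocallyIntegrable (fun p : ℝ × Torus => f p.1 p.2) volume := by
  have h1 := MemLp.locallyIntegrable hf (by norm_num)
  have hexp : Continuous fun p : ℝ × Torus => Real.exp (γ * p.1) := by fun_prop
  refine (congrArg (LocallyIntegrable · volume) (funext fun p => ?_)).mp
    (h1.continuous_smul hexp)
  rw [smul_eq_mul, ← mul_assoc, ← Real.exp_add]
  simp

theorem MemL2w.hasSum_pairing (hf : MemL2w γ f) {ψ : ℝ → Torus → ℝ} (hψ : IsTest ψ) :
    (∀ k, Integrable (fun t => modes f k t * starRingEnd ℂ (modes ψ k t)) volume) ∧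
    HasSum (fun k => ∫ t, modes f k t * starRingEnd ℂ (modes ψ k t))
      ((2 * Real.pi * ∫ t : ℝ, ∫ x, f t x * ψ t x : ℝ) : ℂ) := by
  have s := hf.l2Modes.sumInt_weight (hψ.l2Modes γ)
  refine ⟨s.integrable, ?_⟩
  convert s.hasSum using 1
  rw [← integral_const_mul, ← integral_complex_ofReal]
  refine integral_congr_ae ?_
  filter_upwards [hf.memLp_slice] with t ht
  exact (hasSum_coeff_mul_conj ht (hψ.memLp_slice t)).tsum_eq.symm

theorem isWeakDt_of_modes {u : ℝ → Torus → ℝ} {p v : ℤ → ℝ → ℂ} (hf : MemL2w γ f)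
    (hu : MemL2w γ u) (hp : ∀ k, modes f k =ᵐ[volume] p k) (hv : ∀ k, modes u k =ᵐ[volume] v k)
    (hpv : ∀ k, IsPrim (p k) (v k)) : IsWeakDt f u := by
  intro ψ hψ
  obtain ⟨i1, s1⟩ := hf.hasSum_pairing hψ.testDt
  obtain ⟨i2, s2⟩ := hu.hasSum_pairing hψ
  obtain ⟨i3, -⟩ := hf.hasSum_pairing hψ
  have e : ∀ k, (∫ t, modes f k t * starRingEnd ℂ (modes (testDt ψ) k t)) +
      ∫ t, modes u k t * starRingEnd ℂ (modes ψ k t) = 0 := fun k => by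
    have e1 : (fun t => modes f k t * starRingEnd ℂ (modes ψ k t)) =ᵐ[volume]
        fun t => p k t * starRingEnd ℂ (modes ψ k t) := by
      filter_upwards [hp k] with t ht
      rw [ht]
    have e2 : (fun t => modes f k t * starRingEnd ℂ (modes (testDt ψ) k t) +
        modes u k t * starRingEnd ℂ (modes ψ k t)) =ᵐ[volume]
        fun t => v k t * starRingEnd ℂ (modes ψ k t) +
          p k t * starRingEnd ℂ (modes (testDt ψ) k t) := by
      filter_upwards [hp k, hv k] with t h1 h2
      rw [h1, h2]; ring
    have i12 : Integrable (fun t => modes f k t * starRingEnd ℂ (modes (testDt ψ) k t) +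
        modes u k t * starRingEnd ℂ (modes ψ k t)) volume := (i1 k).add (i2 k)
    rw [← integral_add (i1 k) (i2 k), integral_congr_ae e2]
    exact ((hpv k).mul (hψ.isPrim_modes k).conj).integral_eq_zero ((i3 k).congr e1) (i12.congr e2)
  have s3 := s1.add s2
  simp only [e] at s3
  have h := s3.unique hasSum_zero
  rw [← Complex.ofReal_add, Complex.ofReal_eq_zero, ← mul_add] at h
  have := (mul_eq_zero.1 h).resolve_left Real.two_pi_pos.ne'
  linarith

theorem isWeakDx_of_modes {u : ℝ → Torus → ℝ} (hf : MemL2w γ f) (hu : MemL2w γ u)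
    (hfu : ∀ k, modes u k =ᵐ[volume] fun t => Complex.I * (k * modes f k t)) :
    IsWeakDx f u := by
  intro ψ hψ
  obtain ⟨i1, s1⟩ := hf.hasSum_pairing hψ.testDx
  obtain ⟨i2, s2⟩ := hu.hasSum_pairing hψ
  have e : ∀ k, (∫ t, modes f k t * starRingEnd ℂ (modes (testDx ψ) k t)) +
      ∫ t, modes u k t * starRingEnd ℂ (modes ψ k t) = 0 := fun k => by
    rw [← integral_add (i1 k) (i2 k), ← integral_zero]
    refine integral_congr_ae ?_
    filter_upwards [hfu k] with t ht
    simp only [ht, hψ.modes_testDx, map_mul, Complex.conj_I, map_intCast]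
    ring
  have s3 := s1.add s2
  simp only [e] at s3
  have h := s3.unique hasSum_zero
  rw [← Complex.ofReal_add, Complex.ofReal_eq_zero, ← mul_add] at h
  have := (mul_eq_zero.1 h).resolve_left Real.two_pi_pos.ne'
  linarith

end

/-- A solution of the equations of the Fourier coefficients yields a solution of the linearized
equation, with the corresponding norms. -/
theorem ModeSol.exists_isSolution {μ δ a b γ : ℝ} {c d p v : ℤ → ℝ → ℂ}
    {φ₀ g : ℝ → Torus → ℝ} (hc : ModeCoeffs μ δ a b c d)
    (hφ₀ : ∀ᵐ t, MemLp (φ₀ t) 2 volume)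
    (hcφ : ∀ᵐ t, ∀ j, c j t = coeff (φ₀ t) j / (2 * Real.pi)) (hγ : 0 < γ) (hγa : 2 * a < γ)
    (hγb : b + 2 * a ≤ γ * (δ / 2)) (hg : MemL2w γ g) (h : ModeSol μ γ c (modes g) p v) :
    ∃ φ φt φx, IsSolution μ γ φ₀ g φ φt φx ∧
      2 * Real.pi * (normSqL2w γ φt + normSqL2w γ φx) =
        modeSq (fun k t => (Real.exp (-γ * t) : ℂ) * v k t) +
          modeSq (fun k t => (Real.exp (-γ * t) : ℂ) * (k * p k t)) := by
  obtain ⟨hp, hv⟩ := h.herm hc hγ hγa hγb (modes_neg g)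
  have lx : L2Modes fun k t => (Real.exp (-γ * t) : ℂ) * (Complex.I * (k * p k t)) :=
    (h.memDx.const_mul Complex.I).congr fun k => Eventually.of_forall fun t => by
      simp only; ring
  obtain ⟨φ, mφ, eφ⟩ := exists_memL2w h.l2Modes fun k => Eventually.of_forall (hp k)
  obtain ⟨φt, mt, et⟩ := exists_memL2w h.memDt hv
  obtain ⟨φx, mx, ex⟩ := exists_memL2w lx fun k => Eventually.of_forall fun t => by
    simp only [hp, map_mul, Complex.conj_I, map_intCast]
    push_cast
    ring
  refine ⟨φ, φt, φx, ⟨mφ.locallyIntegrable, ?_, isWeakDt_of_modes mφ mt eφ et h.prim_p,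
    isWeakDx_of_modes mφ mx fun k => ?_, mt, mx, fun ψ hψ => ?_⟩, ?_⟩
  · filter_upwards [eφ 0] with t ht
    rw [modes, coeff_zero_eq, h.zero t] at ht
    exact Complex.ofReal_eq_zero.1 ht
  · filter_upwards [ex k, eφ k] with t h1 h2
    rw [h1, h2]
  · obtain ⟨hi, hs⟩ := hasSum_residual hc hφ₀ hcφ hg mt mx et eφ ex
      (Eventually.of_forall h.zero) hψ
    have e : ∀ k, ∫ t, residual μ c (modes g) p v (modes ψ k) (modes (testDt ψ) k) k t = 0 :=
      fun k => by
        have hP := ((h.prim_v k).mul (hψ.isPrim_modes k).conj).const_mul (-1)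
        have e1 : (fun t => -1 * ((modes g k t - modeOp μ c p k t) *
            starRingEnd ℂ (modes ψ k t) + v k t * starRingEnd ℂ (modes (testDt ψ) k t))) =
            residual μ c (modes g) p v (modes ψ k) (modes (testDt ψ) k) k := by
          funext t; simp only [residual]; ring
        rw [e1] at hP
        exact hP.integral_eq_zero
          (((h.memDt.sumInt_weight (hψ.l2Modes γ)).integrable k).const_mul _) (hi k)
    simp only [e] at hs
    have h1 := hs.unique hasSum_zero
    rw [Complex.ofReal_eq_zero] at h1
    exact sub_eq_zero.1 ((mul_eq_zero.1 h1).resolve_left Real.two_pi_pos.ne')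
  · rw [mul_add, ← mt.modeSq_eq, ← mx.modeSq_eq]
    congr 1
    · refine modeSq_congr fun k => ?_
      filter_upwards [et k] with t ht
      rw [ht]
    · unfold modeSq
      congr 1
      refine tsum_congr fun k => lintegral_congr_ae ?_
      filter_upwards [ex k] with t ht
      rw [ht, mul_left_comm, enorm_mul Complex.I, ← ofReal_norm Complex.I, Complex.norm_I,
        ENNReal.ofReal_one, one_mul]

/-- Two functions with the same Fourier coefficients in `x` are equal almost everywhere. -/
theorem ae_eq_of_modes_eq {f f' : ℝ → Torus → ℝ}
    (hf : LocallyIntegrable (fun p : ℝ × Torus => f p.1 p.2) volume)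
    (hf' : LocallyIntegrable (fun p : ℝ × Torus => f' p.1 p.2) volume)
    (h : ∀ k, modes f k =ᵐ[volume] modes f' k) : ∀ᵐ p : ℝ × Torus, f p.1 p.2 = f' p.1 p.2 := by
  have slice : ∀ {f : ℝ → Torus → ℝ}, LocallyIntegrable (fun p : ℝ × Torus => f p.1 p.2) volume →
      ∀ᵐ t, Integrable (f t) volume := fun {f} hf => by
    have hl : LocallyIntegrable (fun p : ℝ × Torus => (f p.1 p.2 : ℂ)) volume := by
      intro x
      obtain ⟨s, hs, hi⟩ := hf x
      exact ⟨s, hs, hi.ofReal⟩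
    filter_upwards [ae_integrable_slice hl] with t ht
    simpa using ht.re
  have hm : AEMeasurable (fun p : ℝ × Torus => ‖f p.1 p.2 - f' p.1 p.2‖ₑ) volume :=
    (hf.aestronglyMeasurable.sub hf'.aestronglyMeasurable).enorm
  have h0 : ∫⁻ p : ℝ × Torus, ‖f p.1 p.2 - f' p.1 p.2‖ₑ = 0 := by
    have hm' := hm
    rw [Measure.volume_eq_prod] at hm'
    refine (lintegral_prod _ hm').trans ?_
    rw [lintegral_eq_zero_iff' hm'.lintegral_prod_right']
    filter_upwards [slice hf, slice hf', ae_all_iff.2 h] with t h1 h2 h3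
    refine (lintegral_congr_ae ?_).trans lintegral_zero
    filter_upwards [ae_eq_of_coeff_eq h1 h2 h3] with x hx
    simp [hx]
  rw [lintegral_eq_zero_iff' hm] at h0
  filter_upwards [h0] with p hp
  exact sub_eq_zero.1 (enorm_eq_zero.1 hp)

end

end CurrentVortexSheet

theorem theorem3p2 :
    ∃ (C₀ : ℝ → ℝ) (γ₀ : ℝ → ℝ → ℝ → ℝ),
      (∀ δ : ℝ, 0 < δ → 0 < C₀ δ) ∧
      (∀ δ a b : ℝ, 0 < δ → 1 ≤ γ₀ δ a b) ∧
      ∀ (μ δ : ℝ) (φ₀ φ₀t : ℝ → Torus → ℝ), 0 < δ → IsBasicState μ δ φ₀ φ₀t →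
        ∀ γ : ℝ, γ₀ δ (normLinftyH 3 φ₀).toReal (normLinftyH 2 φ₀t).toReal ≤ γ →
          ∀ g : ℝ → Torus → ℝ, MemL2w γ g → ZeroMean g →
            ∃ φ φt φx : ℝ → Torus → ℝ,
              IsSolution μ γ φ₀ g φ φt φx ∧
              γ * (normSqL2w γ φt + normSqL2w γ φx) ≤ C₀ δ / γ * normSqL2w γ g ∧
              ∀ φ' φt' φx' : ℝ → Torus → ℝ, IsSolution μ γ φ₀ g φ' φt' φx' →
                ∀ᵐ p : ℝ × Torus, φ' p.1 p.2 = φ p.1 p.2 := by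
  -- `C₀` is the inverse square of the coercivity constant, and `γ₀` absorbs the error terms, which
  -- are bounded by the `ℓ¹` norms `coeffBound a`, `coeffBound b` of the Fourier coefficients
  refine ⟨fun δ => 1 / min (1 / 2) (δ / 4) ^ 2, fun δ a b => max 1 (max (4 * coeffBound a)
    ((coeffBound b + 2 * coeffBound a) / (δ / 4))), fun δ hδ => ?_, fun δ a b _ => le_max_left _ _,
    fun μ δ φ₀ φ₀t hδ hφ γ hγ g hg hg0 => ?_⟩
  · have : 0 < min (1 / 2) (δ / 4) := lt_min (by norm_num) (by linarith)
    positivity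
  obtain ⟨c, d, hc, hcφ⟩ := hφ.exists_modeCoeffs
  have hφ₀ := hφ.mem.memLp
  set a := coeffBound (normLinftyH 3 φ₀).toReal
  set b := coeffBound (normLinftyH 2 φ₀t).toReal
  have ha : 0 ≤ a := coeffBound_nonneg _
  have hb : 0 ≤ b := coeffBound_nonneg _
  have hγ1 : 1 ≤ γ := (le_max_left _ _).trans hγ
  have hγ2 := (le_max_right _ _).trans hγ
  have hγa : 4 * a ≤ γ := (le_max_left _ _).trans hγ2
  have hγb : b + 2 * a ≤ γ * (δ / 4) :=
    (div_le_iff₀ (by linarith)).1 ((le_max_right _ _).trans hγ2)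
  have hγ0 : 0 < γ := by linarith
  have hγa' : 2 * a < γ := by linarith
  have hγb' : b + 2 * a ≤ γ * (δ / 2) := by nlinarith
  obtain ⟨p, v, hpv, hle⟩ := exists_modeSol hc hγ0 hδ hγa hγb hg.l2Modes hg0.modes_zero
  obtain ⟨φ, φt, φx, hsol, hnorm⟩ :=
    hpv.exists_isSolution hc hφ₀ hcφ hγ0 hγa' hγb' hg
  refine ⟨φ, φt, φx, hsol, ?_, fun φ' φt' φx' h' => ?_⟩
  · rw [← hnorm, hg.modeSq_eq, mul_div_assoc] at hle
    have h1 := le_of_mul_le_mul_left hle Real.two_pi_pos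
    refine (mul_le_mul_of_nonneg_left h1 hγ0.le).trans (le_of_eq ?_)
    have hm : 0 < min (1 / 2) (δ / 4) := lt_min (by norm_num) (by linarith)
    field_simp
  · obtain ⟨p₁, v₁, h₁, e₁⟩ := hsol.exists_modeSol hc hφ₀ hcφ hg
    obtain ⟨p₂, v₂, h₂, e₂⟩ := h'.exists_modeSol hc hφ₀ hcφ hg
    have h0 := (h₂.sub hc h₁).eq_zero hc hγ0 hγa' hγb'
    refine ae_eq_of_modes_eq h'.locallyIntegrable hsol.locallyIntegrable fun k => ?_
    filter_upwards [e₁ k, e₂ k] with t t1 t2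
    rw [t1, t2]
    exact sub_eq_zero.1 (h0 k t)
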